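/- **Setting.** Let $E\subset\mathbb R^n$ be open with a fixed point $\Delta\in\partial E$, let $\mathbb U$ be a compact metric space, and let $\phi:\mathbb R^n\times[0,\infty)\to\mathbb R^n$ be continuous with $\phi(x,0)=x$ and $\phi(x,t+s)=\phi(\phi(x,t),s)$. For $x\in E$ put $t_*(x)=\inf\{t>0:\phi(x,t)\in\partial E\}\in(0,\infty]$, and $\phi(x,t_*(x)):=\Delta$ if $t_*(x)=\infty$. For $x\in\overline E$ let $\mathbb U(x)\subset\mathbb U$ be compact, with $\{(x,a):x\in\overline E,\ a\in\mathbb U(x)\}$ Borel. Let $\lambda,f:\overline E\times\mathbb U\to[0,\infty)$ and $r:\partial E\times\mathbb U\to[0,\infty)$ be Borel and let $Q$ be a stochastic kernel on $E$ given $\overline E\times\mathbb U$; write $Qh(x,a)=\int_E h(z)\,Q(x,a;dz)$. A *policy* $u\in\mathcal S_{\mathbb U}$ is a Borel map $u:\overline E\to\mathbb U$ with $u(x)\in\mathbb U(x)$ for all $x$. For $x\in E$, $\mathbb V^r(x)$ is the set of pairs $\Theta=(\mu,\mu_\partial)$, where $t\mapsto\mu(t)$ is a measurable family of probability measures on $\mathbb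 U$ with $\mu(t)(\mathbb U(\phi(x,t)))=1$ for a.e. $t\in[0,t_*(x))$ and $\mu_\partial$ is a probability measure on $\mathbb U$ with $\mu_\partial(\mathbb U(\phi(x,t_*(x))))=1$; $\mathbb V(x)$ is the set of pairs of a measurable $\nu:[0,\infty)\to\mathbb U$ with $\nu(t)\in\mathbb U(\phi(x,t))$ for $t<t_*(x)$ and a point of $\mathbb U(\phi(x,t_*(x)))$, seen as Dirac measures; and $u_\phi(x)=\big(u(\phi(x,\cdot)),u(\phi(x,t_*(x)))\big)\in\mathbb V(x)$ for a policy $u$. For $w\ge0$ put $w(y,\mu)=\int w(y,a)\,\mu(da)$. For $\Theta=(\mu,\mu_\partial)$ put $\Lambda^\mu(x,t)=\int_0^t\lambda(\phi(x,s),\mu(s))\,ds$ and $$Lv(x,\Theta)=\int_0^{t_*(x)}e^{-\Lambda^\mu(x,s)}v(\phi(x,s),\mu(s))\,ds,\qquad Hw(x,\Theta)=e^{-\Lambda^\mu(x,t_*(x))}w(\phi(x,t_*(x)),\mu_\partial),$$ $\mathcal L=L1$, and $Gh(x,\Theta)=L(\lambda Qh)(x,\Theta)+H(Qh)(x,\Theta)$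 for $h\ge0$, $Gh=Gh^+-Gh^-$ in general (with $e^{-\infty}=0$ and $0\cdot\infty=0$). For $\rho\in\mathbb R$ and $h:E\to\mathbb R$ Borel let $$\mathcal R(\rho,h)(x)=\inf_{\Theta\in\mathbb V^r(x)}\big\{-\rho\,\mathcal L(x,\Theta)+Lf(x,\Theta)+Hr(x,\Theta)+Gh(x,\Theta)\big\}.$$ **Assumptions.** 1. For $x\in E$, $\lambda(x,\cdot)$ is continuous on $\mathbb U(x)$; $\int_0^{t}\sup_{a\in\mathbb U(\phi(x,s))}\lambda(\phi(x,s),a)\,ds<\infty$ for $t<t_*(x)$, and for $t=t_*(x)$ if $t_*(x)<\infty$. For $y\in\overline E$, $f(y,\cdot)$ is continuous on $\mathbb U(y)$; for $z\in\partial E$, $r(z,\cdot)$ is continuous on $\mathbb U(z)$; for $x\in\overline E$ and $h$ bounded Borel on $E$, $Qh(x,\cdot)$ is continuous on $\mathbb U(x)$. 2. There are $b\ge0$, $c>0$, $\delta>0$, $M\ge0$, a Borel function $\overline r\ge0$ on $\partial E$ and a Borel function $g\ge1$ on $E$ such that, for each $x\in E$, $t\mapsto g(\phi(x,t))$ is locally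 absolutely continuous on $[0,t_*(x))$ and, if $t_*(x)<\infty$, has a limit as $t\uparrow t_*(x)$, denoted $g(\phi(x,t_*(x)))$; and a Borel $\mathcal Xg$ with $g(\phi(x,t))-g(x)=\int_0^t\mathcal Xg(\phi(x,s))\,ds$ for $x\in E$, $t<t_*(x)$. For all $x\in E$, $a\in\mathbb U(x)$: $\mathcal Xg(x)+cg(x)-\lambda(x,a)g(x)+\lambda(x,a)Qg(x,a)\le b$ and $f(x,a)\le Mg(x)$. For all $x\in E$ with $z:=\phi(x,t_*(x))$, $t_*(x)<\infty$, and all $a\in\mathbb U(z)$: $\overline r(z)+Qg(z,a)\le g(\phi(x,t_*(x)))$ and $r(z,a)\le\frac{M}{c+\delta}\overline r(z)$. 3. Let $\mathbb B_g(E)$ be the set of Borel $h:E\to\mathbb R$ with $\|h\|_g=\sup_x|h(x)|/g(x)<\infty$. There are $a>0$, $0<\kappa<1$ and, for each $u\in\mathcal S_{\mathbb U}$, a probability measure $\nu_u$ on $E$ with $\nu_u(g)<\infty$ and $|G^kh(x,u_\phi)-\nu_u(h)|\le a\|h\|_g\kappa^kg(x)$ for all $h\in\mathbb B_g(E)$,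 $k\ge0$, $x\in E$, where $G^kh(\cdot,u_\phi)$ is the $k$-th iterate of $h\mapsto Gh(\cdot,u_\phi(\cdot))$. 4. There are $0<k_g<1$, $K_g\ge0$ with $Gg(x,\Gamma)\le k_gg(x)+K_g$ for all $x\in E$, $\Gamma\in\mathbb V(x)$. 5. There are a Borel $\underline\lambda:E\to[0,\infty)$ and $K_\lambda\ge0$ such that, writing $\ell(x,t)=\int_0^t\underline\lambda(\phi(x,s))\,ds$: $\lambda(y,a)\ge\underline\lambda(y)$ for $y\in E$, $a\in\mathbb U(y)$; $\int_0^{t_*(x)}e^{ct-\ell(x,t)}dt\le K_\lambda$ for all $x\in E$; if $t_*(x)=\infty$, then $e^{ct-\ell(x,t)}\to0$ and $e^{-\ell(x,t)}g(\phi(x,t))\to0$ as $t\to\infty$; and $\int_0^{t_*(x)}e^{-\ell(x,t)}\sup_{a\in\mathbb U(\phi(x,t))}f(\phi(x,t),a)\,dt<\infty$ for all $x\in E$. **Proposition.** For every $u\in\mathcal S_{\mathbb U}$ there is exactly one pair $(\rho_u,h_u)\in\mathbb R\times\mathbb B_g(E)$ with $\nu_u(h_u)=0$ and $$h_u(x)=-\rho_u\mathcal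 L(x,u_\phi(x))+Lf(x,u_\phi(x))+Hr(x,u_\phi(x))+Gh_u(x,u_\phi(x))\qquad\text{for all }x\in E.$$ All terms in the infimum defining $\mathcal R(\rho_u,h_u)(x)$ are finite, and there is $\widehat u\in\mathcal S_{\mathbb U}$ such that for all $x\in E$ $$\mathcal R(\rho_u,h_u)(x)=-\rho_u\mathcal L(x,\widehat u_\phi(x))+Lf(x,\widehat u_\phi(x))+Hr(x,\widehat u_\phi(x))+Gh_u(x,\widehat u_\phi(x)),$$ and $\rho_{\widehat u}\le\rho_u$. -/

import Mathlib

open MeasureTheory ProbabilityTheory Filter Topology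
open scoped ENNReal NNReal

noncomputable section

/-- The local characteristics and the costs of a controlled piecewise deterministic Markov process
with state space an open set `E ⊆ ℝⁿ` and compact metric action space `𝕌`.
A Borel function on a Borel subset of `ℝⁿ` (such as `E`, `closure E` or `frontier E`) is given
throughout by a Borel function on `ℝⁿ`; its values off that subset never play a role. -/
structure PDMP (n : ℕ) (𝕌 : Type*) [MetricSpace 𝕌] [MeasurableSpace 𝕌] where
  /-- the state space -/
  E : Set (EuclideanSpace ℝ (Fin n))
  isOpen_E : IsOpen E
  /-- the flow, a continuous semiflow on `ℝⁿ` -/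
  flow : EuclideanSpace ℝ (Fin n) → ℝ≥0 → EuclideanSpace ℝ (Fin n)
  continuous_flow : Continuous (Function.uncurry flow)
  flow_zero : ∀ x, flow x 0 = x
  flow_add : ∀ x t s, flow x (t + s) = flow (flow x t) s
  /-- the conventional exit point of a flow line that never reaches the boundary -/
  Δ : EuclideanSpace ℝ (Fin n)
  Δ_mem : Δ ∈ frontier E
  /-- the feasible actions at a point of `closure E` -/
  A : EuclideanSpace ℝ (Fin n) → Set 𝕌
  isCompact_A : ∀ x ∈ closure E, IsCompact (A x)
  measurableSet_graph :
    MeasurableSet {p : EuclideanSpace ℝ (Fin n) × 𝕌 | p.1 ∈ closure E ∧ p.2 ∈ A p.1}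
  /-- the jump rate -/
  lam : EuclideanSpace ℝ (Fin n) → 𝕌 → ℝ≥0
  measurable_lam : Measurable (Function.uncurry lam)
  /-- the post-jump transition kernel -/
  Q : Kernel (EuclideanSpace ℝ (Fin n) × 𝕌) E
  markov_Q : IsMarkovKernel Q
  /-- the running cost -/
  f : EuclideanSpace ℝ (Fin n) → 𝕌 → ℝ≥0
  measurable_f : Measurable (Function.uncurry f)
  /-- the boundary cost -/
  r : EuclideanSpace ℝ (Fin n) → 𝕌 → ℝ≥0
  measurable_r : Measurable (Function.uncurry r)

/-- A relaxed control: a measurable family `(μ(t, ·))` of probability measures on the action space,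
and a probability measure on the action space used at the boundary. (Only the values at times
`t ≥ 0` matter.) -/
structure RelaxedControl (𝕌 : Type*) [MeasurableSpace 𝕌] where
  μ : Kernel ℝ 𝕌
  markov_μ : IsMarkovKernel μ
  bdry : Measure 𝕌
  prob_bdry : IsProbabilityMeasure bdry

/-- An ordinary control: a measurable action-valued function of time and a boundary action. -/
structure OrdinaryControl (𝕌 : Type*) [MeasurableSpace 𝕌] where
  ν : ℝ → 𝕌
  measurable_ν : Measurable ν
  bdry : 𝕌

/-- An ordinary control seen as a relaxed control through Dirac measures. -/
def OrdinaryControl.toRelaxed {𝕌 : Type*} [MeasurableSpace 𝕌] (Γ : OrdinaryControl 𝕌) :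
    RelaxedControl 𝕌 where
  μ := Kernel.deterministic Γ.ν Γ.measurable_ν
  markov_μ := inferInstance
  bdry := Measure.dirac Γ.bdry
  prob_bdry := inferInstance

/-- The times `s ∈ [0, t)`, for `t ∈ [0, ∞]`. -/
def timesBefore (t : ℝ≥0∞) : Set ℝ := {s | 0 ≤ s ∧ ENNReal.ofReal s < t}

namespace PDMP

variable {n : ℕ} {𝕌 : Type*} [MetricSpace 𝕌] [MeasurableSpace 𝕌]

/-- The flow line of `x` with real time parameter (constant equal to `x` at negative times). -/
def path (D : PDMP n 𝕌) (x : EuclideanSpace ℝ (Fin n)) (s : ℝ) : EuclideanSpace ℝ (Fin n) :=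
  D.flow x s.toNNReal

theorem measurable_path (D : PDMP n 𝕌) (x : EuclideanSpace ℝ (Fin n)) :
    Measurable (D.path x) := by
  have h : Continuous fun s : ℝ => Function.uncurry D.flow (x, s.toNNReal) :=
    D.continuous_flow.comp (continuous_const.prodMk continuous_real_toNNReal)
  exact h.measurable

/-- `t_*(x) = inf {t > 0 : φ(x,t) ∈ ∂E}`, with value `∞` if the boundary is never reached. -/
def tstar (D : PDMP n 𝕌) (x : EuclideanSpace ℝ (Fin n)) : ℝ≥0∞ :=
  sInf {t : ℝ≥0∞ | ∃ s : ℝ≥0, 0 < s ∧ D.flow x s ∈ frontier D.E ∧ t = s}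

open Classical in
/-- `φ(x, t_*(x))`, equal to `Δ` if `t_*(x) = ∞`. -/
def exit (D : PDMP n 𝕌) (x : EuclideanSpace ℝ (Fin n)) : EuclideanSpace ℝ (Fin n) :=
  if D.tstar x = ⊤ then D.Δ else D.flow x (D.tstar x).toNNReal

/-- The set `𝕍ʳ(x)` of relaxed controls that are feasible from `x`. -/
def relaxedControls (D : PDMP n 𝕌) (x : D.E) : Set (RelaxedControl 𝕌) :=
  {Θ | (∀ᵐ s : ℝ, s ∈ timesBefore (D.tstar x) → Θ.μ s (D.A (D.path x s)) = 1) ∧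
    Θ.bdry (D.A (D.exit x)) = 1}

/-- The set `𝕍(x)` of ordinary controls that are feasible from `x`. -/
def ordinaryControls (D : PDMP n 𝕌) (x : D.E) : Set (OrdinaryControl 𝕌) :=
  {Γ | (∀ s ∈ timesBefore (D.tstar x), Γ.ν s ∈ D.A (D.path x s)) ∧ Γ.bdry ∈ D.A (D.exit x)}

/-- The set `𝒮_𝕌` of measurable selectors of the feasible action sets on `closure E`. -/
structure Policy (D : PDMP n 𝕌) where
  toFun : EuclideanSpace ℝ (Fin n) → 𝕌
  measurable_toFun : Measurable toFun
  mem_A : ∀ x ∈ closure D.E, toFun x ∈ D.A x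

/-- The feedback control `u_φ(x) = (u(φ(x, ·)), u(φ(x, t_*(x))))`, as an ordinary control. -/
def Policy.feedbackOrdinary {D : PDMP n 𝕌} (u : D.Policy) (x : D.E) : OrdinaryControl 𝕌 where
  ν := fun s => u.toFun (D.path x s)
  measurable_ν := u.measurable_toFun.comp (D.measurable_path x)
  bdry := u.toFun (D.exit x)

/-- The feedback control `u_φ(x)`, as a relaxed control. -/
def Policy.feedback {D : PDMP n 𝕌} (u : D.Policy) (x : D.E) : RelaxedControl 𝕌 :=
  (u.feedbackOrdinary x).toRelaxed

/-! ### The operators -/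

/-- `Λ^μ(x,t) = ∫₀ᵗ λ(φ(x,s), μ(s)) ds`, for `t ∈ [0, ∞]`. -/
def Lam (D : PDMP n 𝕌) (x : D.E) (Θ : RelaxedControl 𝕌) (t : ℝ≥0∞) : ℝ≥0∞ :=
  ∫⁻ s in timesBefore t, ∫⁻ a, (D.lam (D.path x s) a : ℝ≥0∞) ∂(Θ.μ s)

/-- The survival factor `exp(-Λ^μ(x,t)) ∈ [0, 1]`. -/
def surv (D : PDMP n 𝕌) (x : D.E) (Θ : RelaxedControl 𝕌) (t : ℝ≥0∞) : ℝ≥0∞ :=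
  EReal.exp (-(D.Lam x Θ t : EReal))

/-- `Lv(x,Θ) = ∫₀^{t_*(x)} exp(-Λ^μ(x,s)) v(φ(x,s), μ(s)) ds`, for `v ≥ 0`. -/
def L (D : PDMP n 𝕌) (v : EuclideanSpace ℝ (Fin n) → 𝕌 → ℝ≥0∞) (x : D.E)
    (Θ : RelaxedControl 𝕌) : ℝ≥0∞ :=
  ∫⁻ s in timesBefore (D.tstar x),
    D.surv x Θ (ENNReal.ofReal s) * ∫⁻ a, v (D.path x s) a ∂(Θ.μ s)

/-- `Hw(x,Θ) = exp(-Λ^μ(x,t_*(x))) w(φ(x,t_*(x)), μ_∂)`, for `w ≥ 0`. -/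
def H (D : PDMP n 𝕌) (w : EuclideanSpace ℝ (Fin n) → 𝕌 → ℝ≥0∞) (x : D.E)
    (Θ : RelaxedControl 𝕌) : ℝ≥0∞ :=
  D.surv x Θ (D.tstar x) * ∫⁻ a, w (D.exit x) a ∂Θ.bdry

/-- `Gh(x,Θ)` for `h ≥ 0`: the integral of `h` against the kernel
`G(x,Θ;B) = ∫₀^{t_*(x)} exp(-Λ^μ(x,s)) λQ1_B(φ(x,s), μ(s)) ds
  + exp(-Λ^μ(x,t_*(x))) Q(φ(x,t_*(x)), μ_∂; B)`, where
`λQh(y,μ) = ∫ λ(y,a) (∫ h(z) Q(y,a;dz)) μ(da)`. -/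
def Gpos (D : PDMP n 𝕌) (h : D.E → ℝ≥0∞) (x : D.E) (Θ : RelaxedControl 𝕌) : ℝ≥0∞ :=
  (∫⁻ s in timesBefore (D.tstar x), D.surv x Θ (ENNReal.ofReal s) *
      ∫⁻ a, (D.lam (D.path x s) a : ℝ≥0∞) * ∫⁻ z, h z ∂(D.Q (D.path x s, a)) ∂(Θ.μ s))
    + D.surv x Θ (D.tstar x) * ∫⁻ a, ∫⁻ z, h z ∂(D.Q (D.exit x, a)) ∂Θ.bdry

/-- `Gh(x,Θ) = Gh⁺(x,Θ) - Gh⁻(x,Θ)` for real-valued `h`. -/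
def G (D : PDMP n 𝕌) (h : D.E → ℝ) (x : D.E) (Θ : RelaxedControl 𝕌) : EReal :=
  (D.Gpos (fun z => ENNReal.ofReal (h z)) x Θ : EReal)
    - (D.Gpos (fun z => ENNReal.ofReal (-h z)) x Θ : EReal)

/-- `-ρ ℒ(x,Θ) + Lf(x,Θ) + Hr(x,Θ) + Gh(x,Θ)`, where `ℒ = L1`. -/
def objective (D : PDMP n 𝕌) (ρ : ℝ) (h : D.E → ℝ) (x : D.E) (Θ : RelaxedControl 𝕌) : EReal :=
  ((-ρ : ℝ) : EReal) * (D.L (fun _ _ => 1) x Θ : EReal)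
    + (D.L (fun y a => (D.f y a : ℝ≥0∞)) x Θ : EReal)
    + (D.H (fun y a => (D.r y a : ℝ≥0∞)) x Θ : EReal)
    + D.G h x Θ

/-- All the terms of the objective are finite, so that the objective is a well-defined real. -/
def ObjectiveFinite (D : PDMP n 𝕌) (h : D.E → ℝ) (x : D.E) (Θ : RelaxedControl 𝕌) : Prop :=
  D.L (fun _ _ => 1) x Θ < ⊤ ∧ D.L (fun y a => (D.f y a : ℝ≥0∞)) x Θ < ⊤ ∧
    D.H (fun y a => (D.r y a : ℝ≥0∞)) x Θ < ⊤ ∧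
    D.Gpos (fun z => ENNReal.ofReal (h z)) x Θ < ⊤ ∧
    D.Gpos (fun z => ENNReal.ofReal (-h z)) x Θ < ⊤

/-- The relaxed one-stage optimization operator `ℛ(ρ,h)(x)`. -/
def R (D : PDMP n 𝕌) (ρ : ℝ) (h : D.E → ℝ) (x : D.E) : EReal :=
  ⨅ Θ ∈ D.relaxedControls x, D.objective ρ h x Θ

/-- `Gᵏh(x, u_φ)`, the `k`-th iterate of `h ↦ Gh(·, u_φ(·))`. -/
def Giter (D : PDMP n 𝕌) (u : D.Policy) (k : ℕ) (h : D.E → ℝ) : D.E → ℝ :=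
  (fun (v : D.E → ℝ) (x : D.E) => (D.G v x (u.feedback x)).toReal)^[k] h

/-! ### Weighted sup-norm and functions along the flow -/

/-- `h ∈ 𝔹_g(E)`: `h` is measurable and `|h| / g` is bounded. -/
def MemBg (D : PDMP n 𝕌) (g : EuclideanSpace ℝ (Fin n) → ℝ) (h : D.E → ℝ) : Prop :=
  Measurable h ∧ BddAbove (Set.range fun x : D.E => |h x| / g x)

/-- `‖h‖_g = sup_x |h(x)| / g(x)`. -/
def normBg (D : PDMP n 𝕌) (g : EuclideanSpace ℝ (Fin n) → ℝ) (h : D.E → ℝ) : ℝ :=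
  ⨆ x : D.E, |h x| / g x

/-- `ℓ` is the boundary value `g(φ(x,t_*(x)))`, that is the limit of `g(φ(x,t))` as `t ↑ t_*(x)`. -/
def IsBoundaryValue (D : PDMP n 𝕌) (g : EuclideanSpace ℝ (Fin n) → ℝ) (x : D.E) (ℓ : ℝ) : Prop :=
  Tendsto (fun t => g (D.path x t)) (𝓝[<] (D.tstar x).toReal) (𝓝 ℓ)

/-- `g ∈ 𝕄^{ac}(E)`: `g` is (locally) absolutely continuous along the flow, with a limit at the
boundary. -/
structure MemMac (D : PDMP n 𝕌) (g : EuclideanSpace ℝ (Fin n) → ℝ) : Prop where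
  measurable : Measurable g
  absCont : ∀ x : D.E, ∀ t ∈ timesBefore (D.tstar x),
    AbsolutelyContinuousOnInterval (fun s => g (D.path x s)) 0 t
  limit : ∀ x : D.E, D.tstar x ≠ ⊤ → ∃ ℓ, D.IsBoundaryValue g x ℓ

/-- `Xg` is a version of `𝒳g`: `g(φ(x,t)) - g(x) = ∫₀ᵗ 𝒳g(φ(x,s)) ds` for `t ∈ [0,t_*(x))`. -/
structure IsFlowDeriv (D : PDMP n 𝕌) (g Xg : EuclideanSpace ℝ (Fin n) → ℝ) : Prop where
  measurable : Measurable Xg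
  integrable : ∀ x : D.E, ∀ t ∈ timesBefore (D.tstar x),
    IntervalIntegrable (fun s => Xg (D.path x s)) volume 0 t
  integral_eq : ∀ x : D.E, ∀ t ∈ timesBefore (D.tstar x),
    g (D.path x t) - g x = ∫ s in (0 : ℝ)..t, Xg (D.path x s)

/-! ### Assumptions -/

/-- Continuity in the action and local integrability of the jump rate along the flow. -/
structure ContinuityAssumptions (D : PDMP n 𝕌) : Prop where
  lam_cont : ∀ x ∈ D.E, ContinuousOn (D.lam x) (D.A x)
  lam_int : ∀ x : D.E, ∀ t ∈ timesBefore (D.tstar x),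
    ∫⁻ s in timesBefore (ENNReal.ofReal t),
      ⨆ a ∈ D.A (D.path x s), (D.lam (D.path x s) a : ℝ≥0∞) < ⊤
  lam_int_tstar : ∀ x : D.E, D.tstar x ≠ ⊤ →
    ∫⁻ s in timesBefore (D.tstar x),
      ⨆ a ∈ D.A (D.path x s), (D.lam (D.path x s) a : ℝ≥0∞) < ⊤
  f_cont : ∀ y ∈ closure D.E, ContinuousOn (D.f y) (D.A y)
  r_cont : ∀ z ∈ frontier D.E, ContinuousOn (D.r z) (D.A z)
  Q_cont : ∀ x ∈ closure D.E, ∀ h : D.E → ℝ, Measurable h → (∃ C, ∀ z, |h z| ≤ C) →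
    ContinuousOn (fun a => ∫ z, h z ∂(D.Q (x, a))) (D.A x)

/-- The expected growth condition. The term `λ(x,a) Qg(x,a) ∈ [0,∞]` is computed as a
Lebesgue integral of a nonnegative function. -/
structure GrowthCondition (D : PDMP n 𝕌) (b c δ M : ℝ) (g : EuclideanSpace ℝ (Fin n) → ℝ)
    (rbar : EuclideanSpace ℝ (Fin n) → ℝ≥0) : Prop where
  b_nonneg : 0 ≤ b
  c_pos : 0 < c
  δ_pos : 0 < δ
  M_nonneg : 0 ≤ M
  g_mac : D.MemMac g
  one_le_g : ∀ x ∈ D.E, 1 ≤ g x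
  measurable_rbar : Measurable rbar
  drift : ∃ Xg, D.IsFlowDeriv g Xg ∧ ∀ x ∈ D.E, ∀ a ∈ D.A x,
    ((Xg x + c * g x - D.lam x a * g x : ℝ) : EReal)
      + (((D.lam x a : ℝ≥0∞) * ∫⁻ z : D.E, ENNReal.ofReal (g z) ∂(D.Q (x, a)) : ℝ≥0∞) : EReal)
      ≤ (b : EReal)
  f_le : ∀ x ∈ D.E, ∀ a ∈ D.A x, (D.f x a : ℝ) ≤ M * g x
  boundary : ∀ x : D.E, D.tstar x ≠ ⊤ → ∀ ℓ, D.IsBoundaryValue g x ℓ → ∀ a ∈ D.A (D.exit x),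
    (rbar (D.exit x) : ℝ≥0∞) + ∫⁻ z : D.E, ENNReal.ofReal (g z) ∂(D.Q (D.exit x, a))
      ≤ ENNReal.ofReal ℓ
  r_le : ∀ x : D.E, D.tstar x ≠ ⊤ → ∀ a ∈ D.A (D.exit x),
    (D.r (D.exit x) a : ℝ) ≤ M / (c + δ) * rbar (D.exit x)

/-- Geometric ergodicity of the post-jump kernels `G(x, u_φ; ·)`, with limit laws `ν u`. -/
structure GeometricErgodicity (D : PDMP n 𝕌) (g : EuclideanSpace ℝ (Fin n) → ℝ) (a κ : ℝ)
    (ν : D.Policy → Measure D.E) : Prop where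
  a_pos : 0 < a
  κ_pos : 0 < κ
  κ_lt_one : κ < 1
  prob : ∀ u, IsProbabilityMeasure (ν u)
  g_int : ∀ u, ∫⁻ z : D.E, ENNReal.ofReal (g z) ∂(ν u) < ⊤
  conv : ∀ (u : D.Policy) (h : D.E → ℝ), D.MemBg g h → ∀ (k : ℕ) (x : D.E),
    |D.Giter u k h x - ∫ z, h z ∂(ν u)| ≤ a * D.normBg g h * κ ^ k * g x

/-- The Lyapunov inequality for `G`. -/
structure LyapunovCondition (D : PDMP n 𝕌) (g : EuclideanSpace ℝ (Fin n) → ℝ) (kg Kg : ℝ) :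
    Prop where
  kg_pos : 0 < kg
  kg_lt_one : kg < 1
  Kg_nonneg : 0 ≤ Kg
  le : ∀ x : D.E, ∀ Γ ∈ D.ordinaryControls x,
    D.Gpos (fun z => ENNReal.ofReal (g z)) x Γ.toRelaxed ≤ ENNReal.ofReal (kg * g x + Kg)

/-- `∫₀ᵗ λ_(φ(x,s)) ds` for a lower bound `λ_` of the jump rate. -/
def lowInt (D : PDMP n 𝕌) (lamLow : EuclideanSpace ℝ (Fin n) → ℝ≥0) (x : D.E) (t : ℝ) : ℝ≥0∞ :=
  ∫⁻ s in timesBefore (ENNReal.ofReal t), (lamLow (D.path x s) : ℝ≥0∞)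

/-- The conditions on a lower bound `lamLow` of the jump rate. -/
structure JumpRateBounds (D : PDMP n 𝕌) (c : ℝ) (g : EuclideanSpace ℝ (Fin n) → ℝ)
    (lamLow : EuclideanSpace ℝ (Fin n) → ℝ≥0) (Klam : ℝ≥0) : Prop where
  measurable : Measurable lamLow
  le_lam : ∀ y ∈ D.E, ∀ a ∈ D.A y, lamLow y ≤ D.lam y a
  int_le : ∀ x : D.E, ∫⁻ t in timesBefore (D.tstar x),
    EReal.exp (((c * t : ℝ) : EReal) - (D.lowInt lamLow x t : EReal)) ≤ (Klam : ℝ≥0∞)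
  tendsto_exp : ∀ x : D.E, D.tstar x = ⊤ →
    Tendsto (fun t : ℝ => EReal.exp (((c * t : ℝ) : EReal) - (D.lowInt lamLow x t : EReal)))
      atTop (𝓝 0)
  tendsto_g : ∀ x : D.E, D.tstar x = ⊤ →
    Tendsto (fun t : ℝ => EReal.exp (-(D.lowInt lamLow x t : EReal))
      * ENNReal.ofReal (g (D.path x t))) atTop (𝓝 0)
  f_int : ∀ x : D.E, ∫⁻ t in timesBefore (D.tstar x),
    EReal.exp (-(D.lowInt lamLow x t : EReal))
      * ⨆ a ∈ D.A (D.path x t), (D.f (D.path x t) a : ℝ≥0∞) < ⊤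

/-! ### The pseudo-Poisson equation -/

/-- `(ρ,h) ∈ ℝ × 𝔹_g(E)` solves the pseudo-Poisson equation
`h(x) = -ρ ℒ(x,u_φ(x)) + Lf(x,u_φ(x)) + Hr(x,u_φ(x)) + Gh(x,u_φ(x))` associated with `u`, with the
normalization `ν_u(h) = 0`. -/
structure IsPoissonPair (D : PDMP n 𝕌) (g : EuclideanSpace ℝ (Fin n) → ℝ)
    (ν : D.Policy → Measure D.E) (u : D.Policy) (ρ : ℝ) (h : D.E → ℝ) : Prop where
  memBg : D.MemBg g h
  eq : ∀ x : D.E, (h x : EReal) = D.objective ρ h x (u.feedback x)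
  normalized : ∫ z, h z ∂(ν u) = 0

end PDMP

end

/-!
Write `G_u` for the post-jump operator of a policy `u`, and `J_{ρ,h}(x, Θ)` for the objective in the
infimum that defines `ℛ(ρ,h)(x)`; as a real number it is `objR`.

*Finiteness.* The survival factor `exp (-Λ)` times `g` has, along a flow line, the derivative
`exp (-Λ) (𝒳g - λ g)` (`exp_neg_integral_mul_eq`). With the drift inequality this shows
`c L g + H rbar + G g ≤ g + b K_λ` for every feasible relaxed control (`drift_bound`), so that all
terms of `J_{ρ,h}` are finite and of order `g` when `h ∈ 𝔹_g` (`objective_eq`, `objectiveFinite`,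
`exists_abs_objR_le`). Since `G` is integration against a measure `Gmeas`, it is linear there.

*The Poisson equation.* Comparing `G_u^k` with `G_u^(k+1)`, the limit law `ν_u` is invariant under
`G_u` (`integral_step`). Integrating the equation against `ν_u` forces
`ρ_u = ν_u(Lf + Hr) / ν_u(ℒ)`. For this value the remaining cost has `ν_u`-mean zero, so its
iterates under `G_u` decay geometrically and their sum is a solution (`exists_poissonPair`). The
difference of two solutions is fixed by `G_u`, hence equal to its `ν_u`-mean
(`poissonPair_unique`).

*Lower semicontinuity.* By assumption `a ↦ Qh(x,a)` is continuous only for bounded `h`, and `h_u` is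
merely of order `g`. However, `Lf` and `Hr` are nonnegative and `ℒ` is bounded, so the first `N`
terms of the series of `h_u` are bounded below, and its tail is at most a small multiple of `g`:
thus `h_u ≥ -ε g - C_ε` for every `ε > 0` (`IsPoissonPair.exists_lower_bound`). That suffices for
`a ↦ λ(x,a) Qh_u(x,a)` to be lower semicontinuous (`lowerSemicontinuousOn_mul_integral`). Lower
semicontinuous functions on the compact sets `𝕌(x)` have Borel minimizers
(`exists_measurable_argmin`): projections of Borel sets with compact sections are Borel, by
Novikov's separation theorem (`seqMeasurablySeparable_of_analyticSet`).

*The optimal policy.* For a policy `u'`, the function `W(x) = J_{ρ,h}(x, u'_φ(x))` solves along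
flow lines the equation `W' = ρ - (f + λ Qh - λ W)` with the boundary value `r + Qh`
(`isFlowSolution_value`). For every relaxed control `Θ`, the difference `J_{ρ,h}(x, Θ) - W(x)` is
the discounted integral of the excess of the Hamiltonian `f + λ Qh - λ W` under `Θ` over the one
under `u'`, plus a boundary excess (`IsFlowSolution.tendsto_gap`). Choosing minimizers of the
Hamiltonian therefore improves a policy (`IsFlowSolution.objR_feedback_le`). Policy iteration gives
a decreasing sequence of values; its limit is again a flow solution, now with a minimizing policy
`û` (`exists_isFlowSolution_isMinimizing`, by dominated convergence with `hamBound`), and then the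
excess of every relaxed control is nonnegative: `û` attains the infimum (`IsFlowSolution.le_objR`).

*The gain.* As `u` itself is feasible, `h_u(x) ≥ J_{ρ_u,h_u}(x, û_φ(x))`. Integrating against
`ν_û`, which is invariant under `G_û`, cancels `h_u` and leaves `ρ_û ≤ ρ_u` (`gain_le`).
-/

noncomputable section

/-! ### Novikov separation and projections of Borel sets with compact sections -/

/-- A sequence of sets is separated if it has measurable supersets without a common point. -/
def SeqMeasurablySeparable {α : Type*} [MeasurableSpace α] (S : ℕ → Set α) : Prop :=
  ∃ B : ℕ → Set α, (∀ n, MeasurableSet (B n)) ∧ (∀ n, S n ⊆ B n) ∧ ⋂ n, B n = ∅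

theorem SeqMeasurablySeparable.mono {α : Type*} [MeasurableSpace α] {S S' : ℕ → Set α}
    (h : SeqMeasurablySeparable S) (hS : ∀ n, S' n ⊆ S n) : SeqMeasurablySeparable S' := by
  obtain ⟨B, hB, hSB, hB0⟩ := h
  exact ⟨B, hB, fun n => (hS n).trans (hSB n), hB0⟩

/-- Separation may be checked after splitting one of the sets into countably many pieces. -/
theorem SeqMeasurablySeparable.of_split {α : Type*} [MeasurableSpace α] {S : ℕ → Set α} (i : ℕ)
    (T : ℕ → ℕ → Set α) (hi : S i ⊆ ⋃ k, T k i) (hn : ∀ k, ∀ n ≠ i, S n ⊆ T k n)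
    (h : ∀ k, SeqMeasurablySeparable (T k)) : SeqMeasurablySeparable S := by
  choose B hB hTB hB0 using h
  refine ⟨fun n => if n = i then ⋃ k, B k n else ⋂ k, B k n, fun n => ?_, fun n => ?_, ?_⟩
  · dsimp only
    split_ifs
    · exact MeasurableSet.iUnion fun k => hB k n
    · exact MeasurableSet.iInter fun k => hB k n
  · dsimp only
    split_ifs with h
    · subst h
      exact hi.trans (Set.iUnion_mono fun k => hTB k n)
    · exact Set.subset_iInter fun k => (hn k n h).trans (hTB k n)
  · refine Set.eq_empty_of_forall_notMem fun x hx => ?_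
    rw [Set.mem_iInter] at hx
    have hxi := hx i
    rw [if_pos rfl, Set.mem_iUnion] at hxi
    obtain ⟨k, hk⟩ := hxi
    have : x ∈ ⋂ n, B k n := by
      refine Set.mem_iInter.2 fun n => ?_
      by_cases h : n = i
      · exact h ▸ hk
      · have := hx n
        rw [if_neg h, Set.mem_iInter] at this
        exact this k
    rw [hB0 k] at this
    exact this

/-- The points of Baire space whose coordinates are prescribed by the first `m` entries of `j`:
entry `Nat.pair n p` of `j` prescribes coordinate `p` of the `n`-th point. -/
def codeSet (j : ℕ → ℕ) (m n : ℕ) : Set (ℕ → ℕ) :=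
  {z | ∀ m' < m, (Nat.unpair m').1 = n → z (Nat.unpair m').2 = j m'}

theorem codeSet_congr {j j' : ℕ → ℕ} {m : ℕ} (h : ∀ i < m, j i = j' i) (n : ℕ) :
    codeSet j m n = codeSet j' m n := by
  ext z
  simp only [codeSet, Set.mem_ofPred_eq]
  exact forall_congr' fun i => forall_congr' fun hi => by rw [h i hi]

/-- Recursive choice of a sequence whose initial segments all satisfy `P`, where `P m j` depends only
on the first `m` entries of `j`. -/
theorem exists_seq_of_step {P : ℕ → (ℕ → ℕ) → Prop} (h0 : P 0 0)
    (hstep : ∀ m j, P m j → ∃ k, P (m + 1) (Function.update j m k))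
    (hcongr : ∀ m j j', (∀ i < m, j i = j' i) → P m j → P m j') : ∃ j, ∀ m, P m j := by
  choose! K hK using hstep
  let J : ℕ → (ℕ → ℕ) := fun m => Nat.rec 0 (fun m j => Function.update j m (K m j)) m
  have hJs : ∀ m, J (m + 1) = Function.update (J m) m (K m (J m)) := fun m => rfl
  have hJ : ∀ m, P m (J m) := by
    intro m
    induction m with
    | zero => exact h0
    | succ m ih => rw [hJs]; exact hK m _ ih
  have hst : ∀ i m, i < m → J m i = J (i + 1) i := by
    intro i m him
    induction m with
    | zero => omega
    | succ m ih =>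
      rcases Nat.lt_succ_iff_lt_or_eq.1 him with h | h
      · rw [hJs, Function.update_of_ne h.ne, ih h]
      · rw [h]
  exact ⟨fun i => J (i + 1) i, fun m => hcongr m _ _ (fun i hi => hst i m hi) (hJ m)⟩

/-- **Novikov's separation theorem**: a sequence of analytic sets without a common point can be
enlarged to Borel sets without a common point. Otherwise non-separation persists along finer and
finer codes of pieces of the sets; these shrink to one point in each set, two of which differ, and
disjoint neighbourhoods of the two separate a late piece of the code. -/
theorem seqMeasurablySeparable_of_analyticSet {α : Type*} [TopologicalSpace α] [T2Space α]
    [MeasurableSpace α] [OpensMeasurableSpace α] {A : ℕ → Set α} (hA : ∀ n, AnalyticSet (A n))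
    (h0 : ⋂ n, A n = ∅) : SeqMeasurablySeparable A := by
  by_cases hne : ∃ n, A n = ∅
  · obtain ⟨n, hn⟩ := hne
    refine ⟨fun i => if i = n then ∅ else Set.univ, fun i => ?_, fun i => ?_, ?_⟩
    · dsimp only; split_ifs <;> simp
    · dsimp only
      split_ifs with h
      · rw [h, hn]
      · exact Set.subset_univ _
    · exact Set.eq_empty_of_forall_notMem fun x hx => by simpa using Set.mem_iInter.1 hx n
  push Not at hne
  have hf : ∀ n, ∃ f : (ℕ → ℕ) → α, Continuous f ∧ Set.range f = A n := fun n => by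
    have hAn := hA n
    rw [AnalyticSet] at hAn
    rcases hAn with h | h
    · exact absurd h (hne n).ne_empty
    · exact h
  choose f hfc hfr using hf
  by_contra hsep
  obtain ⟨j, hj⟩ := exists_seq_of_step
    (P := fun m j => ¬ SeqMeasurablySeparable fun n => f n '' codeSet j m n) (by
      intro h
      refine hsep (h.mono fun n => ?_)
      have : codeSet 0 0 n = Set.univ := by
        ext z; simp [codeSet]
      rw [this, Set.image_univ, hfr])
    (by
      intro m j
      contrapose!
      intro h
      refine SeqMeasurablySeparable.of_split (Nat.unpair m).1
        (fun k n => f n '' codeSet (Function.update j m k) (m + 1) n) ?_ ?_ h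
      · rintro _ ⟨z, hz, rfl⟩
        refine Set.mem_iUnion.2 ⟨z (Nat.unpair m).2, z, fun m' hm' hu => ?_, rfl⟩
        rcases Nat.lt_succ_iff_lt_or_eq.1 hm' with h | h
        · rw [Function.update_of_ne h.ne]
          exact hz m' h hu
        · subst h
          simp
      · rintro k n hn _ ⟨z, hz, rfl⟩
        refine ⟨z, fun m' hm' hu => ?_, rfl⟩
        rcases Nat.lt_succ_iff_lt_or_eq.1 hm' with h | h
        · rw [Function.update_of_ne h.ne]
          exact hz m' h hu
        · subst h
          exact absurd hu.symm hn)
    (by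
      intro m j j' h hP
      have : (fun n => f n '' codeSet j' m n) = fun n => f n '' codeSet j m n := by
        funext n
        rw [codeSet_congr h]
      rwa [this])
  let z : ℕ → ℕ → ℕ := fun n p => j (Nat.pair n p)
  have hdiff : ∃ n n', f n (z n) ≠ f n' (z n') := by
    by_contra! hall
    have : f 0 (z 0) ∈ ⋂ n, A n :=
      Set.mem_iInter.2 fun n => by rw [hall 0 n, ← hfr]; exact Set.mem_range_self _
    rw [h0] at this
    exact this
  obtain ⟨n, n', hnn⟩ := hdiff
  obtain ⟨U, V, hU, hV, hxU, hxV, hUV⟩ := t2_separation hnn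
  -- long initial segments of `j` confine the `i`-th point to any prescribed neighbourhood of `z i`
  have hsmall : ∀ (i : ℕ) (W : Set α), IsOpen W → f i (z i) ∈ W →
      ∃ m, ∀ m' ≥ m, f i '' codeSet j m' i ⊆ W := by
    intro i W hW hxW
    have hopen : IsOpen (f i ⁻¹' W) := hW.preimage (hfc i)
    obtain ⟨I, u, hu, hsub⟩ := isOpen_pi_iff.1 hopen (z i) hxW
    refine ⟨∑ p ∈ I, (Nat.pair i p + 1), fun m' hm' => ?_⟩
    rintro _ ⟨y, hy, rfl⟩
    refine hsub fun p hp => ?_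
    have hlt : Nat.pair i p < m' :=
      lt_of_lt_of_le (Nat.lt_succ_self _) (le_trans (Finset.single_le_sum
        (f := fun p => Nat.pair i p + 1) (fun _ _ => Nat.zero_le _) hp) hm')
    have := hy (Nat.pair i p) hlt (by simp)
    rw [Nat.unpair_pair] at this
    rw [this]
    exact (hu p hp).2
  obtain ⟨m₁, h₁⟩ := hsmall n U hU hxU
  obtain ⟨m₂, h₂⟩ := hsmall n' V hV hxV
  have hne' : n ≠ n' := fun h => hnn (by rw [h])
  refine hj (max m₁ m₂) ⟨fun i => if i = n then U else if i = n' then V else Set.univ,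
    fun i => ?_, fun i => ?_, ?_⟩
  · dsimp only
    split_ifs
    exacts [hU.measurableSet, hV.measurableSet, MeasurableSet.univ]
  · dsimp only
    split_ifs with h h'
    · subst h; exact h₁ _ (le_max_left _ _)
    · subst h'; exact h₂ _ (le_max_right _ _)
    · exact Set.subset_univ _
  · refine Set.eq_empty_of_forall_notMem fun x hx => ?_
    have hx1 := Set.mem_iInter.1 hx n
    have hx2 := Set.mem_iInter.1 hx n'
    rw [if_pos rfl] at hx1
    rw [if_neg hne'.symm, if_pos rfl] at hx2
    exact Set.disjoint_left.1 hUV hx1 hx2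

section Selection

variable {X Y : Type*} [TopologicalSpace X] [PolishSpace X] [MeasurableSpace X] [BorelSpace X]
  [MetricSpace Y] [CompactSpace Y] [MeasurableSpace Y] [BorelSpace Y]

/-- A Borel set with open sections is a countable union of Borel rectangles with open second
factors (Kunugui–Novikov). -/
theorem exists_rectangles_of_isOpen_sections {A : Set (X × Y)} (hA : MeasurableSet A)
    (ho : ∀ x, IsOpen {y | (x, y) ∈ A}) :
    ∃ (C : ℕ → Set X) (V : ℕ → Set Y), (∀ n, MeasurableSet (C n)) ∧ (∀ n, IsOpen (V n)) ∧
      A = ⋃ n, C n ×ˢ V n := by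
  have hbasis := TopologicalSpace.isBasis_countableBasis Y
  obtain ⟨V, hV⟩ := ((TopologicalSpace.countable_countableBasis Y).insert ∅).exists_eq_range
    (Set.insert_nonempty _ _)
  have hVo : ∀ n, IsOpen (V n) := fun n => by
    have : V n ∈ insert ∅ (TopologicalSpace.countableBasis Y) := hV ▸ Set.mem_range_self n
    rcases this with h | h
    · rw [h]; exact isOpen_empty
    · exact hbasis.isOpen h
  -- the points of `A` outside of the largest rectangle with second factor `V n`
  let W : ℕ → Set ((X × Y) × Y) := fun n =>
    {p | p.1 ∈ A ∧ (p.1.2 ∈ (V n)ᶜ ∨ (p.2 ∈ V n ∧ (p.1.1, p.2) ∈ Aᶜ))}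
  have hW : ∀ n, MeasurableSet (W n) := fun n =>
    (measurable_fst hA).inter (((measurable_snd.comp measurable_fst) (hVo n).measurableSet.compl).union
      ((measurable_snd (hVo n).measurableSet).inter
        (((measurable_fst.comp measurable_fst).prodMk measurable_snd) hA.compl)))
  have hN : ∀ n, AnalyticSet (Prod.fst '' W n) := fun n =>
    (hW n).analyticSet.image_of_continuous continuous_fst
  have hN0 : ⋂ n, Prod.fst '' W n = ∅ := by
    refine Set.eq_empty_of_forall_notMem ?_
    rintro ⟨x, y⟩ hxy
    rw [Set.mem_iInter] at hxy
    have hxA : (x, y) ∈ A := by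
      obtain ⟨p, hp, hpe⟩ := hxy 0
      exact hpe ▸ hp.1
    obtain ⟨v, hv, hyv, hvA⟩ := hbasis.exists_subset_of_mem_open (show y ∈ {y | (x, y) ∈ A} from hxA)
      (ho x)
    obtain ⟨n, rfl⟩ : v ∈ Set.range V := hV ▸ Set.mem_insert_of_mem _ hv
    obtain ⟨⟨⟨x', y'⟩, y''⟩, hp, hpe⟩ := hxy n
    obtain ⟨rfl, rfl⟩ := Prod.mk.inj hpe
    rcases hp.2 with h | h
    · exact h hyv
    · exact h.2 (hvA h.1)
  obtain ⟨B, hB, hNB, hB0⟩ := seqMeasurablySeparable_of_analyticSet hN hN0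
  have hproj : ∀ n, AnalyticSet (Prod.fst '' (A \ B n)) := fun n =>
    (hA.diff (hB n)).analyticSet.image_of_continuous continuous_fst
  have hbad : ∀ n, AnalyticSet (Prod.fst '' ((Set.univ ×ˢ V n) \ A)) := fun n =>
    ((MeasurableSet.univ.prod (hVo n).measurableSet).diff hA).analyticSet.image_of_continuous
      continuous_fst
  have hsub : ∀ n x y, (x, y) ∈ A \ B n → y ∈ V n ∧ ∀ y' ∈ V n, (x, y') ∈ A := by
    intro n x y hxy
    have h : ∀ y', ((x, y), y') ∉ W n := fun y' h => hxy.2 (hNB n ⟨_, h, rfl⟩)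
    have hy : y ∈ V n := by
      by_contra hy
      exact h y ⟨hxy.1, Or.inl hy⟩
    exact ⟨hy, fun y' hy' => by
      by_contra hc
      exact h y' ⟨hxy.1, Or.inr ⟨hy', hc⟩⟩⟩
  have hdisj : ∀ n, Disjoint (Prod.fst '' (A \ B n)) (Prod.fst '' ((Set.univ ×ˢ V n) \ A)) := by
    intro n
    rw [Set.disjoint_left]
    rintro _ ⟨⟨x, y⟩, hxy, rfl⟩ ⟨⟨x', y'⟩, hxy', hx⟩
    obtain rfl : x' = x := hx
    exact hxy'.2 ((hsub n _ y hxy).2 y' hxy'.1.2)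
  have hsep := fun n => (hproj n).measurablySeparable (hbad n) (hdisj n)
  choose C hAC hCd hCm using hsep
  refine ⟨C, V, hCm, hVo, Set.Subset.antisymm ?_ ?_⟩
  · rintro ⟨x, y⟩ hxy
    have : ∃ n, (x, y) ∉ B n := by
      by_contra! h
      have : (x, y) ∈ ⋂ n, B n := Set.mem_iInter.2 h
      rw [hB0] at this
      exact this
    obtain ⟨n, hn⟩ := this
    exact Set.mem_iUnion.2 ⟨n, hAC n ⟨(x, y), ⟨hxy, hn⟩, rfl⟩, (hsub n x y ⟨hxy, hn⟩).1⟩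
  · refine Set.iUnion_subset fun n => ?_
    rintro ⟨x, y⟩ ⟨hx, hy⟩
    by_contra hA'
    exact Set.disjoint_left.1 (hCd n) ⟨(x, y), ⟨⟨trivial, hy⟩, hA'⟩, rfl⟩ hx

/-- **Novikov's projection theorem**: the projection of a Borel set with compact sections is
Borel. -/
theorem measurableSet_proj_of_isClosed_sections {K : Set (X × Y)} (hK : MeasurableSet K)
    (hc : ∀ x, IsClosed {y | (x, y) ∈ K}) : MeasurableSet {x | ∃ y, (x, y) ∈ K} := by
  obtain ⟨C, V, hC, hV, hCV⟩ := exists_rectangles_of_isOpen_sections hK.compl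
    (fun x => (hc x).isOpen_compl)
  -- a section of `K` is empty iff finitely many of the open factors cover the compact space
  have : {x | ∃ y, (x, y) ∈ K}ᶜ =
      ⋃ (s : Finset ℕ) (_ : (⋃ n ∈ s, V n) = Set.univ), ⋂ n ∈ s, C n := by
    ext x
    simp only [Set.mem_compl_iff, Set.mem_ofPred_eq, not_exists, Set.mem_iUnion, Set.mem_iInter,
      exists_prop]
    constructor
    · intro hx
      have hcov : (Set.univ : Set Y) ⊆ ⋃ n : {n // x ∈ C n}, V n := by
        intro y _
        have : (x, y) ∈ Kᶜ := hx y
        rw [hCV, Set.mem_iUnion] at this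
        obtain ⟨n, hn⟩ := this
        exact Set.mem_iUnion.2 ⟨⟨n, hn.1⟩, hn.2⟩
      obtain ⟨t, ht⟩ := isCompact_univ.elim_finite_subcover (fun n : {n // x ∈ C n} => V n)
        (fun n => hV n.1) hcov
      refine ⟨t.map (Function.Embedding.subtype _), ?_, ?_⟩
      · refine Set.eq_univ_of_univ_subset (ht.trans ?_)
        intro y hy
        simp only [Set.mem_iUnion] at hy ⊢
        obtain ⟨n, hn, hy⟩ := hy
        exact ⟨n, Finset.mem_map_of_mem _ hn, hy⟩
      · intro n hn
        obtain ⟨m, _, rfl⟩ := Finset.mem_map.1 hn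
        exact m.2
    · rintro ⟨s, hs, hx⟩ y hy
      have : y ∈ ⋃ n ∈ s, V n := hs ▸ Set.mem_univ y
      simp only [Set.mem_iUnion] at this
      obtain ⟨n, hn, hyn⟩ := this
      have : (x, y) ∈ Kᶜ := by
        rw [hCV]
        exact Set.mem_iUnion.2 ⟨n, hx n hn, hyn⟩
      exact this hy
  rw [← MeasurableSet.compl_iff, this]
  exact MeasurableSet.iUnion fun s => MeasurableSet.iUnion fun _ =>
    Finset.measurableSet_biInter s fun n _ => hC n

/-- The points of `K` that minimize `F` in their section. -/
def argminSet {X Y : Type*} (K : Set (X × Y)) (F : X × Y → ℝ) : Set (X × Y) :=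
  {p | p ∈ K ∧ ∀ y, (p.1, y) ∈ K → F p ≤ F (p.1, y)}

omit [CompactSpace Y] [MeasurableSpace Y] [BorelSpace Y] in
theorem isClosed_sublevel {S : Set Y} {φ : Y → ℝ} (hS : IsClosed S)
    (hφ : LowerSemicontinuousOn φ S) (q : ℝ) : IsClosed {y | y ∈ S ∧ φ y ≤ q} := by
  obtain ⟨v, hv, hvs⟩ := lowerSemicontinuousOn_iff_preimage_Iic.1 hφ q
  have : {y | y ∈ S ∧ φ y ≤ q} = S ∩ v := hvs
  rw [this]
  exact hS.inter hv

omit [TopologicalSpace X] [PolishSpace X] [MeasurableSpace X] [BorelSpace X] [MetricSpace Y]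
  [CompactSpace Y] [MeasurableSpace Y] [BorelSpace Y] in
/-- With rational thresholds, minimality is expressed through the projections of countably many sets. -/
theorem argminSet_eq (K : Set (X × Y)) (F : X × Y → ℝ) :
    argminSet K F = K ∩ ⋂ q : ℚ, ({p | p.1 ∈ {x | ∃ y, (x, y) ∈ K ∩ {p | F p ≤ q}}ᶜ} ∪
      {p | F p ≤ q}) := by
  ext ⟨x, y⟩
  simp only [argminSet, Set.mem_inter_iff, Set.mem_ofPred_eq, Set.mem_iInter, Set.mem_union,
    Set.mem_compl_iff, not_exists, not_and]
  refine and_congr_right fun hxy => ⟨fun h q => ?_, fun h y' hy' => ?_⟩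
  · by_cases hq : F (x, y) ≤ q
    · exact Or.inr hq
    · exact Or.inl fun y' hy' hF => hq ((h y' hy').trans hF)
  · by_contra! hlt
    obtain ⟨q, hq1, hq2⟩ := exists_rat_btwn hlt
    rcases h q with h | h
    · exact h y' hy' hq1.le
    · exact absurd h (not_le.2 hq2)

theorem measurableSet_argminSet {K : Set (X × Y)} {F : X × Y → ℝ} (hK : MeasurableSet K)
    (hc : ∀ x, IsClosed {y | (x, y) ∈ K}) (hF : Measurable F)
    (hl : ∀ x, LowerSemicontinuousOn (fun y => F (x, y)) {y | (x, y) ∈ K}) :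
    MeasurableSet (argminSet K F) := by
  rw [argminSet_eq]
  refine hK.inter (MeasurableSet.iInter fun q => MeasurableSet.union ?_ (hF measurableSet_Iic))
  have : MeasurableSet {x | ∃ y, (x, y) ∈ K ∩ {p | F p ≤ q}} :=
    measurableSet_proj_of_isClosed_sections (hK.inter (hF measurableSet_Iic))
      fun x => isClosed_sublevel (hc x) (hl x) q
  exact measurable_fst this.compl

omit [TopologicalSpace X] [PolishSpace X] [MeasurableSpace X] [BorelSpace X] [CompactSpace Y]
  [MeasurableSpace Y] [BorelSpace Y] in
theorem isClosed_argminSet {K : Set (X × Y)} {F : X × Y → ℝ}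
    (hc : ∀ x, IsClosed {y | (x, y) ∈ K})
    (hl : ∀ x, LowerSemicontinuousOn (fun y => F (x, y)) {y | (x, y) ∈ K}) (x : X) :
    IsClosed {y | (x, y) ∈ argminSet K F} := by
  have : {y | (x, y) ∈ argminSet K F} = {y | (x, y) ∈ K} ∩
      ⋂ y' : {y' // (x, y') ∈ K}, {y | (x, y) ∈ K ∧ F (x, y) ≤ F (x, y'.1)} := by
    ext y
    simp only [argminSet, Set.mem_ofPred_eq, Set.mem_inter_iff, Set.mem_iInter, Subtype.forall]
    exact ⟨fun h => ⟨h.1, fun y' hy' => ⟨h.1, h.2 y' hy'⟩⟩,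
      fun h => ⟨h.1, fun y' hy' => (h.2 y' hy').2⟩⟩
  rw [this]
  exact (hc x).inter (isClosed_iInter fun y' => isClosed_sublevel (hc x) (hl x) _)

omit [TopologicalSpace X] [PolishSpace X] [MeasurableSpace X] [BorelSpace X]
  [MeasurableSpace Y] [BorelSpace Y] in
theorem nonempty_argminSet {K : Set (X × Y)} {F : X × Y → ℝ}
    (hc : ∀ x, IsClosed {y | (x, y) ∈ K})
    (hl : ∀ x, LowerSemicontinuousOn (fun y => F (x, y)) {y | (x, y) ∈ K}) {x : X}
    (hne : {y | (x, y) ∈ K}.Nonempty) : {y | (x, y) ∈ argminSet K F}.Nonempty := by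
  obtain ⟨y, hy, hmin⟩ := (hl x).exists_isMinOn hne (hc x).isCompact
  exact ⟨y, hy, fun y' hy' => hmin hy'⟩

/-- The successive refinements of `K` by minimal distance to the points of a dense sequence. -/
def refineSeq (K : Set (X × Y)) (d : ℕ → Y) : ℕ → Set (X × Y)
  | 0 => K
  | n + 1 => argminSet (refineSeq K d n) fun p => dist p.2 (d n)

/-- A Borel set with compact sections has a Borel uniformization: minimizing successively the
distances to the points of a dense sequence leaves one point in every nonempty section. -/
theorem exists_measurable_section {K : Set (X × Y)} (hK : MeasurableSet K)
    (hc : ∀ x, IsClosed {y | (x, y) ∈ K}) {u₀ : X → Y} (hu₀ : Measurable u₀) :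
    ∃ u : X → Y, Measurable u ∧ ∀ x, (∃ y, (x, y) ∈ K) → (x, u x) ∈ K := by
  classical
  rcases isEmpty_or_nonempty Y with hY | hY
  · exact ⟨u₀, hu₀, fun x ⟨y, _⟩ => hY.elim y⟩
  let d : ℕ → Y := TopologicalSpace.denseSeq Y
  let R : ℕ → Set (X × Y) := refineSeq K d
  have hcont : ∀ (n : ℕ) (x : X) (S : Set Y),
      LowerSemicontinuousOn (fun y => dist ((x, y) : X × Y).2 (d n)) S := fun n x S =>
    (continuous_id.dist continuous_const).continuousOn.lowerSemicontinuousOn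
  have hdm : ∀ n, Measurable fun p : X × Y => dist p.2 (d n) := fun n =>
    measurable_snd.dist measurable_const
  have hRc : ∀ n x, IsClosed {y | (x, y) ∈ R n} := by
    intro n
    induction n with
    | zero => exact hc
    | succ n ih => exact isClosed_argminSet ih fun x => hcont n x _
  have hRm : ∀ n, MeasurableSet (R n) := by
    intro n
    induction n with
    | zero => exact hK
    | succ n ih => exact measurableSet_argminSet ih (hRc n) (hdm n) fun x => hcont n x _
  have hRs : ∀ n, R (n + 1) ⊆ R n := fun n p hp => hp.1
  have hRne : ∀ x, (∃ y, (x, y) ∈ K) → ∀ n, {y | (x, y) ∈ R n}.Nonempty := by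
    intro x hx n
    induction n with
    | zero => exact hx
    | succ n ih => exact nonempty_argminSet (hRc n) (fun x => hcont n x _) ih
  let K' : Set (X × Y) := ⋂ n, R n
  have hK' : MeasurableSet K' := MeasurableSet.iInter hRm
  have hK'sub : K' ⊆ K := fun p hp => Set.mem_iInter.1 hp 0
  have hK'ne : ∀ x, (∃ y, (x, y) ∈ K) → ∃ y, (x, y) ∈ K' := by
    intro x hx
    obtain ⟨y, hy⟩ := IsCompact.nonempty_iInter_of_sequence_nonempty_isCompact_isClosed
      (fun n => {y | (x, y) ∈ R n}) (fun n y hy => hRs n hy) (hRne x hx) (hRc 0 x).isCompact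
      (fun n => hRc n x)
    exact ⟨y, Set.mem_iInter.2 fun n => Set.mem_iInter.1 hy n⟩
  have huniq : ∀ x y y', (x, y) ∈ K' → (x, y') ∈ K' → y = y' := by
    intro x y y' hy hy'
    have hd : ∀ n, dist y (d n) = dist y' (d n) := fun n =>
      le_antisymm
        ((Set.mem_iInter.1 hy (n + 1)).2 y' (Set.mem_iInter.1 hy' n))
        ((Set.mem_iInter.1 hy' (n + 1)).2 y (Set.mem_iInter.1 hy n))
    have heq : (fun z => dist y z) = fun z => dist y' z :=
      Continuous.ext_on (TopologicalSpace.denseRange_denseSeq Y) (by fun_prop) (by fun_prop)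
        (by rintro _ ⟨n, rfl⟩; exact hd n)
    have := congrFun heq y'
    simpa using this
  refine ⟨fun x => if h : ∃ y, (x, y) ∈ K then (hK'ne x h).choose else u₀ x, ?_, ?_⟩
  · refine measurable_of_isClosed fun C hC => ?_
    have hpre : (fun x => if h : ∃ y, (x, y) ∈ K then (hK'ne x h).choose else u₀ x) ⁻¹' C =
        {x | ∃ y, (x, y) ∈ K' ∩ Prod.snd ⁻¹' C} ∪ ({x | ∃ y, (x, y) ∈ K}ᶜ ∩ u₀ ⁻¹' C) := by
      ext x
      by_cases h : ∃ y, (x, y) ∈ K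
      · have hx : x ∉ {x | ∃ y, (x, y) ∈ K}ᶜ ∩ u₀ ⁻¹' C := fun hx => hx.1 h
        rw [Set.mem_preimage, dif_pos h, Set.mem_union, or_iff_left hx]
        refine ⟨fun hx => ⟨_, (hK'ne x h).choose_spec, hx⟩, ?_⟩
        rintro ⟨y, hy, hyC⟩
        rw [← huniq x _ _ hy (hK'ne x h).choose_spec]
        exact hyC
      · have hx : x ∉ {x | ∃ y, (x, y) ∈ K' ∩ Prod.snd ⁻¹' C} := by
          rintro ⟨y, hy, -⟩
          exact h ⟨y, hK'sub hy⟩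
        rw [Set.mem_preimage, dif_neg h, Set.mem_union, or_iff_right hx]
        exact ⟨fun hx => ⟨h, hx⟩, fun hx => hx.2⟩
    rw [hpre]
    refine MeasurableSet.union ?_ (MeasurableSet.inter ?_ (hu₀ hC.measurableSet))
    · refine measurableSet_proj_of_isClosed_sections (hK'.inter (measurable_snd hC.measurableSet))
        fun x => ?_
      have : {y | (x, y) ∈ K' ∩ Prod.snd ⁻¹' C} = (⋂ n, {y | (x, y) ∈ R n}) ∩ C := by
        ext y
        simp [K']
      rw [this]
      exact (isClosed_iInter fun n => hRc n x).inter hC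
    · exact (measurableSet_proj_of_isClosed_sections hK hc).compl
  · intro x h
    simp only [dif_pos h]
    exact hK'sub (hK'ne x h).choose_spec

/-- **Measurable selection of minimizers**: a Borel cost that is lower semicontinuous in the action
has a Borel minimizer over compact feasible sets with Borel graph. -/
theorem exists_measurable_argmin {K : Set (X × Y)} (hK : MeasurableSet K)
    (hc : ∀ x, IsClosed {y | (x, y) ∈ K}) {F : X × Y → ℝ} (hF : Measurable F)
    (hl : ∀ x, LowerSemicontinuousOn (fun y => F (x, y)) {y | (x, y) ∈ K})
    {u₀ : X → Y} (hu₀ : Measurable u₀) :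
    ∃ u : X → Y, Measurable u ∧ ∀ x, (∃ y, (x, y) ∈ K) →
      (x, u x) ∈ K ∧ ∀ y, (x, y) ∈ K → F (x, u x) ≤ F (x, y) := by
  obtain ⟨u, hu, huK⟩ := exists_measurable_section (measurableSet_argminSet hK hc hF hl)
    (isClosed_argminSet hc hl) hu₀
  exact ⟨u, hu, fun x hx => huK x (nonempty_argminSet hc hl hx)⟩

end Selection

/-! ### Flow lines and exit times -/

theorem measurableSet_timesBefore (T : ℝ≥0∞) : MeasurableSet (timesBefore T) :=
  measurableSet_Ici.inter (ENNReal.measurable_ofReal measurableSet_Iio)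

theorem timesBefore_ofReal (t : ℝ) : timesBefore (ENNReal.ofReal t) = Set.Ico 0 t := by
  ext s
  simp only [timesBefore, Set.mem_ofPred_eq, Set.mem_Ico]
  refine and_congr_right fun hs => ?_
  rw [ENNReal.ofReal_lt_ofReal_iff']
  exact ⟨fun h => h.1, fun h => ⟨h, hs.trans_lt h⟩⟩

theorem timesBefore_of_ne_top {T : ℝ≥0∞} (hT : T ≠ ⊤) : timesBefore T = Set.Ico 0 T.toReal := by
  conv_lhs => rw [← ENNReal.ofReal_toReal hT]
  exact timesBefore_ofReal _

theorem timesBefore_top : timesBefore ⊤ = Set.Ici 0 := by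
  ext s
  simp [timesBefore]

theorem mem_timesBefore_of_le {T : ℝ≥0∞} {s t : ℝ} (ht : t ∈ timesBefore T) (hs : 0 ≤ s)
    (hst : s ≤ t) : s ∈ timesBefore T :=
  ⟨hs, (ENNReal.ofReal_le_ofReal hst).trans_lt ht.2⟩

theorem Ico_subset_timesBefore {T : ℝ≥0∞} {t : ℝ} (ht : t ∈ timesBefore T) :
    Set.Ico 0 t ⊆ timesBefore T := fun _ hs => mem_timesBefore_of_le ht hs.1 hs.2.le

theorem Icc_subset_timesBefore {T : ℝ≥0∞} {t : ℝ} (ht : t ∈ timesBefore T) :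
    Set.Icc 0 t ⊆ timesBefore T := fun _ hs => mem_timesBefore_of_le ht hs.1 hs.2

theorem zero_mem_timesBefore {T : ℝ≥0∞} (hT : 0 < T) : (0 : ℝ) ∈ timesBefore T :=
  ⟨le_rfl, by simpa using hT⟩

namespace PDMP

variable {n : ℕ} {𝕌 : Type*} [MetricSpace 𝕌] [MeasurableSpace 𝕌] (D : PDMP n 𝕌)

theorem continuous_uncurry_path :
    Continuous fun p : EuclideanSpace ℝ (Fin n) × ℝ => D.path p.1 p.2 :=
  D.continuous_flow.comp (continuous_fst.prodMk (continuous_real_toNNReal.comp continuous_snd))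

theorem path_add (x : EuclideanSpace ℝ (Fin n)) {s t : ℝ} (hs : 0 ≤ s) (ht : 0 ≤ t) :
    D.path (D.path x s) t = D.path x (s + t) := by
  rw [path, path, path, Real.toNNReal_add hs ht, D.flow_add]

theorem notMem_frontier (x : D.E) : (x : EuclideanSpace ℝ (Fin n)) ∉ frontier D.E := fun h =>
  (D.isOpen_E.inter_frontier_eq.le ⟨x.2, h⟩ : (x : EuclideanSpace ℝ (Fin n)) ∈ (∅ : Set _))

/-- By connectedness, a flow line that leaves `E` has met the frontier before. -/
theorem flow_mem_of_lt_tstar (x : D.E) {r : ℝ≥0} (hr : (r : ℝ≥0∞) < D.tstar x) :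
    D.flow x r ∈ D.E := by
  by_contra hE
  have hpre : IsPreconnected (D.flow x '' Set.Icc 0 r) :=
    isPreconnected_Icc.image _
      (D.continuous_flow.comp (continuous_const.prodMk continuous_id)).continuousOn
  obtain ⟨s, hs, hsf⟩ : ∃ s ∈ Set.Icc 0 r, D.flow x s ∈ frontier D.E := by
    by_contra! hno
    have hcl : ∀ s ∈ Set.Icc 0 r, D.flow x s ∉ D.E → D.flow x s ∈ (closure D.E)ᶜ := by
      intro s hs hsE hsc
      refine hno s hs ⟨hsc, ?_⟩
      rwa [D.isOpen_E.interior_eq]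
    obtain ⟨y, -, hyE, hyc⟩ := hpre D.E (closure D.E)ᶜ D.isOpen_E isClosed_closure.isOpen_compl
      (by
        rintro _ ⟨s, hs, rfl⟩
        by_cases h : D.flow x s ∈ D.E
        · exact Or.inl h
        · exact Or.inr (hcl s hs h))
      ⟨x, ⟨0, ⟨le_rfl, zero_le⟩, D.flow_zero x⟩, x.2⟩
      ⟨_, ⟨r, ⟨zero_le, le_rfl⟩, rfl⟩, hcl r ⟨zero_le, le_rfl⟩ hE⟩
    exact hyc (subset_closure hyE)
  have hs0 : 0 < s := by
    rcases eq_or_ne s 0 with h | h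
    · rw [h, D.flow_zero] at hsf
      exact absurd hsf (D.notMem_frontier x)
    · exact pos_iff_ne_zero.2 h
  have : D.tstar x ≤ s := sInf_le ⟨s, hs0, hsf, rfl⟩
  exact absurd (hr.trans_le this) (not_lt.2 (ENNReal.coe_le_coe.2 hs.2))

theorem flow_tstar_mem_frontier (x : D.E) (hx : D.tstar x ≠ ⊤) :
    D.flow x (D.tstar x).toNNReal ∈ frontier D.E := by
  let S : Set ℝ≥0 := {s | D.flow x s ∈ frontier D.E}
  have hS : IsClosed S :=
    isClosed_frontier.preimage (D.continuous_flow.comp (continuous_const.prodMk continuous_id))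
  have hset : {t : ℝ≥0∞ | ∃ s : ℝ≥0, 0 < s ∧ D.flow x s ∈ frontier D.E ∧ t = s} =
      (fun s : ℝ≥0 => (s : ℝ≥0∞)) '' S := by
    ext t
    constructor
    · rintro ⟨s, -, hs, rfl⟩
      exact ⟨s, hs, rfl⟩
    · rintro ⟨s, hs, rfl⟩
      refine ⟨s, pos_iff_ne_zero.2 fun h => ?_, hs, rfl⟩
      have hs' : D.flow x s ∈ frontier D.E := hs
      rw [h, D.flow_zero] at hs'
      exact D.notMem_frontier x hs'
  have hne : S.Nonempty := by
    by_contra hne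
    rw [Set.not_nonempty_iff_eq_empty] at hne
    apply hx
    rw [tstar, hset, hne, Set.image_empty, sInf_empty]
  have hts : D.tstar x = (sInf S : ℝ≥0) := by
    rw [tstar, hset, ENNReal.coe_sInf hne, sInf_image]
  rw [hts, ENNReal.toNNReal_coe]
  exact hS.csInf_mem hne (OrderBot.bddBelow S)

theorem lt_tstar_iff (x : D.E) (r : ℝ≥0) :
    (r : ℝ≥0∞) < D.tstar x ↔ ∀ s ≤ r, D.flow x s ∈ D.E := by
  refine ⟨fun h s hs => D.flow_mem_of_lt_tstar x ((ENNReal.coe_le_coe.2 hs).trans_lt h),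
    fun h => ?_⟩
  by_contra! hle
  have hT : D.tstar x ≠ ⊤ := ne_top_of_le_ne_top ENNReal.coe_ne_top hle
  have h1 := h (D.tstar x).toNNReal (ENNReal.toNNReal_mono ENNReal.coe_ne_top hle)
  exact D.notMem_frontier ⟨_, h1⟩ (D.flow_tstar_mem_frontier x hT)

theorem tstar_pos (x : D.E) : 0 < D.tstar x := by
  have := (D.lt_tstar_iff x 0).2 fun s hs => by
    rw [le_zero_iff.1 hs, D.flow_zero]; exact x.2
  simpa using this

theorem path_mem (x : D.E) {s : ℝ} (hs : s ∈ timesBefore (D.tstar x)) : D.path x s ∈ D.E :=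
  D.flow_mem_of_lt_tstar x hs.2

theorem exit_mem_frontier (x : D.E) : D.exit x ∈ frontier D.E := by
  rw [exit]
  split_ifs with h
  · exact D.Δ_mem
  · exact D.flow_tstar_mem_frontier x h

theorem exit_mem_closure (x : D.E) : D.exit x ∈ closure D.E :=
  frontier_subset_closure (D.exit_mem_frontier x)

theorem lowerSemicontinuous_tstar : LowerSemicontinuous fun x : D.E => D.tstar x := by
  intro x a ha
  lift a to ℝ≥0 using ha.ne_top
  replace ha := (D.lt_tstar_iff x a).1 ha
  have : ∀ᶠ y : D.E in 𝓝 x, ∀ s ∈ Set.Icc 0 a, D.flow y s ∈ D.E := by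
    refine isCompact_Icc.eventually_forall_of_forall_eventually fun s hs => ?_
    have hc : Continuous fun p : D.E × ℝ≥0 => D.flow p.1 p.2 :=
      D.continuous_flow.comp ((continuous_subtype_val.comp continuous_fst).prodMk continuous_snd)
    exact hc.continuousAt.eventually (D.isOpen_E.mem_nhds (ha s hs.2))
  exact this.mono fun y hy => (D.lt_tstar_iff y a).2 fun s hs => hy s ⟨zero_le, hs⟩

theorem measurable_tstar : Measurable fun x : D.E => D.tstar x :=
  D.lowerSemicontinuous_tstar.measurable

theorem measurable_exit : Measurable fun x : D.E => D.exit x := by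
  refine Measurable.ite (D.measurable_tstar (measurableSet_singleton ⊤)) measurable_const ?_
  exact D.continuous_flow.measurable.comp
    (measurable_subtype_coe.prodMk (ENNReal.measurable_toNNReal.comp D.measurable_tstar))

/-- The point of `E` reached at a time before the exit time. -/
def pathE (x : D.E) {t : ℝ} (ht : t ∈ timesBefore (D.tstar x)) : D.E := ⟨D.path x t, D.path_mem x ht⟩

theorem tstar_pathE (x : D.E) {t : ℝ} (ht : t ∈ timesBefore (D.tstar x)) :
    D.tstar (D.pathE x ht) = D.tstar x - ENNReal.ofReal t := by
  have key : ∀ r : ℝ≥0, (r : ℝ≥0∞) < D.tstar (D.pathE x ht) ↔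
      (r : ℝ≥0∞) < D.tstar x - ENNReal.ofReal t := by
    intro r
    rw [lt_tstar_iff, lt_tsub_iff_right, ENNReal.ofReal, ← ENNReal.coe_add, lt_tstar_iff]
    have hfl : ∀ s, D.flow (D.pathE x ht) s = D.flow x (t.toNNReal + s) := fun s =>
      (D.flow_add x _ s).symm
    constructor
    · intro h s hs
      rcases le_total s t.toNNReal with hst | hst
      · exact D.flow_mem_of_lt_tstar x ((ENNReal.coe_le_coe.2 hst).trans_lt ht.2)
      · obtain ⟨s', rfl⟩ := exists_add_of_le hst
        rw [← hfl]
        exact h s' (by rw [add_comm] at hs; exact le_of_add_le_add_right hs)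
    · intro h s hs
      rw [hfl, add_comm]
      exact h _ (by gcongr)
  refine le_antisymm ?_ ?_
  · exact ENNReal.le_of_forall_nnreal_lt fun r hr => ((key r).1 hr).le
  · exact ENNReal.le_of_forall_nnreal_lt fun r hr => ((key r).2 hr).le

theorem mem_timesBefore_tstar_pathE (x : D.E) {t : ℝ} (ht : t ∈ timesBefore (D.tstar x)) {s : ℝ}
    (hs : 0 ≤ s) : s ∈ timesBefore (D.tstar (D.pathE x ht)) ↔ t + s ∈ timesBefore (D.tstar x) := by
  simp only [timesBefore, Set.mem_ofPred_eq, hs, add_nonneg ht.1 hs, true_and]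
  rw [tstar_pathE, lt_tsub_iff_left, ENNReal.ofReal_add ht.1 hs]

theorem tstar_pathE_eq_top_iff (x : D.E) {t : ℝ} (ht : t ∈ timesBefore (D.tstar x)) :
    D.tstar (D.pathE x ht) = ⊤ ↔ D.tstar x = ⊤ := by
  rw [tstar_pathE, ENNReal.sub_eq_top_iff]
  simp

theorem exit_pathE (x : D.E) {t : ℝ} (ht : t ∈ timesBefore (D.tstar x)) :
    D.exit (D.pathE x ht) = D.exit x := by
  by_cases h : D.tstar x = ⊤
  · rw [exit, exit, if_pos h, if_pos ((D.tstar_pathE_eq_top_iff x ht).2 h)]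
  · rw [exit, exit, if_neg h, if_neg (mt (D.tstar_pathE_eq_top_iff x ht).1 h)]
    change D.flow (D.flow x t.toNNReal) _ = _
    rw [← D.flow_add]
    congr 1
    rw [tstar_pathE, ENNReal.toNNReal_sub ENNReal.ofReal_ne_top, ENNReal.ofReal,
      ENNReal.toNNReal_coe, add_tsub_cancel_of_le]
    rw [← ENNReal.coe_le_coe, ENNReal.coe_toNNReal h]
    exact ht.2.le

end PDMP

/-! ### Discounting along a path -/

theorem AbsolutelyContinuousOnInterval.lipschitzOnWith_comp {φ f : ℝ → ℝ} {a b : ℝ} {K : ℝ≥0}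
    {s : Set ℝ} (hf : AbsolutelyContinuousOnInterval f a b) (hφ : LipschitzOnWith K φ s)
    (hs : Set.MapsTo f (Set.uIcc a b) s) :
    AbsolutelyContinuousOnInterval (fun x => φ (f x)) a b := by
  rw [absolutelyContinuousOnInterval_iff] at hf ⊢
  intro ε hε
  obtain ⟨δ, hδ, h⟩ := hf (ε / (K + 1)) (by positivity)
  refine ⟨δ, hδ, fun E hE hlt => ?_⟩
  have h1 := h E hE hlt
  have hK : (0 : ℝ) < K + 1 := by positivity
  rw [lt_div_iff₀ hK] at h1
  refine lt_of_le_of_lt ?_ h1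
  rw [Finset.sum_mul]
  refine Finset.sum_le_sum fun i hi => ?_
  have hmem := hE.1 i hi
  calc dist (φ (f (E.2 i).1)) (φ (f (E.2 i).2)) ≤ K * dist (f (E.2 i).1) (f (E.2 i).2) :=
        hφ.dist_le_mul _ (hs hmem.1) _ (hs hmem.2)
    _ ≤ dist (f (E.2 i).1) (f (E.2 i).2) * (K + 1) := by
        nlinarith [dist_nonneg (x := f (E.2 i).1) (y := f (E.2 i).2)]

/-- The product rule for the discounted value of a path `V` with density `p`. The rate `l` may
have any sign: applied with `-l`, the identity undoes the discounting. -/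
theorem exp_neg_integral_mul_eq {l p V : ℝ → ℝ} {v₀ t : ℝ} (ht : 0 ≤ t)
    (hl : IntervalIntegrable l volume 0 t) (hp : IntervalIntegrable p volume 0 t)
    (hV : ∀ s ∈ Set.Icc 0 t, V s = v₀ + ∫ r in (0 : ℝ)..s, p r) :
    IntervalIntegrable (fun s => Real.exp (-∫ r in (0 : ℝ)..s, l r) * (p s - l s * V s))
        volume 0 t ∧
      Real.exp (-∫ r in (0 : ℝ)..t, l r) * V t =
        v₀ + ∫ s in (0 : ℝ)..t, Real.exp (-∫ r in (0 : ℝ)..s, l r) * (p s - l s * V s) := by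
  have hu : Set.uIcc 0 t = Set.Icc 0 t := Set.uIcc_of_le ht
  set Λ : ℝ → ℝ := fun s => -∫ r in (0 : ℝ)..s, l r with hΛ
  set W : ℝ → ℝ := fun s => v₀ + ∫ r in (0 : ℝ)..s, p r with hW
  have hΛac : AbsolutelyContinuousOnInterval Λ 0 t :=
    (hl.absolutelyContinuousOnInterval_intervalIntegral (by simp)).neg
  have hcst : AbsolutelyContinuousOnInterval (fun _ : ℝ => v₀) 0 t :=
    (LipschitzWith.const v₀).lipschitzOnWith.absolutelyContinuousOnInterval
  have hWac : AbsolutelyContinuousOnInterval W 0 t :=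
    hcst.add (hp.absolutelyContinuousOnInterval_intervalIntegral (by simp))
  have hEac : AbsolutelyContinuousOnInterval (fun s => Real.exp (Λ s)) 0 t := by
    obtain ⟨C, hC⟩ := hΛac.exists_bound
    have hK : LipschitzOnWith (Real.exp C).toNNReal Real.exp (Set.Icc (-C) C) := by
      refine (convex_Icc _ _).lipschitzOnWith_of_nnnorm_deriv_le
        (fun s _ => Real.differentiableAt_exp) fun s hs => ?_
      rw [Real.deriv_exp, ← NNReal.coe_le_coe, coe_nnnorm, Real.norm_eq_abs, Real.abs_exp,
        Real.coe_toNNReal _ (Real.exp_pos _).le]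
      exact Real.exp_le_exp.2 hs.2
    exact hΛac.lipschitzOnWith_comp hK fun s hs => abs_le.1 (hC s hs)
  have hder : ∀ᵐ s, s ∈ Set.uIoc 0 t →
      deriv (fun s => Real.exp (Λ s)) s * W s + Real.exp (Λ s) * deriv W s =
        Real.exp (Λ s) * (p s - l s * V s) := by
    filter_upwards [hl.ae_hasDerivAt_integral, hp.ae_hasDerivAt_integral] with s h1 h2 hs
    have hs' : s ∈ Set.uIcc 0 t := Set.uIoc_subset_uIcc hs
    have e1 : deriv (fun s => Real.exp (Λ s)) s = Real.exp (Λ s) * (-l s) :=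
      ((h1 hs' 0 (by simp)).neg.exp).deriv
    have e2 : deriv W s = p s := ((h2 hs' 0 (by simp)).const_add v₀).deriv
    rw [e1, e2, hV s (hu ▸ hs')]
    ring
  have hint := hEac.integral_deriv_mul_eq_sub hWac
  rw [intervalIntegral.integral_congr_ae hder] at hint
  refine ⟨?_, ?_⟩
  · refine (IntervalIntegrable.congr_ae
      ((hEac.intervalIntegrable_deriv.mul_continuousOn hWac.continuousOn).add
        (hWac.intervalIntegrable_deriv.continuousOn_mul hEac.continuousOn)) ?_)
    exact (ae_restrict_iff' measurableSet_uIoc).2 hder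
  · rw [hint, hV t ⟨ht, le_rfl⟩]
    simp [hΛ, hW]

/-! ### Occupation measures -/

attribute [instance] PDMP.markov_Q RelaxedControl.markov_μ RelaxedControl.prob_bdry

namespace PDMP

variable {n : ℕ} {𝕌 : Type*} [MetricSpace 𝕌] [MeasurableSpace 𝕌] (D : PDMP n 𝕌)

/-- The average of `v(y, ·)` over the relaxed action used at time `s`, at `y = φ(x,s)`. -/
def avg (v : EuclideanSpace ℝ (Fin n) → 𝕌 → ℝ≥0∞) (x : EuclideanSpace ℝ (Fin n))
    (Θ : RelaxedControl 𝕌) (s : ℝ) : ℝ≥0∞ :=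
  ∫⁻ a, v (D.path x s) a ∂(Θ.μ s)

theorem measurable_avg {v : EuclideanSpace ℝ (Fin n) → 𝕌 → ℝ≥0∞}
    (hv : Measurable (Function.uncurry v)) (x : EuclideanSpace ℝ (Fin n)) (Θ : RelaxedControl 𝕌) :
    Measurable (D.avg v x Θ) := by
  have h : Measurable (Function.uncurry fun (s : ℝ) (a : 𝕌) => v (D.path x s) a) :=
    hv.comp (((D.measurable_path x).comp measurable_fst).prodMk measurable_snd)
  exact h.lintegral_kernel_prod_right

theorem timesBefore_mono {s t : ℝ≥0∞} (h : s ≤ t) : timesBefore s ⊆ timesBefore t :=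
  fun _ hr => ⟨hr.1, hr.2.trans_le h⟩

theorem surv_antitone (x : D.E) (Θ : RelaxedControl 𝕌) : Antitone (D.surv x Θ) := by
  intro s t hst
  refine EReal.exp_monotone (EReal.neg_le_neg_iff.2 ?_)
  exact EReal.coe_ennreal_le_coe_ennreal_iff.2 (lintegral_mono_set (timesBefore_mono hst))

theorem measurable_surv (x : D.E) (Θ : RelaxedControl 𝕌) :
    Measurable fun s : ℝ => D.surv x Θ (ENNReal.ofReal s) :=
  ((D.surv_antitone x Θ).comp_monotone (fun _ _ h => ENNReal.ofReal_le_ofReal h)).measurable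

theorem surv_le_one (x : D.E) (Θ : RelaxedControl 𝕌) (t : ℝ≥0∞) : D.surv x Θ t ≤ 1 := by
  rw [surv, EReal.exp_le_one_iff, EReal.neg_le, neg_zero]
  exact EReal.coe_ennreal_nonneg _

theorem surv_ne_top (x : D.E) (Θ : RelaxedControl 𝕌) (t : ℝ≥0∞) : D.surv x Θ t ≠ ⊤ :=
  ne_top_of_le_ne_top ENNReal.one_ne_top (D.surv_le_one x Θ t)

/-- The occupation measure of the states and actions used before the first jump and the exit
time: `L v(x, Θ)` is the integral of `v` against it. -/
def occ (x : D.E) (Θ : RelaxedControl 𝕌) : Measure (EuclideanSpace ℝ (Fin n) × 𝕌) :=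
  (((volume.restrict (timesBefore (D.tstar x))).withDensity
    fun s => D.surv x Θ (ENNReal.ofReal s)) ⊗ₘ Θ.μ).map fun p => (D.path x p.1, p.2)

/-- The exit measure: `H w(x, Θ)` is the integral of `w` against it. -/
def bocc (x : D.E) (Θ : RelaxedControl 𝕌) : Measure (EuclideanSpace ℝ (Fin n) × 𝕌) :=
  D.surv x Θ (D.tstar x) • Θ.bdry.map fun a => (D.exit x, a)

/-- The law `G(x, Θ; ·)` of the state after the first jump. -/
def Gmeas (x : D.E) (Θ : RelaxedControl 𝕌) : Measure D.E :=
  D.Q ∘ₘ ((D.occ x Θ).withDensity (fun p => (D.lam p.1 p.2 : ℝ≥0∞)) + D.bocc x Θ)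

theorem measurable_path_pair (x : EuclideanSpace ℝ (Fin n)) :
    Measurable fun p : ℝ × 𝕌 => (D.path x p.1, p.2) :=
  ((D.measurable_path x).comp measurable_fst).prodMk measurable_snd

theorem lintegral_occ {v : EuclideanSpace ℝ (Fin n) × 𝕌 → ℝ≥0∞} (hv : Measurable v) (x : D.E)
    (Θ : RelaxedControl 𝕌) : ∫⁻ p, v p ∂(D.occ x Θ) = D.L (fun y a => v (y, a)) x Θ := by
  have h : Measurable fun p : ℝ × 𝕌 => v (D.path x p.1, p.2) :=
    hv.comp (D.measurable_path_pair (x : EuclideanSpace ℝ (Fin n)))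
  rw [occ, lintegral_map hv (D.measurable_path_pair _), Measure.lintegral_compProd h,
    lintegral_withDensity_eq_lintegral_mul _ (D.measurable_surv x Θ)
      (h.lintegral_kernel_prod_right')]
  rfl

theorem lintegral_bocc {w : EuclideanSpace ℝ (Fin n) × 𝕌 → ℝ≥0∞} (hw : Measurable w) (x : D.E)
    (Θ : RelaxedControl 𝕌) : ∫⁻ p, w p ∂(D.bocc x Θ) = D.H (fun y a => w (y, a)) x Θ := by
  rw [bocc, lintegral_smul_measure, lintegral_map hw measurable_prodMk_left]
  rfl

theorem lintegral_Gmeas {h : D.E → ℝ≥0∞} (hh : Measurable h) (x : D.E) (Θ : RelaxedControl 𝕌) :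
    ∫⁻ z, h z ∂(D.Gmeas x Θ) = D.Gpos h x Θ := by
  have hQ : Measurable fun p : EuclideanSpace ℝ (Fin n) × 𝕌 => ∫⁻ z, h z ∂(D.Q p) :=
    hh.lintegral_kernel
  have hlam : Measurable fun p : EuclideanSpace ℝ (Fin n) × 𝕌 => (D.lam p.1 p.2 : ℝ≥0∞) :=
    measurable_coe_nnreal_ennreal.comp D.measurable_lam
  rw [Gmeas, Measure.lintegral_bind D.Q.aemeasurable hh.aemeasurable, lintegral_add_measure,
    lintegral_withDensity_eq_lintegral_mul _ hlam hQ, lintegral_bocc _ hQ,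
    lintegral_occ _ (hlam.mul hQ)]
  rfl

theorem G_eq_integral {h : D.E → ℝ} (hh : Measurable h) {x : D.E} {Θ : RelaxedControl 𝕌}
    (hi : Integrable h (D.Gmeas x Θ)) : D.G h x Θ = ((∫ z, h z ∂(D.Gmeas x Θ) : ℝ) : EReal) := by
  have h1 : ∫⁻ z, ENNReal.ofReal (h z) ∂(D.Gmeas x Θ) ≠ ⊤ := hi.lintegral_lt_top.ne
  have h2 : ∫⁻ z, ENNReal.ofReal (-h z) ∂(D.Gmeas x Θ) ≠ ⊤ := hi.neg.lintegral_lt_top.ne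
  have hn : Measurable fun z => ENNReal.ofReal (-h z) := hh.neg.ennreal_ofReal
  rw [G, ← D.lintegral_Gmeas hh.ennreal_ofReal, ← D.lintegral_Gmeas hn,
    integral_eq_lintegral_pos_part_sub_lintegral_neg_part hi, EReal.coe_sub,
    ← EReal.coe_ennreal_toReal h1, ← EReal.coe_ennreal_toReal h2]

/-- `λ(y,a) ∫ h dQ(y,a)`. Where `h` is not integrable, which for `h ∈ 𝔹_g` happens only if
`λ(y,a) = 0`, the Bochner integral is `0`, in accordance with `0 · ∞ = 0`. -/
def lamQ (h : D.E → ℝ) (p : EuclideanSpace ℝ (Fin n) × 𝕌) : ℝ :=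
  D.lam p.1 p.2 * ∫ z, h z ∂(D.Q p)

theorem measurable_lam_prod : Measurable fun p : EuclideanSpace ℝ (Fin n) × 𝕌 => D.lam p.1 p.2 :=
  D.measurable_lam

theorem measurable_f_prod : Measurable fun p : EuclideanSpace ℝ (Fin n) × 𝕌 => D.f p.1 p.2 :=
  D.measurable_f

theorem measurable_r_prod : Measurable fun p : EuclideanSpace ℝ (Fin n) × 𝕌 => D.r p.1 p.2 :=
  D.measurable_r

theorem measurable_Q_integral {h : D.E → ℝ} (hh : Measurable h) :
    Measurable fun p : EuclideanSpace ℝ (Fin n) × 𝕌 => ∫ z, h z ∂(D.Q p) :=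
  hh.stronglyMeasurable.integral_kernel.measurable

theorem measurable_lamQ {h : D.E → ℝ} (hh : Measurable h) : Measurable (D.lamQ h) :=
  (measurable_coe_nnreal_real.comp D.measurable_lam_prod).mul (D.measurable_Q_integral hh)

theorem integrable_of_integrable_Gmeas {h : D.E → ℝ} {x : D.E}
    {Θ : RelaxedControl 𝕌} (hi : Integrable h (D.Gmeas x Θ)) :
    Integrable (D.lamQ h) (D.occ x Θ) ∧ Integrable (fun p => ∫ z, h z ∂(D.Q p)) (D.bocc x Θ) ∧
      ∫ z, h z ∂(D.Gmeas x Θ) =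
        ∫ p, D.lamQ h p ∂(D.occ x Θ) + ∫ p, ∫ z, h z ∂(D.Q p) ∂(D.bocc x Θ) := by
  have hc : D.Gmeas x Θ = (D.Q ∘ₖ Kernel.const Unit
      ((D.occ x Θ).withDensity (fun p => (D.lam p.1 p.2 : ℝ≥0∞)) + D.bocc x Θ)) () := by
    rw [Gmeas, Measure.comp_eq_comp_const_apply]
  rw [hc] at hi
  have hi1 := hi.integral_comp
  have hi2 := Kernel.integral_comp hi
  rw [Kernel.const_apply] at hi1 hi2
  rw [integrable_add_measure] at hi1
  have hw := hi1.1
  rw [integrable_withDensity_iff_integrable_coe_smul D.measurable_lam_prod] at hw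
  refine ⟨by simpa [lamQ] using! hw, hi1.2, ?_⟩
  rw [hc, hi2, integral_add_measure hi1.1 hi1.2,
    integral_withDensity_eq_integral_smul D.measurable_lam_prod]
  rfl

/-- The integral against the occupation measure, along the flow line. -/
theorem integral_occ {v : EuclideanSpace ℝ (Fin n) × 𝕌 → ℝ} {x : D.E} {Θ : RelaxedControl 𝕌}
    (hv : Measurable v) (hi : Integrable v (D.occ x Θ)) :
    IntegrableOn (fun s => (D.surv x Θ (ENNReal.ofReal s)).toReal *
        ∫ a, v (D.path x s, a) ∂(Θ.μ s)) (timesBefore (D.tstar x)) ∧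
      ∫ p, v p ∂(D.occ x Θ) = ∫ s in timesBefore (D.tstar x),
        (D.surv x Θ (ENNReal.ofReal s)).toReal * ∫ a, v (D.path x s, a) ∂(Θ.μ s) := by
  have hm := D.measurable_path_pair (𝕌 := 𝕌) (x : EuclideanSpace ℝ (Fin n))
  have hi' := hi
  rw [occ, integrable_map_measure hv.aestronglyMeasurable hm.aemeasurable] at hi'
  have hc := hi'
  rw [Measure.compProd] at hc
  replace hc := hc.integral_compProd
  rw [Kernel.const_apply] at hc
  simp only [Kernel.prodMkLeft_apply, Function.comp_apply] at hc
  rw [integrable_withDensity_iff_integrable_smul' (D.measurable_surv x Θ)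
    (ae_of_all _ fun s => (D.surv_ne_top x Θ _).lt_top)] at hc
  refine ⟨hc, ?_⟩
  rw [occ, integral_map hm.aemeasurable hv.aestronglyMeasurable]
  have := Measure.integral_compProd hi'
  simp only [Function.comp_apply] at this
  rw [this, integral_withDensity_eq_integral_toReal_smul (D.measurable_surv x Θ)
    (ae_of_all _ fun s => (D.surv_ne_top x Θ _).lt_top)]
  rfl

theorem integral_bocc {w : EuclideanSpace ℝ (Fin n) × 𝕌 → ℝ} (x : D.E) (Θ : RelaxedControl 𝕌)
    (hw : Measurable w) :
    ∫ p, w p ∂(D.bocc x Θ) = (D.surv x Θ (D.tstar x)).toReal * ∫ a, w (D.exit x, a) ∂Θ.bdry := by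
  rw [bocc, integral_smul_measure, integral_map measurable_prodMk_left.aemeasurable
    hw.aestronglyMeasurable]
  rfl

end PDMP

/-! ### Limits at the exit time -/

open Classical in
/-- The filter of times increasing to `T ∈ (0, ∞]`. -/
def exitFilter (T : ℝ≥0∞) : Filter ℝ := if T = ⊤ then atTop else 𝓝[<] T.toReal

theorem exitFilter_top : exitFilter ⊤ = atTop := if_pos rfl

theorem exitFilter_of_ne_top {T : ℝ≥0∞} (hT : T ≠ ⊤) : exitFilter T = 𝓝[<] T.toReal := if_neg hT

instance exitFilter_neBot (T : ℝ≥0∞) : (exitFilter T).NeBot := by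
  rw [exitFilter]; split_ifs <;> infer_instance

instance exitFilter_isCountablyGenerated (T : ℝ≥0∞) : (exitFilter T).IsCountablyGenerated := by
  rw [exitFilter]; split_ifs <;> infer_instance

theorem eventually_gt_exitFilter {T : ℝ≥0∞} {s : ℝ} (hs : s ∈ timesBefore T) :
    ∀ᶠ t in exitFilter T, s < t := by
  by_cases hT : T = ⊤
  · subst hT
    rw [exitFilter_top]
    exact eventually_gt_atTop s
  · rw [exitFilter_of_ne_top hT]
    rw [timesBefore_of_ne_top hT] at hs
    exact nhdsWithin_le_nhds (lt_mem_nhds hs.2)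

theorem eventually_mem_exitFilter {T : ℝ≥0∞} (h0 : 0 < T) :
    ∀ᶠ t in exitFilter T, t ∈ timesBefore T := by
  have h1 := eventually_gt_exitFilter (zero_mem_timesBefore h0)
  by_cases hT : T = ⊤
  · subst hT
    rw [timesBefore_top]
    exact h1.mono fun t ht => ht.le
  · rw [exitFilter_of_ne_top hT] at h1 ⊢
    rw [timesBefore_of_ne_top hT]
    filter_upwards [h1, self_mem_nhdsWithin] with t ht ht'
    exact ⟨ht.le, ht'⟩

theorem aecover_exitFilter (T : ℝ≥0∞) :
    AECover (volume.restrict (timesBefore T)) (exitFilter T) fun t => Set.Ico 0 t where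
  ae_eventually_mem := by
    refine (ae_restrict_iff' (measurableSet_timesBefore T)).2 (ae_of_all _ fun s hs => ?_)
    exact (eventually_gt_exitFilter hs).mono fun t ht => ⟨hs.1, ht⟩
  measurableSet _ := measurableSet_Ico

theorem tendsto_lintegral_exitFilter {T : ℝ≥0∞} (h0 : 0 < T) {F : ℝ → ℝ≥0∞} (hF : Measurable F) :
    Tendsto (fun t => ∫⁻ s in Set.Ico 0 t, F s) (exitFilter T) (𝓝 (∫⁻ s in timesBefore T, F s)) := by
  refine ((aecover_exitFilter T).lintegral_tendsto_of_countably_generated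
    hF.aemeasurable).congr' ?_
  filter_upwards [eventually_mem_exitFilter h0] with t ht
  rw [Measure.restrict_restrict measurableSet_Ico,
    Set.inter_eq_self_of_subset_left (Ico_subset_timesBefore ht)]

theorem tendsto_integral_exitFilter {T : ℝ≥0∞} (h0 : 0 < T) {F : ℝ → ℝ}
    (hF : IntegrableOn F (timesBefore T)) :
    Tendsto (fun t => ∫ s in (0 : ℝ)..t, F s) (exitFilter T) (𝓝 (∫ s in timesBefore T, F s)) := by
  refine ((aecover_exitFilter T).integral_tendsto_of_countably_generated hF).congr' ?_
  filter_upwards [eventually_mem_exitFilter h0] with t ht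
  rw [Measure.restrict_restrict measurableSet_Ico,
    Set.inter_eq_self_of_subset_left (Ico_subset_timesBefore ht), intervalIntegral.integral_of_le ht.1,
    integral_Ico_eq_integral_Ioo, integral_Ioc_eq_integral_Ioo]

/-! ### Feasible relaxed controls -/

namespace PDMP

variable {n : ℕ} {𝕌 : Type*} [MetricSpace 𝕌] [MeasurableSpace 𝕌] (D : PDMP n 𝕌)

theorem measurable_lam_ennreal :
    Measurable (Function.uncurry fun y a => (D.lam y a : ℝ≥0∞)) :=
  measurable_coe_nnreal_ennreal.comp D.measurable_lam

theorem tendsto_surv (x : D.E) (Θ : RelaxedControl 𝕌) :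
    Tendsto (fun t => D.surv x Θ (ENNReal.ofReal t)) (exitFilter (D.tstar x))
      (𝓝 (D.surv x Θ (D.tstar x))) := by
  have h := tendsto_lintegral_exitFilter (D.tstar_pos x)
    (D.measurable_avg D.measurable_lam_ennreal x Θ)
  have hc : Continuous fun r : ℝ≥0∞ => EReal.exp (-(r : EReal)) :=
    ENNReal.continuous_exp.comp (continuous_neg.comp continuous_coe_ennreal_ereal)
  refine ((hc.tendsto _).comp h).congr fun t => ?_
  rw [Function.comp_apply, surv, Lam, timesBefore_ofReal]
  rfl

/-- The jump rate along the flow line under a relaxed control. -/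
def rate (x : EuclideanSpace ℝ (Fin n)) (Θ : RelaxedControl 𝕌) (s : ℝ) : ℝ :=
  (D.avg (fun y a => (D.lam y a : ℝ≥0∞)) x Θ s).toReal

theorem rate_nonneg (x : EuclideanSpace ℝ (Fin n)) (Θ : RelaxedControl 𝕌) (s : ℝ) :
    0 ≤ D.rate x Θ s := ENNReal.toReal_nonneg

/-- As long as the accumulated intensity is finite, the survival factor is the exponential of a real
integral. -/
theorem rate_spec {x : D.E} {Θ : RelaxedControl 𝕌} {t : ℝ} (ht : 0 ≤ t)
    (hL : D.Lam x Θ (ENNReal.ofReal t) < ⊤) :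
    IntervalIntegrable (D.rate x Θ) volume 0 t ∧
      D.surv x Θ (ENNReal.ofReal t) =
        ENNReal.ofReal (Real.exp (-∫ s in (0 : ℝ)..t, D.rate x Θ s)) := by
  have hm := D.measurable_avg D.measurable_lam_ennreal x Θ
  have hL' : ∫⁻ s in Set.Ico 0 t, D.avg (fun y a => (D.lam y a : ℝ≥0∞)) x Θ s < ⊤ := by
    rw [Lam, timesBefore_ofReal] at hL
    exact hL
  have hint : IntegrableOn (D.rate x Θ) (Set.Ico 0 t) :=
    integrable_toReal_of_lintegral_ne_top hm.aemeasurable hL'.ne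
  refine ⟨(intervalIntegrable_iff_integrableOn_Ico_of_le ht).2 hint, ?_⟩
  have hI : ∫ s in (0 : ℝ)..t, D.rate x Θ s = (D.Lam x Θ (ENNReal.ofReal t)).toReal := by
    rw [intervalIntegral.integral_of_le ht, integral_Ioc_eq_integral_Ioo,
      ← integral_Ico_eq_integral_Ioo]
    unfold rate
    rw [integral_toReal hm.aemeasurable (ae_lt_top hm hL'.ne), Lam, timesBefore_ofReal]
    rfl
  rw [hI, surv, ← EReal.exp_coe, EReal.coe_neg, EReal.coe_ennreal_toReal hL.ne]

variable [BorelSpace 𝕌]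

theorem measurableSet_A {y : EuclideanSpace ℝ (Fin n)} (hy : y ∈ closure D.E) :
    MeasurableSet (D.A y) := (D.isCompact_A y hy).measurableSet

variable {D}

theorem ae_mem_A {x : D.E} {Θ : RelaxedControl 𝕌} (hΘ : Θ ∈ D.relaxedControls x) :
    ∀ᵐ s ∂(volume.restrict (timesBefore (D.tstar x))), ∀ᵐ a ∂(Θ.μ s), a ∈ D.A (D.path x s) := by
  rw [ae_restrict_iff' (measurableSet_timesBefore _)]
  filter_upwards [hΘ.1] with s hs hsT
  exact (mem_ae_iff_prob_eq_one (D.measurableSet_A (subset_closure (D.path_mem x hsT)))).2 (hs hsT)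

theorem ae_bdry_mem_A {x : D.E} {Θ : RelaxedControl 𝕌} (hΘ : Θ ∈ D.relaxedControls x) :
    ∀ᵐ a ∂Θ.bdry, a ∈ D.A (D.exit x) :=
  (mem_ae_iff_prob_eq_one (D.measurableSet_A (D.exit_mem_closure x))).2 hΘ.2

theorem avg_lam_le_iSup {x : D.E} {Θ : RelaxedControl 𝕌} (hΘ : Θ ∈ D.relaxedControls x) :
    ∀ᵐ s ∂(volume.restrict (timesBefore (D.tstar x))),
      D.avg (fun y a => (D.lam y a : ℝ≥0∞)) x Θ s ≤
        ⨆ a ∈ D.A (D.path x s), (D.lam (D.path x s) a : ℝ≥0∞) := by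
  filter_upwards [ae_mem_A hΘ] with s hs
  calc D.avg (fun y a => (D.lam y a : ℝ≥0∞)) x Θ s
      ≤ ∫⁻ _, ⨆ a ∈ D.A (D.path x s), (D.lam (D.path x s) a : ℝ≥0∞) ∂(Θ.μ s) :=
        lintegral_mono_ae (hs.mono fun a ha =>
          le_iSup₂ (f := fun a (_ : a ∈ D.A (D.path x s)) => (D.lam (D.path x s) a : ℝ≥0∞)) a ha)
    _ = _ := by simp

theorem Lam_lt_top (hcont : D.ContinuityAssumptions) {x : D.E} {Θ : RelaxedControl 𝕌}
    (hΘ : Θ ∈ D.relaxedControls x) {t : ℝ} (ht : t ∈ timesBefore (D.tstar x)) :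
    D.Lam x Θ (ENNReal.ofReal t) < ⊤ :=
  lt_of_le_of_lt (lintegral_mono_ae (ae_restrict_of_ae_restrict_of_subset
    (timesBefore_mono ht.2.le) (avg_lam_le_iSup hΘ))) (hcont.lam_int x t ht)

theorem Lam_tstar_lt_top (hcont : D.ContinuityAssumptions) {x : D.E} {Θ : RelaxedControl 𝕌}
    (hΘ : Θ ∈ D.relaxedControls x) (hT : D.tstar x ≠ ⊤) : D.Lam x Θ (D.tstar x) < ⊤ :=
  lt_of_le_of_lt (lintegral_mono_ae (avg_lam_le_iSup hΘ)) (hcont.lam_int_tstar x hT)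

theorem Policy.feedback_mem (u : D.Policy) (x : D.E) : u.feedback x ∈ D.relaxedControls x := by
  refine ⟨ae_of_all _ fun s hs => ?_, ?_⟩
  · have h := D.path_mem x hs
    change Kernel.deterministic (u.feedbackOrdinary x).ν (u.feedbackOrdinary x).measurable_ν s _ = 1
    rw [Kernel.deterministic_apply' _ _ (D.measurableSet_A (subset_closure h))]
    exact Set.indicator_of_mem (u.mem_A _ (subset_closure h)) _
  · change Measure.dirac _ _ = 1
    rw [Measure.dirac_apply' _ (D.measurableSet_A (D.exit_mem_closure x))]
    exact Set.indicator_of_mem (u.mem_A _ (D.exit_mem_closure x)) _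

variable {c : ℝ} {g : EuclideanSpace ℝ (Fin n) → ℝ} {lamLow : EuclideanSpace ℝ (Fin n) → ℝ≥0}
  {Klam : ℝ≥0}

theorem surv_le_exp_lowInt (hrate : D.JumpRateBounds c g lamLow Klam) {x : D.E}
    {Θ : RelaxedControl 𝕌} (hΘ : Θ ∈ D.relaxedControls x) {t : ℝ}
    (ht : t ∈ timesBefore (D.tstar x)) :
    D.surv x Θ (ENNReal.ofReal t) ≤ EReal.exp (-(D.lowInt lamLow x t : EReal)) := by
  refine EReal.exp_monotone (EReal.neg_le_neg_iff.2
    (EReal.coe_ennreal_le_coe_ennreal_iff.2 (lintegral_mono_ae ?_)))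
  have h1 := ae_restrict_of_ae_restrict_of_subset (timesBefore_mono ht.2.le) (ae_mem_A hΘ)
  filter_upwards [h1, ae_restrict_mem (measurableSet_timesBefore _)] with s hs hsT
  calc (lamLow (D.path x s) : ℝ≥0∞) = ∫⁻ _, lamLow (D.path x s) ∂(Θ.μ s) := by simp
    _ ≤ _ := lintegral_mono_ae (hs.mono fun a ha => ENNReal.coe_le_coe.2
      (hrate.le_lam _ (D.path_mem x (timesBefore_mono ht.2.le hsT)) a ha))

theorem surv_le_exp (hc : 0 ≤ c) (hrate : D.JumpRateBounds c g lamLow Klam) {x : D.E}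
    {Θ : RelaxedControl 𝕌} (hΘ : Θ ∈ D.relaxedControls x) {t : ℝ}
    (ht : t ∈ timesBefore (D.tstar x)) :
    D.surv x Θ (ENNReal.ofReal t) ≤
      EReal.exp (((c * t : ℝ) : EReal) - (D.lowInt lamLow x t : EReal)) := by
  refine (surv_le_exp_lowInt hrate hΘ ht).trans (EReal.exp_monotone ?_)
  rw [sub_eq_add_neg]
  exact le_add_of_nonneg_left (EReal.coe_nonneg.2 (mul_nonneg hc ht.1))

theorem L_one_le (hc : 0 ≤ c) (hrate : D.JumpRateBounds c g lamLow Klam) {x : D.E}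
    {Θ : RelaxedControl 𝕌} (hΘ : Θ ∈ D.relaxedControls x) : D.L (fun _ _ => 1) x Θ ≤ Klam := by
  refine le_trans (lintegral_mono_ae ?_) (hrate.int_le x)
  filter_upwards [ae_restrict_mem (measurableSet_timesBefore _)] with t ht
  simpa using surv_le_exp hc hrate hΘ ht

/-- Flow lines that never reach the boundary carry no exit mass. -/
theorem surv_tstar_eq_zero (hc : 0 ≤ c) (hrate : D.JumpRateBounds c g lamLow Klam) {x : D.E}
    {Θ : RelaxedControl 𝕌} (hΘ : Θ ∈ D.relaxedControls x) (hT : D.tstar x = ⊤) :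
    D.surv x Θ (D.tstar x) = 0 := by
  have h := D.tendsto_surv x Θ
  have h' := hrate.tendsto_exp x hT
  refine le_antisymm (le_of_tendsto_of_tendsto h (by rw [hT, exitFilter_top]; exact h') ?_) zero_le
  filter_upwards [eventually_mem_exitFilter (D.tstar_pos x)] with t ht
  exact surv_le_exp hc hrate hΘ ht

/-- On flow lines that never reach the boundary, the discounted weight vanishes in the limit. -/
theorem tendsto_surv_mul_g (hrate : D.JumpRateBounds c g lamLow Klam) {x : D.E}
    {Θ : RelaxedControl 𝕌} (hΘ : Θ ∈ D.relaxedControls x) (hT : D.tstar x = ⊤) :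
    Tendsto (fun t => D.surv x Θ (ENNReal.ofReal t) * ENNReal.ofReal (g (D.path x t)))
      (exitFilter (D.tstar x)) (𝓝 0) := by
  have h' := hrate.tendsto_g x hT
  rw [← exitFilter_top, ← hT] at h'
  refine tendsto_of_tendsto_of_tendsto_of_le_of_le' tendsto_const_nhds h'
    (Eventually.of_forall fun _ => zero_le) ?_
  filter_upwards [eventually_mem_exitFilter (D.tstar_pos x)] with t ht
  gcongr
  exact surv_le_exp_lowInt hrate hΘ ht

end PDMP

/-! ### The drift inequality along the flow -/

namespace PDMP

variable {n : ℕ} {𝕌 : Type*} [MetricSpace 𝕌] [MeasurableSpace 𝕌] {D : PDMP n 𝕌}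

/-- `Qg(y,a)`, in `[0, ∞]`. -/
def Qg (D : PDMP n 𝕌) (g : EuclideanSpace ℝ (Fin n) → ℝ) (p : EuclideanSpace ℝ (Fin n) × 𝕌) :
    ℝ≥0∞ := ∫⁻ z : D.E, ENNReal.ofReal (g z) ∂(D.Q p)

/-- The drift inequality of the growth condition, with all its terms finite. -/
def DriftInequality (D : PDMP n 𝕌) (b c : ℝ) (g Xg : EuclideanSpace ℝ (Fin n) → ℝ) : Prop :=
  ∀ y ∈ D.E, ∀ a ∈ D.A y, 0 ≤ b - Xg y - c * g y + D.lam y a * g y ∧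
    (D.lam y a : ℝ≥0∞) * D.Qg g (y, a) ≤ ENNReal.ofReal (b - Xg y - c * g y + D.lam y a * g y)

variable {b c δ M : ℝ} {g Xg : EuclideanSpace ℝ (Fin n) → ℝ}
  {rbar : EuclideanSpace ℝ (Fin n) → ℝ≥0} {lamLow : EuclideanSpace ℝ (Fin n) → ℝ≥0} {Klam : ℝ≥0}

theorem GrowthCondition.exists_driftInequality (h : D.GrowthCondition b c δ M g rbar) :
    ∃ Xg, D.IsFlowDeriv g Xg ∧ D.DriftInequality b c g Xg := by
  obtain ⟨Xg, hX, hd⟩ := h.drift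
  refine ⟨Xg, hX, fun y hy a ha => ?_⟩
  have h1 := hd y hy a ha
  change _ + (((D.lam y a : ℝ≥0∞) * D.Qg g (y, a) : ℝ≥0∞) : EReal) ≤ _ at h1
  generalize (D.lam y a : ℝ≥0∞) * D.Qg g (y, a) = e at h1 ⊢
  have he : e ≠ ⊤ := by
    rintro rfl
    rw [EReal.coe_ennreal_top, EReal.coe_add_top] at h1
    exact absurd h1 (not_le.2 (EReal.coe_lt_top b))
  lift e to ℝ≥0 using he
  have h2 : ((e : ℝ≥0∞) : EReal) = ((e : ℝ) : EReal) := rfl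
  rw [h2, ← EReal.coe_add, EReal.coe_le_coe_iff] at h1
  have h0 : (0 : ℝ) ≤ e := e.2
  refine ⟨by linarith, ?_⟩
  rw [← ENNReal.ofReal_coe_nnreal]
  refine ENNReal.ofReal_le_ofReal ?_
  linarith

theorem measurable_g_E (hg : Measurable g) : Measurable fun z : D.E => ENNReal.ofReal (g z) :=
  (hg.comp measurable_subtype_coe).ennreal_ofReal

theorem measurable_Qg (hg : Measurable g) : Measurable (D.Qg g) :=
  (measurable_g_E hg).lintegral_kernel

theorem measurable_lam_mul_Qg (hg : Measurable g) :
    Measurable (Function.uncurry fun y a => (D.lam y a : ℝ≥0∞) * D.Qg g (y, a)) :=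
  D.measurable_lam_ennreal.mul (measurable_Qg hg)

variable [BorelSpace 𝕌]

theorem ae_avg_lam_lt_top (hcont : D.ContinuityAssumptions) {x : D.E} {Θ : RelaxedControl 𝕌}
    (hΘ : Θ ∈ D.relaxedControls x) {t : ℝ} (ht : t ∈ timesBefore (D.tstar x)) :
    ∀ᵐ s ∂(volume.restrict (Set.Ico 0 t)), D.avg (fun y a => (D.lam y a : ℝ≥0∞)) x Θ s < ⊤ := by
  have h := Lam_lt_top hcont hΘ ht
  rw [Lam, timesBefore_ofReal] at h
  exact ae_lt_top (D.measurable_avg D.measurable_lam_ennreal x Θ) h.ne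

/-- The drift inequality averaged over the actions of a relaxed control. -/
theorem ae_avg_lam_mul_Qg_le (hcont : D.ContinuityAssumptions)
    (hd : D.DriftInequality b c g Xg) {x : D.E} {Θ : RelaxedControl 𝕌}
    (hΘ : Θ ∈ D.relaxedControls x) {t : ℝ} (ht : t ∈ timesBefore (D.tstar x)) :
    ∀ᵐ s ∂(volume.restrict (Set.Ico 0 t)),
      0 ≤ b - Xg (D.path x s) - c * g (D.path x s) + D.rate x Θ s * g (D.path x s) ∧
      D.avg (fun y a => (D.lam y a : ℝ≥0∞) * D.Qg g (y, a)) x Θ s ≤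
        ENNReal.ofReal (b - Xg (D.path x s) - c * g (D.path x s) +
          D.rate x Θ s * g (D.path x s)) := by
  filter_upwards [ae_avg_lam_lt_top hcont hΘ ht, ae_restrict_mem measurableSet_Ico,
    ae_restrict_of_ae_restrict_of_subset (Ico_subset_timesBefore ht) (ae_mem_A hΘ)]
    with s hfin hs hA
  have hy := D.path_mem x (Ico_subset_timesBefore ht hs)
  set y := D.path x s
  have hm : Measurable fun a => (D.lam y a : ℝ≥0∞) :=
    D.measurable_lam_ennreal.comp measurable_prodMk_left
  have hi : Integrable (fun a => (D.lam y a : ℝ)) (Θ.μ s) :=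
    integrable_toReal_of_lintegral_ne_top hm.aemeasurable hfin.ne
  have hrate : ∫ a, (D.lam y a : ℝ) ∂(Θ.μ s) = D.rate x Θ s :=
    integral_toReal hm.aemeasurable (ae_lt_top hm hfin.ne)
  have hi2 : Integrable (fun a => b - Xg y - c * g y + D.lam y a * g y) (Θ.μ s) :=
    (integrable_const _).add (hi.mul_const _)
  have hnn : 0 ≤ᵐ[Θ.μ s] fun a => b - Xg y - c * g y + D.lam y a * g y :=
    hA.mono fun a ha => (hd y hy a ha).1
  have heq : ∫ a, (b - Xg y - c * g y + D.lam y a * g y) ∂(Θ.μ s) =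
      b - Xg y - c * g y + D.rate x Θ s * g y := by
    rw [integral_add (integrable_const _) (hi.mul_const _), integral_mul_const, hrate]
    simp
  refine ⟨heq ▸ integral_nonneg_of_ae hnn, ?_⟩
  rw [← heq, ofReal_integral_eq_lintegral_ofReal hi2 hnn]
  exact lintegral_mono_ae (hA.mono fun a ha => (hd y hy a ha).2)

variable (hcont : D.ContinuityAssumptions) (hgrowth : D.GrowthCondition b c δ M g rbar)
  (hrate : D.JumpRateBounds c g lamLow Klam)

include hcont hgrowth hrate

/-- The drift inequality integrated along a flow line up to a time before the exit time. The constant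
`b` contributes at most `b Klam`, the bound of the discounted length of the flow line. -/
theorem drift_bound_of_mem {x : D.E} {Θ : RelaxedControl 𝕌} (hΘ : Θ ∈ D.relaxedControls x) {t : ℝ}
    (ht : t ∈ timesBefore (D.tstar x)) :
    (∫⁻ s in Set.Ico 0 t, D.surv x Θ (ENNReal.ofReal s) *
        (D.avg (fun y a => (D.lam y a : ℝ≥0∞) * D.Qg g (y, a)) x Θ s +
          ENNReal.ofReal (c * g (D.path x s)))) +
      D.surv x Θ (ENNReal.ofReal t) * ENNReal.ofReal (g (D.path x t)) ≤
        ENNReal.ofReal (g x + b * Klam) := by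
  obtain ⟨Xg, hX, hd⟩ := hgrowth.exists_driftInequality
  set e : ℝ → ℝ := fun s => Real.exp (-∫ r in (0 : ℝ)..s, D.rate x Θ r) with he
  have hsurv : ∀ s ∈ Set.Icc 0 t, D.surv x Θ (ENNReal.ofReal s) = ENNReal.ofReal (e s) :=
    fun s hs => (rate_spec D hs.1
      (Lam_lt_top hcont hΘ (Icc_subset_timesBefore ht hs))).2
  have hrt := (rate_spec D ht.1 (Lam_lt_top hcont hΘ ht)).1
  have hgE : ∀ s ∈ Set.Icc 0 t, 1 ≤ g (D.path x s) := fun s hs =>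
    hgrowth.one_le_g _ (D.path_mem x (Icc_subset_timesBefore ht hs))
  obtain ⟨hint, heq⟩ := exp_neg_integral_mul_eq (V := fun s => g (D.path x s)) (v₀ := g x) ht.1 hrt
    (hX.integrable x t ht) (fun s hs => by
      rw [← hX.integral_eq x s (Icc_subset_timesBefore ht hs)]; ring)
  have hsm : IntervalIntegrable e volume 0 t := by
    refine ContinuousOn.intervalIntegrable ?_
    rw [Set.uIcc_of_le ht.1]
    have := intervalIntegral.continuousOn_primitive_interval' hrt Set.left_mem_uIcc
    rw [Set.uIcc_of_le ht.1] at this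
    exact Real.continuous_exp.comp_continuousOn this.neg
  have hL : ∫ s in (0 : ℝ)..t, e s ≤ Klam := by
    have h1 : ∫⁻ s in Set.Ico 0 t, D.surv x Θ (ENNReal.ofReal s) ≤ Klam := by
      refine le_trans (lintegral_mono_set (Ico_subset_timesBefore ht)) ?_
      simpa [L] using L_one_le hgrowth.c_pos.le hrate hΘ
    rw [setLIntegral_congr_fun measurableSet_Ico
      (fun s hs => hsurv s (Set.Ico_subset_Icc_self hs))] at h1
    rw [intervalIntegral.integral_of_le ht.1, integral_Ioc_eq_integral_Ioo,
      ← integral_Ico_eq_integral_Ioo, integral_eq_lintegral_of_nonneg_ae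
        (ae_of_all _ fun s => (Real.exp_pos _).le)
        ((intervalIntegrable_iff_integrableOn_Ico_of_le ht.1).1 hsm).aestronglyMeasurable]
    exact ENNReal.toReal_le_coe_of_le_coe h1
  set q : ℝ → ℝ := fun s => e s * b - e s * (Xg (D.path x s) - D.rate x Θ s * g (D.path x s))
    with hq
  have hqi : IntervalIntegrable q volume 0 t := (hsm.mul_const b).sub hint
  have hae := ae_avg_lam_mul_Qg_le hcont hd hΘ ht
  have hle : ∀ᵐ s ∂(volume.restrict (Set.Ico 0 t)), 0 ≤ q s ∧
      D.surv x Θ (ENNReal.ofReal s) *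
        (D.avg (fun y a => (D.lam y a : ℝ≥0∞) * D.Qg g (y, a)) x Θ s +
          ENNReal.ofReal (c * g (D.path x s))) ≤ ENNReal.ofReal (q s) := by
    filter_upwards [hae, ae_restrict_mem measurableSet_Ico] with s hs hsm
    have hs' := Set.Ico_subset_Icc_self hsm
    have hcg : 0 ≤ c * g (D.path x s) :=
      mul_nonneg hgrowth.c_pos.le (zero_le_one.trans (hgE s hs'))
    have hes : 0 ≤ e s := (Real.exp_pos _).le
    have hqe : q s = e s * ((b - Xg (D.path x s) - c * g (D.path x s) +
        D.rate x Θ s * g (D.path x s)) + c * g (D.path x s)) := by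
      rw [hq]; ring
    refine ⟨hqe ▸ mul_nonneg hes (add_nonneg hs.1 hcg), ?_⟩
    rw [hsurv s hs', hqe, ENNReal.ofReal_mul hes, ENNReal.ofReal_add hs.1 hcg]
    gcongr
    exact hs.2
  have hIq : ∫⁻ s in Set.Ico 0 t, ENNReal.ofReal (q s) = ENNReal.ofReal (∫ s in (0 : ℝ)..t, q s) := by
    rw [intervalIntegral.integral_of_le ht.1, integral_Ioc_eq_integral_Ioo,
      ← integral_Ico_eq_integral_Ioo, ofReal_integral_eq_lintegral_ofReal
        ((intervalIntegrable_iff_integrableOn_Ico_of_le ht.1).1 hqi) (hle.mono fun s hs => hs.1)]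
  have hgt : 0 ≤ g (D.path x t) := zero_le_one.trans (hgE t ⟨ht.1, le_rfl⟩)
  have het : 0 ≤ e t := (Real.exp_pos _).le
  have hIq0 : 0 ≤ ∫ s in (0 : ℝ)..t, q s := by
    rw [intervalIntegral.integral_of_le ht.1, integral_Ioc_eq_integral_Ioo,
      ← integral_Ico_eq_integral_Ioo]
    exact integral_nonneg_of_ae (hle.mono fun s hs => hs.1)
  calc _ ≤ (∫⁻ s in Set.Ico 0 t, ENNReal.ofReal (q s)) +
        ENNReal.ofReal (e t) * ENNReal.ofReal (g (D.path x t)) := by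
        rw [hsurv t ⟨ht.1, le_rfl⟩]
        gcongr 1
        exact lintegral_mono_ae (hle.mono fun s hs => hs.2)
    _ = ENNReal.ofReal ((∫ s in (0 : ℝ)..t, q s) + e t * g (D.path x t)) := by
        rw [hIq, ← ENNReal.ofReal_mul het, ← ENNReal.ofReal_add hIq0 (mul_nonneg het hgt)]
    _ ≤ _ := by
        refine ENNReal.ofReal_le_ofReal ?_
        have hsplit : ∫ s in (0 : ℝ)..t, q s = (∫ s in (0 : ℝ)..t, e s) * b -
            ∫ s in (0 : ℝ)..t, e s * (Xg (D.path x s) - D.rate x Θ s * g (D.path x s)) := by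
          rw [hq, intervalIntegral.integral_sub (hsm.mul_const b) hint,
            intervalIntegral.integral_mul_const]
        have hb := mul_le_mul_of_nonneg_right hL hgrowth.b_nonneg
        rw [hsplit]
        change e t * g (D.path x t) = _ at heq
        rw [heq]
        linarith

/-- The expected growth of `g` up to and including the first jump. -/
theorem drift_bound {x : D.E} {Θ : RelaxedControl 𝕌} (hΘ : Θ ∈ D.relaxedControls x) :
    ENNReal.ofReal c * D.L (fun y _ => ENNReal.ofReal (g y)) x Θ +
      D.H (fun y _ => (rbar y : ℝ≥0∞)) x Θ + D.Gpos (fun z => ENNReal.ofReal (g z)) x Θ ≤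
        ENNReal.ofReal (g x + b * Klam) := by
  have hgm := hgrowth.g_mac.measurable
  have hQm := D.measurable_avg (measurable_lam_mul_Qg (D := D) hgm) x Θ
  have hcg : Measurable fun s => ENNReal.ofReal (c * g (D.path x s)) :=
    ((hgm.comp (D.measurable_path x)).const_mul c).ennreal_ofReal
  have hm1 : Measurable fun s => D.surv x Θ (ENNReal.ofReal s) *
      (D.avg (fun y a => (D.lam y a : ℝ≥0∞) * D.Qg g (y, a)) x Θ s +
        ENNReal.ofReal (c * g (D.path x s))) := (D.measurable_surv x Θ).mul (hQm.add hcg)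
  have hm2 : Measurable fun s => D.surv x Θ (ENNReal.ofReal s) *
      D.avg (fun y a => (D.lam y a : ℝ≥0∞) * D.Qg g (y, a)) x Θ s :=
    (D.measurable_surv x Θ).mul hQm
  have hlim := tendsto_lintegral_exitFilter (D.tstar_pos x) hm1
  have hbdry : ∃ ℓ, Tendsto (fun t => D.surv x Θ (ENNReal.ofReal t) * ENNReal.ofReal (g (D.path x t)))
      (exitFilter (D.tstar x)) (𝓝 ℓ) ∧ D.H (fun y _ => (rbar y : ℝ≥0∞)) x Θ +
        D.surv x Θ (D.tstar x) * ∫⁻ a, D.Qg g (D.exit x, a) ∂Θ.bdry ≤ ℓ := by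
    by_cases hT : D.tstar x = ⊤
    · refine ⟨0, tendsto_surv_mul_g hrate hΘ hT, ?_⟩
      rw [H, surv_tstar_eq_zero hgrowth.c_pos.le hrate hΘ hT]
      simp
    · obtain ⟨ℓ, hℓ⟩ := hgrowth.g_mac.limit x hT
      refine ⟨D.surv x Θ (D.tstar x) * ENNReal.ofReal ℓ, ?_, ?_⟩
      · refine ENNReal.Tendsto.mul (D.tendsto_surv x Θ) (Or.inr ENNReal.ofReal_ne_top) ?_
          (Or.inr (D.surv_ne_top x Θ _))
        rw [exitFilter_of_ne_top hT]
        exact (ENNReal.continuous_ofReal.tendsto _).comp hℓ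
      · have hQe : Measurable fun a => D.Qg g (D.exit x, a) :=
          (measurable_Qg hgm).comp measurable_prodMk_left
        rw [H, ← mul_add, ← lintegral_add_right _ hQe]
        gcongr
        calc _ ≤ ∫⁻ _, ENNReal.ofReal ℓ ∂Θ.bdry :=
              lintegral_mono_ae ((ae_bdry_mem_A hΘ).mono fun a ha => hgrowth.boundary x hT ℓ hℓ a ha)
          _ = _ := by simp
  obtain ⟨ℓ, hℓ, hle⟩ := hbdry
  have hsum := le_of_tendsto (hlim.add hℓ) (by
    filter_upwards [eventually_mem_exitFilter (D.tstar_pos x)] with t ht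
    exact drift_bound_of_mem hcont hgrowth hrate hΘ ht)
  refine le_trans ?_ hsum
  have hsplit : ∫⁻ s in timesBefore (D.tstar x), D.surv x Θ (ENNReal.ofReal s) *
        (D.avg (fun y a => (D.lam y a : ℝ≥0∞) * D.Qg g (y, a)) x Θ s +
          ENNReal.ofReal (c * g (D.path x s))) =
      (∫⁻ s in timesBefore (D.tstar x), D.surv x Θ (ENNReal.ofReal s) *
        D.avg (fun y a => (D.lam y a : ℝ≥0∞) * D.Qg g (y, a)) x Θ s) +
      ENNReal.ofReal c * D.L (fun y _ => ENNReal.ofReal (g y)) x Θ := by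
    simp_rw [mul_add]
    rw [lintegral_add_left hm2, L, ← lintegral_const_mul]
    · congr 2
      funext s
      rw [ENNReal.ofReal_mul hgrowth.c_pos.le]
      simp only [lintegral_const, measure_univ, mul_one]
      ring
    · exact (D.measurable_surv x Θ).mul (D.measurable_avg
        (v := fun y _ => ENNReal.ofReal (g y)) (hgm.comp measurable_fst).ennreal_ofReal x Θ)
  have hG : D.Gpos (fun z => ENNReal.ofReal (g z)) x Θ =
      (∫⁻ s in timesBefore (D.tstar x), D.surv x Θ (ENNReal.ofReal s) *
        D.avg (fun y a => (D.lam y a : ℝ≥0∞) * D.Qg g (y, a)) x Θ s) +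
      D.surv x Θ (D.tstar x) * ∫⁻ a, D.Qg g (D.exit x, a) ∂Θ.bdry := rfl
  rw [hsplit, hG]
  refine le_trans (le_of_eq ?_) (add_le_add_right hle _)
  ring

end PDMP

/-! ### Weighted bounds for one stage -/

namespace PDMP

variable {n : ℕ} {𝕌 : Type*} [MetricSpace 𝕌] [MeasurableSpace 𝕌] {D : PDMP n 𝕌}
variable {b c δ M : ℝ} {g Xg : EuclideanSpace ℝ (Fin n) → ℝ}
  {rbar : EuclideanSpace ℝ (Fin n) → ℝ≥0} {lamLow : EuclideanSpace ℝ (Fin n) → ℝ≥0} {Klam : ℝ≥0}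

theorem memBg_iff (hg : ∀ x ∈ D.E, 1 ≤ g x) {h : D.E → ℝ} :
    D.MemBg g h ↔ Measurable h ∧ ∃ C, 0 ≤ C ∧ ∀ x : D.E, |h x| ≤ C * g x := by
  refine and_congr_right fun _ => ⟨?_, ?_⟩
  · rintro ⟨C, hC⟩
    refine ⟨max C 0, le_max_right _ _, fun x => ?_⟩
    have hgx : 0 < g x := zero_lt_one.trans_le (hg x x.2)
    rw [← div_le_iff₀ hgx]
    exact (hC (Set.mem_range_self x)).trans (le_max_left _ _)
  · rintro ⟨C, -, hC⟩
    refine ⟨C, ?_⟩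
    rintro _ ⟨x, rfl⟩
    have hgx : 0 < g x := zero_lt_one.trans_le (hg x x.2)
    exact (div_le_iff₀ hgx).2 (hC x)

theorem normBg_nonneg (hg : ∀ x ∈ D.E, 1 ≤ g x) (h : D.E → ℝ) : 0 ≤ D.normBg g h :=
  Real.iSup_nonneg fun x => div_nonneg (abs_nonneg _) (zero_le_one.trans (hg x x.2))

/-- The objective as a real number. For feasible controls and `h ∈ 𝔹_g` all its terms are finite, so
that nothing is lost by `toReal` and by the Bochner integral. -/
def objR (D : PDMP n 𝕌) (ρ : ℝ) (h : D.E → ℝ) (x : D.E) (Θ : RelaxedControl 𝕌) : ℝ :=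
  -ρ * (D.L (fun _ _ => 1) x Θ).toReal + (D.L (fun y a => (D.f y a : ℝ≥0∞)) x Θ).toReal +
    (D.H (fun y a => (D.r y a : ℝ≥0∞)) x Θ).toReal + ∫ z, h z ∂(D.Gmeas x Θ)

theorem L_mono_of_le [BorelSpace 𝕌] {x : D.E} {Θ : RelaxedControl 𝕌} (hΘ : Θ ∈ D.relaxedControls x)
    {v w : EuclideanSpace ℝ (Fin n) → 𝕌 → ℝ≥0∞} (h : ∀ y ∈ D.E, ∀ a ∈ D.A y, v y a ≤ w y a) :
    D.L v x Θ ≤ D.L w x Θ := by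
  refine lintegral_mono_ae ?_
  filter_upwards [ae_mem_A hΘ, ae_restrict_mem (measurableSet_timesBefore _)] with s hs hsT
  refine mul_le_mul_right ?_ _
  exact lintegral_mono_ae (hs.mono fun a ha => h _ (D.path_mem x hsT) a ha)

theorem L_const_mul {v : EuclideanSpace ℝ (Fin n) → 𝕌 → ℝ≥0∞} (hv : Measurable (Function.uncurry v))
    (k : ℝ≥0∞) (x : D.E) (Θ : RelaxedControl 𝕌) :
    D.L (fun y a => k * v y a) x Θ = k * D.L v x Θ := by
  have h1 := D.lintegral_occ (v := fun p => k * v p.1 p.2) (hv.const_mul k) x Θ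
  have h2 := D.lintegral_occ (v := fun p => v p.1 p.2) hv x Θ
  rw [← h1, ← h2]
  exact lintegral_const_mul k hv

theorem H_const_mul {v : EuclideanSpace ℝ (Fin n) → 𝕌 → ℝ≥0∞} (hv : Measurable (Function.uncurry v))
    (k : ℝ≥0∞) (x : D.E) (Θ : RelaxedControl 𝕌) :
    D.H (fun y a => k * v y a) x Θ = k * D.H v x Θ := by
  have h1 := D.lintegral_bocc (w := fun p => k * v p.1 p.2) (hv.const_mul k) x Θ
  have h2 := D.lintegral_bocc (w := fun p => v p.1 p.2) hv x Θ
  rw [← h1, ← h2]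
  exact lintegral_const_mul k hv

section Feasible

variable [BorelSpace 𝕌] (hcont : D.ContinuityAssumptions)

include hcont in
/-- The survival factor loses exactly the mass of the jumps, so that `Gmeas` is a sub-probability. -/
theorem Gmeas_univ_le_one {x : D.E} {Θ : RelaxedControl 𝕌} (hΘ : Θ ∈ D.relaxedControls x) :
    D.Gmeas x Θ Set.univ ≤ 1 := by
  have hm := D.measurable_avg D.measurable_lam_ennreal x Θ
  have hm1 : Measurable fun s => D.surv x Θ (ENNReal.ofReal s) *
      D.avg (fun y a => (D.lam y a : ℝ≥0∞)) x Θ s := (D.measurable_surv x Θ).mul hm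
  have hG : D.Gmeas x Θ Set.univ = (∫⁻ s in timesBefore (D.tstar x),
      D.surv x Θ (ENNReal.ofReal s) * D.avg (fun y a => (D.lam y a : ℝ≥0∞)) x Θ s) +
      D.surv x Θ (D.tstar x) := by
    have := D.lintegral_Gmeas (h := fun _ => 1) measurable_const x Θ
    simp only [lintegral_const, one_mul] at this
    rw [this, Gpos]
    simp [avg]
  rw [hG]
  refine le_of_tendsto ((tendsto_lintegral_exitFilter (D.tstar_pos x) hm1).add
    (D.tendsto_surv x Θ)) ?_
  filter_upwards [eventually_mem_exitFilter (D.tstar_pos x)] with t ht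
  have hrt := (rate_spec D ht.1 (Lam_lt_top hcont hΘ ht)).1
  obtain ⟨hint, heq⟩ := exp_neg_integral_mul_eq (V := fun _ => 1) (p := fun _ => 0) (v₀ := 1) ht.1 hrt
    (by simp) (fun s _ => by simp)
  simp only [mul_one, zero_sub, mul_neg] at hint heq
  have hint' := hint.neg
  simp only [neg_neg, Pi.neg_def] at hint'
  have hi : ∫⁻ s in Set.Ico 0 t, D.surv x Θ (ENNReal.ofReal s) *
      D.avg (fun y a => (D.lam y a : ℝ≥0∞)) x Θ s = ENNReal.ofReal (∫ s in (0 : ℝ)..t,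
        Real.exp (-∫ r in (0 : ℝ)..s, D.rate x Θ r) * D.rate x Θ s) := by
    rw [intervalIntegral.integral_of_le ht.1, integral_Ioc_eq_integral_Ioo,
      ← integral_Ico_eq_integral_Ioo, ofReal_integral_eq_lintegral_ofReal
        ((intervalIntegrable_iff_integrableOn_Ico_of_le ht.1).1 hint')
        (ae_of_all _ fun s => mul_nonneg (Real.exp_pos _).le (D.rate_nonneg x Θ s))]
    refine lintegral_congr_ae ?_
    filter_upwards [ae_avg_lam_lt_top hcont hΘ ht, ae_restrict_mem measurableSet_Ico] with s hs hsm
    rw [(rate_spec D hsm.1 (Lam_lt_top hcont hΘ (Ico_subset_timesBefore ht hsm))).2,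
      ENNReal.ofReal_mul (Real.exp_pos _).le, rate, ENNReal.ofReal_toReal hs.ne]
  rw [hi, (rate_spec D ht.1 (Lam_lt_top hcont hΘ ht)).2, ← ENNReal.ofReal_add]
  · rw [heq, intervalIntegral.integral_neg]
    simp
  · exact intervalIntegral.integral_nonneg ht.1 fun s _ =>
      mul_nonneg (Real.exp_pos _).le (D.rate_nonneg x Θ s)
  · exact (Real.exp_pos _).le

variable (hgrowth : D.GrowthCondition b c δ M g rbar)
  (hrate : D.JumpRateBounds c g lamLow Klam)

include hcont hgrowth hrate

theorem L_g_le {x : D.E} {Θ : RelaxedControl 𝕌} (hΘ : Θ ∈ D.relaxedControls x) :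
    D.L (fun y _ => ENNReal.ofReal (g y)) x Θ ≤ ENNReal.ofReal ((g x + b * Klam) / c) := by
  have h := drift_bound hcont hgrowth hrate hΘ
  have hc : ENNReal.ofReal c ≠ 0 := (ENNReal.ofReal_pos.2 hgrowth.c_pos).ne'
  rw [ENNReal.ofReal_div_of_pos hgrowth.c_pos, ENNReal.le_div_iff_mul_le (Or.inl hc)
    (Or.inl ENNReal.ofReal_ne_top), mul_comm]
  exact le_trans (le_trans le_self_add le_self_add) h

theorem L_f_le {x : D.E} {Θ : RelaxedControl 𝕌} (hΘ : Θ ∈ D.relaxedControls x) :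
    D.L (fun y a => (D.f y a : ℝ≥0∞)) x Θ ≤ ENNReal.ofReal (M * ((g x + b * Klam) / c)) := by
  calc D.L (fun y a => (D.f y a : ℝ≥0∞)) x Θ
      ≤ D.L (fun y _ => ENNReal.ofReal M * ENNReal.ofReal (g y)) x Θ := by
        refine L_mono_of_le hΘ fun y hy a ha => ?_
        rw [← ENNReal.ofReal_mul hgrowth.M_nonneg, ← ENNReal.ofReal_coe_nnreal]
        exact ENNReal.ofReal_le_ofReal (hgrowth.f_le y hy a ha)
    _ = ENNReal.ofReal M * D.L (fun y _ => ENNReal.ofReal (g y)) x Θ :=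
        L_const_mul (hgrowth.g_mac.measurable.comp measurable_fst).ennreal_ofReal _ x Θ
    _ ≤ _ := by
        rw [ENNReal.ofReal_mul hgrowth.M_nonneg]
        gcongr
        exact L_g_le hcont hgrowth hrate hΘ

theorem H_r_le {x : D.E} {Θ : RelaxedControl 𝕌} (hΘ : Θ ∈ D.relaxedControls x) :
    D.H (fun y a => (D.r y a : ℝ≥0∞)) x Θ ≤
      ENNReal.ofReal (M / (c + δ) * (g x + b * Klam)) := by
  have hMc : 0 ≤ M / (c + δ) :=
    div_nonneg hgrowth.M_nonneg (add_pos hgrowth.c_pos hgrowth.δ_pos).le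
  by_cases hT : D.tstar x = ⊤
  · rw [H, surv_tstar_eq_zero hgrowth.c_pos.le hrate hΘ hT]
    simp
  calc D.H (fun y a => (D.r y a : ℝ≥0∞)) x Θ
      ≤ D.H (fun y _ => ENNReal.ofReal (M / (c + δ)) * (rbar y : ℝ≥0∞)) x Θ := by
        rw [H, H]
        gcongr 1
        refine lintegral_mono_ae ((ae_bdry_mem_A hΘ).mono fun a ha => ?_)
        rw [← ENNReal.ofReal_coe_nnreal, ← ENNReal.ofReal_coe_nnreal (p := rbar _),
          ← ENNReal.ofReal_mul hMc]
        exact ENNReal.ofReal_le_ofReal (hgrowth.r_le x hT a ha)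
    _ = ENNReal.ofReal (M / (c + δ)) * D.H (fun y _ => (rbar y : ℝ≥0∞)) x Θ :=
        H_const_mul (v := fun y _ => (rbar y : ℝ≥0∞)) (measurable_coe_nnreal_ennreal.comp
          (hgrowth.measurable_rbar.comp measurable_fst)) _ x Θ
    _ ≤ _ := by
        rw [ENNReal.ofReal_mul hMc]
        gcongr
        exact le_trans (le_trans le_add_self le_self_add) (drift_bound hcont hgrowth hrate hΘ)

theorem lintegral_g_Gmeas_le {x : D.E} {Θ : RelaxedControl 𝕌} (hΘ : Θ ∈ D.relaxedControls x) :
    ∫⁻ z, ENNReal.ofReal (g z) ∂(D.Gmeas x Θ) ≤ ENNReal.ofReal (g x + b * Klam) := by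
  rw [D.lintegral_Gmeas (measurable_g_E hgrowth.g_mac.measurable)]
  exact le_trans le_add_self (drift_bound hcont hgrowth hrate hΘ)

theorem integrable_g_Gmeas {x : D.E} {Θ : RelaxedControl 𝕌} (hΘ : Θ ∈ D.relaxedControls x) :
    Integrable (fun z : D.E => g z) (D.Gmeas x Θ) ∧
      ∫ z : D.E, g z ∂(D.Gmeas x Θ) ≤ g x + b * Klam := by
  have hle := lintegral_g_Gmeas_le hcont hgrowth hrate hΘ
  have hm := hgrowth.g_mac.measurable.comp (measurable_subtype_coe (p := (· ∈ D.E)))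
  have hnn : ∀ᵐ z : D.E ∂(D.Gmeas x Θ), 0 ≤ g z :=
    ae_of_all _ fun z => zero_le_one.trans (hgrowth.one_le_g z z.2)
  refine ⟨(lintegral_ofReal_ne_top_iff_integrable hm.aestronglyMeasurable hnn).1
    (ne_top_of_le_ne_top ENNReal.ofReal_ne_top hle), ?_⟩
  rw [integral_eq_lintegral_of_nonneg_ae hnn hm.aestronglyMeasurable]
  refine ENNReal.toReal_le_of_le_ofReal ?_ hle
  exact add_nonneg (zero_le_one.trans (hgrowth.one_le_g x x.2)) (mul_nonneg hgrowth.b_nonneg Klam.2)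

theorem integrable_Gmeas {h : D.E → ℝ} (hh : Measurable h) {C : ℝ}
    (hC : ∀ x : D.E, |h x| ≤ C * g x) {x : D.E} {Θ : RelaxedControl 𝕌}
    (hΘ : Θ ∈ D.relaxedControls x) :
    Integrable h (D.Gmeas x Θ) :=
  ((integrable_g_Gmeas hcont hgrowth hrate hΘ).1.const_mul C).mono' hh.aestronglyMeasurable
    (ae_of_all _ hC)

theorem abs_integral_Gmeas_le {h : D.E → ℝ} {C : ℝ} (hC0 : 0 ≤ C)
    (hC : ∀ x : D.E, |h x| ≤ C * g x) {x : D.E} {Θ : RelaxedControl 𝕌}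
    (hΘ : Θ ∈ D.relaxedControls x) :
    |∫ z, h z ∂(D.Gmeas x Θ)| ≤ C * (g x + b * Klam) := by
  obtain ⟨hi, hle⟩ := integrable_g_Gmeas hcont hgrowth hrate hΘ
  refine (norm_integral_le_of_norm_le (f := h) (hi.const_mul C) (ae_of_all _ hC)).trans ?_
  rw [integral_const_mul]
  gcongr

theorem objectiveFinite {h : D.E → ℝ} (hh : D.MemBg g h) {x : D.E} {Θ : RelaxedControl 𝕌}
    (hΘ : Θ ∈ D.relaxedControls x) : D.ObjectiveFinite h x Θ := by
  obtain ⟨hm, C, -, hC⟩ := (memBg_iff hgrowth.one_le_g).1 hh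
  have hi := integrable_Gmeas hcont hgrowth hrate hm hC hΘ
  have hn : Measurable fun z => ENNReal.ofReal (-h z) := hm.neg.ennreal_ofReal
  refine ⟨(L_one_le hgrowth.c_pos.le hrate hΘ).trans_lt ENNReal.coe_lt_top,
    (L_f_le hcont hgrowth hrate hΘ).trans_lt ENNReal.ofReal_lt_top,
    (H_r_le hcont hgrowth hrate hΘ).trans_lt ENNReal.ofReal_lt_top, ?_, ?_⟩
  · rw [← D.lintegral_Gmeas hm.ennreal_ofReal]
    exact hi.lintegral_lt_top
  · rw [← D.lintegral_Gmeas hn]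
    exact hi.neg.lintegral_lt_top

theorem objective_eq {h : D.E → ℝ} (hh : D.MemBg g h) (ρ : ℝ) {x : D.E} {Θ : RelaxedControl 𝕌}
    (hΘ : Θ ∈ D.relaxedControls x) : D.objective ρ h x Θ = (D.objR ρ h x Θ : EReal) := by
  obtain ⟨hm, C, -, hC⟩ := (memBg_iff hgrowth.one_le_g).1 hh
  obtain ⟨h1, h2, h3, -⟩ := objectiveFinite hcont hgrowth hrate hh hΘ
  rw [objective, D.G_eq_integral hm (integrable_Gmeas hcont hgrowth hrate hm hC hΘ), objR,
    EReal.coe_add, EReal.coe_add, EReal.coe_add, EReal.coe_mul, EReal.coe_ennreal_toReal h1.ne,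
    EReal.coe_ennreal_toReal h2.ne, EReal.coe_ennreal_toReal h3.ne]

/-- The one-stage cost is of order `g`, uniformly over the feasible controls. -/
theorem exists_abs_objR_le {h : D.E → ℝ} (hh : D.MemBg g h) (ρ : ℝ) :
    ∃ C, 0 ≤ C ∧ ∀ (x : D.E), ∀ Θ ∈ D.relaxedControls x, |D.objR ρ h x Θ| ≤ C * g x := by
  obtain ⟨hm, C, hC0, hC⟩ := (memBg_iff hgrowth.one_le_g).1 hh
  have hMc : 0 ≤ M / (c + δ) :=
    div_nonneg hgrowth.M_nonneg (add_pos hgrowth.c_pos hgrowth.δ_pos).le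
  have hbK : 0 ≤ b * (Klam : ℝ) := mul_nonneg hgrowth.b_nonneg Klam.2
  have hMc' : 0 ≤ M / c := div_nonneg hgrowth.M_nonneg hgrowth.c_pos.le
  refine ⟨|ρ| * Klam + (M / c + M / (c + δ) + C) * (1 + b * Klam), by positivity, fun x Θ hΘ => ?_⟩
  have hg1 := hgrowth.one_le_g x x.2
  have hB0 : 0 ≤ g x + b * Klam := by linarith
  have e1 : (D.L (fun _ _ => 1) x Θ).toReal ≤ Klam :=
    ENNReal.toReal_le_coe_of_le_coe (L_one_le hgrowth.c_pos.le hrate hΘ)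
  have e2 : (D.L (fun y a => (D.f y a : ℝ≥0∞)) x Θ).toReal ≤ M / c * (g x + b * Klam) := by
    refine (ENNReal.toReal_le_of_le_ofReal ?_ (L_f_le hcont hgrowth hrate hΘ)).trans_eq (by ring)
    exact mul_nonneg hgrowth.M_nonneg (div_nonneg hB0 hgrowth.c_pos.le)
  have e3 : (D.H (fun y a => (D.r y a : ℝ≥0∞)) x Θ).toReal ≤ M / (c + δ) * (g x + b * Klam) :=
    ENNReal.toReal_le_of_le_ofReal (mul_nonneg hMc hB0) (H_r_le hcont hgrowth hrate hΘ)
  have e4 := abs_integral_Gmeas_le hcont hgrowth hrate hC0 hC hΘ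
  have e1' : |-ρ * (D.L (fun _ _ => 1) x Θ).toReal| ≤ |ρ| * Klam := by
    rw [abs_mul, abs_neg, abs_of_nonneg ENNReal.toReal_nonneg]
    gcongr
  have e2' := abs_of_nonneg (ENNReal.toReal_nonneg (a := D.L (fun y a => (D.f y a : ℝ≥0∞)) x Θ))
  have e3' := abs_of_nonneg (ENNReal.toReal_nonneg (a := D.H (fun y a => (D.r y a : ℝ≥0∞)) x Θ))
  have hBg : g x + b * Klam ≤ (1 + b * Klam) * g x := by nlinarith
  rw [objR]
  refine (abs_add_le _ _).trans ?_
  refine (add_le_add ((abs_add_le _ _).trans (add_le_add ((abs_add_le _ _).trans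
    (add_le_add e1' (e2'.le.trans e2))) (e3'.le.trans e3))) e4).trans ?_
  have h5 : (M / c + M / (c + δ) + C) * (g x + b * Klam) ≤
      (M / c + M / (c + δ) + C) * ((1 + b * Klam) * g x) := by gcongr
  have h6 : |ρ| * (Klam : ℝ) ≤ |ρ| * Klam * g x := le_mul_of_one_le_right (by positivity) hg1
  nlinarith

end Feasible

end PDMP

/-! ### Measurable dependence on the initial state -/

namespace PDMP

variable {n : ℕ} {𝕌 : Type*} [MetricSpace 𝕌] [MeasurableSpace 𝕌] {D : PDMP n 𝕌}

theorem avg_feedback {v : EuclideanSpace ℝ (Fin n) → 𝕌 → ℝ≥0∞} (hv : Measurable (Function.uncurry v))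
    (u : D.Policy) (x : D.E) (s : ℝ) :
    D.avg v x (u.feedback x) s = v (D.path x s) (u.toFun (D.path x s)) :=
  Kernel.lintegral_deterministic' (g := fun s => u.toFun (D.path x s)) (a := s)
    (u.measurable_toFun.comp (D.measurable_path x))
    (hv.comp (measurable_prodMk_left (x := D.path x s)))

theorem measurable_pathE_uncurry : Measurable fun p : D.E × ℝ => D.path p.1 p.2 :=
  D.continuous_uncurry_path.measurable.comp
    ((measurable_subtype_coe.comp measurable_fst).prodMk measurable_snd)

theorem measurable_feedback_value {β : Type*} [MeasurableSpace β]
    {v : EuclideanSpace ℝ (Fin n) → 𝕌 → β} (hv : Measurable (Function.uncurry v))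
    (u : D.Policy) :
    Measurable fun p : D.E × ℝ => v (D.path p.1 p.2) (u.toFun (D.path p.1 p.2)) :=
  hv.comp (measurable_pathE_uncurry.prodMk (u.measurable_toFun.comp measurable_pathE_uncurry))

theorem measurable_setLIntegral_timesBefore {β : Type*} [MeasurableSpace β] {F : β × ℝ → ℝ≥0∞}
    (hF : Measurable F) {T : β → ℝ≥0∞} (hT : Measurable T) :
    Measurable fun x => ∫⁻ s in timesBefore (T x), F (x, s) := by
  have hS : MeasurableSet {p : β × ℝ | 0 ≤ p.2 ∧ ENNReal.ofReal p.2 < T p.1} :=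
    (measurableSet_le measurable_const measurable_snd).inter
      (measurableSet_lt (ENNReal.measurable_ofReal.comp measurable_snd) (hT.comp measurable_fst))
  have h := (hF.indicator hS).lintegral_prod_right' (ν := volume)
  convert h using 2 with x
  rw [← lintegral_indicator (measurableSet_timesBefore _)]
  rfl

theorem measurable_surv_feedback (u : D.Policy) :
    Measurable fun p : D.E × ℝ≥0∞ => D.surv p.1 (u.feedback p.1) p.2 := by
  have h : Measurable fun q : (D.E × ℝ≥0∞) × ℝ =>
      (D.lam (D.path q.1.1 q.2) (u.toFun (D.path q.1.1 q.2)) : ℝ≥0∞) :=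
    (measurable_feedback_value D.measurable_lam_ennreal u).comp
      ((measurable_fst.comp measurable_fst).prodMk measurable_snd)
  have hL := measurable_setLIntegral_timesBefore h (T := fun p => p.2) measurable_snd
  have hL' : Measurable fun p : D.E × ℝ≥0∞ => D.Lam p.1 (u.feedback p.1) p.2 := by
    convert hL using 2 with p
    exact lintegral_congr fun s => avg_feedback D.measurable_lam_ennreal u p.1 s
  exact EReal.measurable_exp.comp (measurable_coe_ennreal_ereal.comp hL').neg

theorem measurable_L_feedback {v : EuclideanSpace ℝ (Fin n) → 𝕌 → ℝ≥0∞}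
    (hv : Measurable (Function.uncurry v)) (u : D.Policy) :
    Measurable fun x : D.E => D.L v x (u.feedback x) := by
  have h := measurable_setLIntegral_timesBefore (((measurable_surv_feedback u).comp
    (measurable_fst.prodMk (ENNReal.measurable_ofReal.comp measurable_snd))).mul
    (measurable_feedback_value hv u)) D.measurable_tstar
  convert h using 2 with x
  exact lintegral_congr fun s => congrArg (_ * ·) (avg_feedback hv u x s)

theorem measurable_H_feedback {w : EuclideanSpace ℝ (Fin n) → 𝕌 → ℝ≥0∞}
    (hw : Measurable (Function.uncurry w)) (u : D.Policy) :
    Measurable fun x : D.E => D.H w x (u.feedback x) := by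
  have h : Measurable fun x : D.E => D.surv x (u.feedback x) (D.tstar x) *
      w (D.exit x) (u.toFun (D.exit x)) :=
    ((measurable_surv_feedback u).comp (measurable_id.prodMk D.measurable_tstar)).mul
      (hw.comp (D.measurable_exit.prodMk (u.measurable_toFun.comp D.measurable_exit)))
  convert h using 2 with x
  exact congrArg (_ * ·) (lintegral_dirac' _ (hw.comp measurable_prodMk_left))

theorem measurable_Gmeas_feedback (u : D.Policy) :
    Measurable fun x : D.E => D.Gmeas x (u.feedback x) := by
  refine Measure.measurable_of_measurable_coe _ fun B hB => ?_
  have hi : Measurable (B.indicator (1 : D.E → ℝ≥0∞)) := measurable_one.indicator hB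
  have hQ : Measurable fun p : EuclideanSpace ℝ (Fin n) × 𝕌 => ∫⁻ z, B.indicator 1 z ∂(D.Q p) :=
    hi.lintegral_kernel
  have h : ∀ x, D.Gmeas x (u.feedback x) B =
      D.L (fun y a => (D.lam y a : ℝ≥0∞) * ∫⁻ z, B.indicator 1 z ∂(D.Q (y, a))) x (u.feedback x) +
      D.H (fun y a => ∫⁻ z, B.indicator 1 z ∂(D.Q (y, a))) x (u.feedback x) := fun x => by
    rw [← lintegral_indicator_one hB, D.lintegral_Gmeas hi]
    rfl
  simp_rw [h]
  exact (measurable_L_feedback (D.measurable_lam_ennreal.mul hQ) u).add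
    (measurable_H_feedback hQ u)

/-- The post-jump kernel `G(x, u_φ(x); ·)` of a policy. -/
def stepKernel (u : D.Policy) : Kernel D.E D.E where
  toFun x := D.Gmeas x (u.feedback x)
  measurable' := measurable_Gmeas_feedback u

/-- The action of the post-jump kernel of a policy on functions. -/
def step (u : D.Policy) (h : D.E → ℝ) (x : D.E) : ℝ := ∫ z, h z ∂(D.Gmeas x (u.feedback x))

theorem measurable_step (u : D.Policy) {h : D.E → ℝ} (hh : Measurable h) :
    Measurable (D.step u h) :=
  (hh.stronglyMeasurable.integral_kernel (κ := stepKernel u)).measurable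

theorem measurable_objR (u : D.Policy) (ρ : ℝ) {h : D.E → ℝ} (hh : Measurable h) :
    Measurable fun x => D.objR ρ h x (u.feedback x) :=
  ((((measurable_L_feedback measurable_const u).ennreal_toReal.const_mul (-ρ)).add
    (measurable_L_feedback (v := fun y a => (D.f y a : ℝ≥0∞))
      (measurable_coe_nnreal_ennreal.comp D.measurable_f) u).ennreal_toReal).add
    (measurable_H_feedback (w := fun y a => (D.r y a : ℝ≥0∞))
      (measurable_coe_nnreal_ennreal.comp D.measurable_r) u).ennreal_toReal).add (measurable_step u hh)

/-! ### The Poisson equation -/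

variable {b c δ M : ℝ} {g Xg : EuclideanSpace ℝ (Fin n) → ℝ}
  {rbar : EuclideanSpace ℝ (Fin n) → ℝ≥0} {lamLow : EuclideanSpace ℝ (Fin n) → ℝ≥0} {Klam : ℝ≥0}
  {a κ : ℝ} {ν : D.Policy → Measure D.E}

theorem memBg_zero (hg : ∀ x ∈ D.E, 1 ≤ g x) : D.MemBg g fun _ => 0 :=
  (memBg_iff hg).2 ⟨measurable_const, 0, le_rfl, by simp⟩

theorem objR_eq_add_step (u : D.Policy) (ρ : ℝ) (h : D.E → ℝ) (x : D.E) :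
    D.objR ρ h x (u.feedback x) = D.objR ρ (fun _ => 0) x (u.feedback x) + D.step u h x := by
  simp [objR, step]

theorem objR_zero_eq (Θ : RelaxedControl 𝕌) (ρ : ℝ) (x : D.E) :
    D.objR ρ (fun _ => 0) x Θ =
      -ρ * (D.L (fun _ _ => 1) x Θ).toReal + D.objR 0 (fun _ => 0) x Θ := by
  simp [objR]
  ring

theorem MemBg.add (hg : ∀ x ∈ D.E, 1 ≤ g x) {h k : D.E → ℝ} (hh : D.MemBg g h) (hk : D.MemBg g k) :
    D.MemBg g fun x => h x + k x := by
  rw [memBg_iff hg] at hh hk ⊢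
  obtain ⟨hm, C, hC0, hC⟩ := hh
  obtain ⟨km, C', hC0', hC'⟩ := hk
  exact ⟨hm.add km, C + C', add_nonneg hC0 hC0', fun x =>
    (abs_add_le _ _).trans ((add_le_add (hC x) (hC' x)).trans_eq (by ring))⟩

theorem MemBg.const_mul (hg : ∀ x ∈ D.E, 1 ≤ g x) {h : D.E → ℝ} (hh : D.MemBg g h) (r : ℝ) :
    D.MemBg g fun x => r * h x := by
  rw [memBg_iff hg] at hh ⊢
  obtain ⟨hm, C, hC0, hC⟩ := hh
  refine ⟨hm.const_mul r, |r| * C, by positivity, fun x => ?_⟩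
  rw [abs_mul, mul_assoc]
  exact mul_le_mul_of_nonneg_left (hC x) (abs_nonneg r)

theorem GeometricErgodicity.integrable (herg : D.GeometricErgodicity g a κ ν)
    (hgm : Measurable g) (hg : ∀ x ∈ D.E, 1 ≤ g x) (u : D.Policy) {h : D.E → ℝ}
    (hh : D.MemBg g h) : Integrable h (ν u) := by
  obtain ⟨hm, C, -, hC⟩ := (memBg_iff hg).1 hh
  have hnn : ∀ᵐ z : D.E ∂(ν u), 0 ≤ g z := ae_of_all _ fun z => zero_le_one.trans (hg z z.2)
  have hgi : Integrable (fun z : D.E => g z) (ν u) :=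
    (lintegral_ofReal_ne_top_iff_integrable (hgm.comp measurable_subtype_coe).aestronglyMeasurable
      hnn).1 (herg.g_int u).ne
  exact (hgi.const_mul C).mono' hm.aestronglyMeasurable (ae_of_all _ hC)

theorem GeometricErgodicity.nonempty (herg : D.GeometricErgodicity g a κ ν) (u : D.Policy) :
    Nonempty D.E := by
  have := herg.prob u
  exact (ν u).nonempty_of_neZero

theorem GeometricErgodicity.tendsto (herg : D.GeometricErgodicity g a κ ν) (u : D.Policy)
    {h : D.E → ℝ} (hh : D.MemBg g h) (x : D.E) :
    Tendsto (fun k => D.Giter u k h x) atTop (𝓝 (∫ z, h z ∂(ν u))) := by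
  rw [tendsto_iff_dist_tendsto_zero]
  refine squeeze_zero (fun _ => dist_nonneg) (fun k => herg.conv u h hh k x) ?_
  have := ((tendsto_pow_atTop_nhds_zero_of_lt_one herg.κ_pos.le herg.κ_lt_one).const_mul
    (a * D.normBg g h)).mul_const (g x)
  simpa using this

variable [BorelSpace 𝕌]

theorem L_one_toReal_pos (hcont : D.ContinuityAssumptions) {x : D.E} {Θ : RelaxedControl 𝕌}
    (hΘ : Θ ∈ D.relaxedControls x) (hfin : D.L (fun _ _ => 1) x Θ < ⊤) :
    0 < (D.L (fun _ _ => 1) x Θ).toReal := by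
  refine ENNReal.toReal_pos ?_ hfin.ne
  simp only [L, lintegral_const, measure_univ, mul_one]
  rw [← pos_iff_ne_zero, setLIntegral_pos_iff (D.measurable_surv x Θ)]
  have hsub : timesBefore (D.tstar x) ⊆
      Function.support (fun s => D.surv x Θ (ENNReal.ofReal s)) ∩ timesBefore (D.tstar x) := by
    intro s hs
    refine ⟨?_, hs⟩
    rw [Function.mem_support, (rate_spec D hs.1 (Lam_lt_top hcont hΘ hs)).2]
    exact (ENNReal.ofReal_pos.2 (Real.exp_pos _)).ne'
  refine lt_of_lt_of_le ?_ (measure_mono hsub)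
  obtain ⟨t, ht, ht0⟩ := ((eventually_mem_exitFilter (D.tstar_pos x)).and
    (eventually_gt_exitFilter (zero_mem_timesBefore (D.tstar_pos x)))).exists
  refine lt_of_lt_of_le ?_ (measure_mono (Ico_subset_timesBefore ht))
  simpa using ht0

variable (hcont : D.ContinuityAssumptions)
  (hgrowth : D.GrowthCondition b c δ M g rbar)
  (hrate : D.JumpRateBounds c g lamLow Klam) (herg : D.GeometricErgodicity g a κ ν)

include hcont hgrowth hrate

theorem memBg_objR (u : D.Policy) (ρ : ℝ) {h : D.E → ℝ} (hh : D.MemBg g h) :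
    D.MemBg g fun x => D.objR ρ h x (u.feedback x) := by
  obtain ⟨C, hC0, hC⟩ := exists_abs_objR_le hcont hgrowth hrate hh ρ
  exact (memBg_iff hgrowth.one_le_g).2 ⟨measurable_objR u ρ hh.1, C, hC0,
    fun x => hC x _ (u.feedback_mem x)⟩

theorem memBg_step (u : D.Policy) {h : D.E → ℝ} (hh : D.MemBg g h) : D.MemBg g (D.step u h) := by
  obtain ⟨hm, C, hC0, hC⟩ := (memBg_iff hgrowth.one_le_g).1 hh
  have hbK : 0 ≤ b * (Klam : ℝ) := mul_nonneg hgrowth.b_nonneg Klam.2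
  refine (memBg_iff hgrowth.one_le_g).2 ⟨measurable_step u hm, C * (1 + b * Klam), by positivity,
    fun x => (abs_integral_Gmeas_le hcont hgrowth hrate hC0 hC (u.feedback_mem x)).trans ?_⟩
  have hg1 := hgrowth.one_le_g x x.2
  rw [mul_assoc]
  gcongr
  nlinarith

theorem G_feedback_toReal (u : D.Policy) {h : D.E → ℝ} (hh : D.MemBg g h) (x : D.E) :
    (D.G h x (u.feedback x)).toReal = D.step u h x := by
  obtain ⟨hm, C, -, hC⟩ := (memBg_iff hgrowth.one_le_g).1 hh
  rw [D.G_eq_integral hm (integrable_Gmeas hcont hgrowth hrate hm hC (u.feedback_mem x)),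
    EReal.toReal_coe, step]

theorem Giter_succ (u : D.Policy) {h : D.E → ℝ} (hh : D.MemBg g h) (k : ℕ) :
    D.Giter u (k + 1) h = D.Giter u k (D.step u h) := by
  rw [Giter, Function.iterate_succ_apply, Giter]
  congr 1
  funext x
  exact G_feedback_toReal hcont hgrowth hrate u hh x

theorem memBg_Giter (u : D.Policy) {h : D.E → ℝ} (hh : D.MemBg g h) (k : ℕ) :
    D.MemBg g (D.Giter u k h) := by
  induction k generalizing h with
  | zero => exact hh
  | succ k ih =>
    rw [Giter_succ hcont hgrowth hrate u hh]
    exact ih (memBg_step hcont hgrowth hrate u hh)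

theorem Giter_succ' (u : D.Policy) {h : D.E → ℝ} (hh : D.MemBg g h) (k : ℕ) :
    D.Giter u (k + 1) h = D.step u (D.Giter u k h) := by
  rw [Giter, Function.iterate_succ_apply']
  funext x
  exact G_feedback_toReal hcont hgrowth hrate u (memBg_Giter hcont hgrowth hrate u hh k) x

theorem integrable_feedback (u : D.Policy) {h : D.E → ℝ} (hh : D.MemBg g h) (x : D.E) :
    Integrable h (D.Gmeas x (u.feedback x)) := by
  obtain ⟨hm, C, -, hC⟩ := (memBg_iff hgrowth.one_le_g).1 hh
  exact integrable_Gmeas hcont hgrowth hrate hm hC (u.feedback_mem x)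

omit hcont in
theorem memBg_L_one (u : D.Policy) :
    D.MemBg g fun x => (D.L (fun _ _ => 1) x (u.feedback x)).toReal := by
  refine (memBg_iff hgrowth.one_le_g).2 ⟨(measurable_L_feedback measurable_const u).ennreal_toReal,
    Klam, Klam.2, fun x => ?_⟩
  rw [abs_of_nonneg ENNReal.toReal_nonneg]
  refine (ENNReal.toReal_le_coe_of_le_coe
    (L_one_le hgrowth.c_pos.le hrate (u.feedback_mem x))).trans ?_
  exact le_mul_of_one_le_right Klam.2 (hgrowth.one_le_g x x.2)

include herg

/-- The limit law of a policy is invariant under its post-jump kernel. -/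
theorem integral_step (u : D.Policy) {h : D.E → ℝ} (hh : D.MemBg g h) :
    ∫ z, D.step u h z ∂(ν u) = ∫ z, h z ∂(ν u) := by
  obtain ⟨x⟩ := herg.nonempty u
  have h1 := herg.tendsto u (memBg_step hcont hgrowth hrate u hh) x
  have h2 := (tendsto_add_atTop_iff_nat 1).2 (herg.tendsto u hh x)
  simp_rw [Giter_succ hcont hgrowth hrate u hh] at h2
  exact tendsto_nhds_unique h1 h2

/-- The expected time between jumps is positive, because every flow line spends some time in `E`. -/
theorem integral_L_one_pos (u : D.Policy) :
    0 < ∫ x, (D.L (fun _ _ => 1) x (u.feedback x)).toReal ∂(ν u) := by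
  have := herg.prob u
  have hi := herg.integrable hgrowth.g_mac.measurable hgrowth.one_le_g u
    (memBg_L_one hgrowth hrate u)
  rw [integral_pos_iff_support_of_nonneg (fun x => ENNReal.toReal_nonneg) hi]
  have : Function.support (fun x => (D.L (fun _ _ => 1) x (u.feedback x)).toReal) = Set.univ :=
    Set.eq_univ_of_forall fun x => (L_one_toReal_pos hcont (u.feedback_mem x)
      ((L_one_le hgrowth.c_pos.le hrate (u.feedback_mem x)).trans_lt ENNReal.coe_lt_top)).ne'
  rw [this]
  simp

/-- The stationary mean of the one-stage cost; by invariance `h` enters through its plain mean. -/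
theorem integral_objR (u : D.Policy) (ρ : ℝ) {h : D.E → ℝ} (hh : D.MemBg g h) :
    ∫ x, D.objR ρ h x (u.feedback x) ∂(ν u) =
      -ρ * ∫ x, (D.L (fun _ _ => 1) x (u.feedback x)).toReal ∂(ν u) +
        ∫ x, D.objR 0 (fun _ => 0) x (u.feedback x) ∂(ν u) + ∫ z, h z ∂(ν u) := by
  have hI : ∀ {h : D.E → ℝ}, D.MemBg g h → Integrable h (ν u) := fun hh =>
    herg.integrable hgrowth.g_mac.measurable hgrowth.one_le_g u hh
  have h0 := memBg_zero hgrowth.one_le_g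
  have hL := memBg_L_one hgrowth hrate u
  simp_rw [objR_eq_add_step u ρ h, objR_zero_eq _ ρ]
  rw [integral_add, integral_add, integral_const_mul, integral_step hcont hgrowth hrate herg u hh]
  · exact hI (hL.const_mul hgrowth.one_le_g _)
  · exact hI (memBg_objR hcont hgrowth hrate u 0 h0)
  · exact hI ((hL.const_mul hgrowth.one_le_g _).add hgrowth.one_le_g
      (memBg_objR hcont hgrowth hrate u 0 h0))
  · exact hI (memBg_step hcont hgrowth hrate u hh)

omit herg in
theorem isPoissonPair_iff (u : D.Policy) (ρ : ℝ) (h : D.E → ℝ) :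
    D.IsPoissonPair g ν u ρ h ↔ D.MemBg g h ∧
      (∀ x, h x = D.objR ρ h x (u.feedback x)) ∧ ∫ z, h z ∂(ν u) = 0 := by
  constructor
  · intro hp
    refine ⟨hp.memBg, fun x => ?_, hp.normalized⟩
    have := hp.eq x
    rw [objective_eq hcont hgrowth hrate hp.memBg ρ (u.feedback_mem x)] at this
    exact_mod_cast this
  · rintro ⟨h1, h2, h3⟩
    refine ⟨h1, fun x => ?_, h3⟩
    rw [objective_eq hcont hgrowth hrate h1 ρ (u.feedback_mem x), ← h2 x]

/-- The gain of a policy is determined by its limit law. -/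
theorem gain_eq (u : D.Policy) {ρ : ℝ} {h : D.E → ℝ} (hp : D.IsPoissonPair g ν u ρ h) :
    ρ * ∫ x, (D.L (fun _ _ => 1) x (u.feedback x)).toReal ∂(ν u) =
      ∫ x, D.objR 0 (fun _ => 0) x (u.feedback x) ∂(ν u) := by
  obtain ⟨h1, h2, h3⟩ := (isPoissonPair_iff hcont hgrowth hrate u ρ h).1 hp
  have := integral_objR hcont hgrowth hrate herg u ρ h1
  simp_rw [← h2] at this
  rw [h3] at this
  linarith

/-- The gains agree by `gain_eq`. The difference of the value functions is fixed by the post-jump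
kernel, so that ergodicity identifies it with its mean, which is zero. -/
theorem poissonPair_unique (u : D.Policy) {ρ ρ' : ℝ} {h h' : D.E → ℝ}
    (hp : D.IsPoissonPair g ν u ρ h) (hp' : D.IsPoissonPair g ν u ρ' h') : ρ = ρ' ∧ h = h' := by
  have hρ : ρ = ρ' := by
    have h1 := gain_eq hcont hgrowth hrate herg u hp
    have h2 := gain_eq hcont hgrowth hrate herg u hp'
    exact mul_right_cancel₀ (integral_L_one_pos hcont hgrowth hrate herg u).ne' (h1.trans h2.symm)
  subst hρ
  refine ⟨rfl, ?_⟩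
  obtain ⟨h1, h2, h3⟩ := (isPoissonPair_iff hcont hgrowth hrate u ρ h).1 hp
  obtain ⟨h1', h2', h3'⟩ := (isPoissonPair_iff hcont hgrowth hrate u ρ h').1 hp'
  have hI : ∀ {h : D.E → ℝ}, D.MemBg g h → Integrable h (ν u) := fun hh =>
    herg.integrable hgrowth.g_mac.measurable hgrowth.one_le_g u hh
  have hn' := h1'.const_mul hgrowth.one_le_g (-1)
  set d : D.E → ℝ := fun x => h x + -1 * h' x with hd
  have hdm : D.MemBg g d := h1.add hgrowth.one_le_g hn'
  have hd0 : ∫ z, d z ∂(ν u) = 0 := by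
    rw [hd, integral_add (hI h1) (hI hn'), integral_const_mul, h3, h3']
    simp
  -- the difference of two solutions is harmonic for the post-jump kernel
  have hstep : D.step u d = d := by
    funext x
    have e1 := objR_eq_add_step u ρ h x
    have e2 := objR_eq_add_step u ρ h' x
    rw [← h2 x] at e1
    rw [← h2' x] at e2
    have : D.step u d x = D.step u h x + -1 * D.step u h' x := by
      rw [step, hd, integral_add (integrable_feedback hcont hgrowth hrate u h1 x)
        (integrable_feedback hcont hgrowth hrate u hn' x), integral_const_mul]
      rfl
    rw [this, hd]
    dsimp only
    linarith
  have hit : ∀ k, D.Giter u k d = d := by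
    intro k
    induction k with
    | zero => rfl
    | succ k ih => rw [Giter_succ hcont hgrowth hrate u hdm, hstep, ih]
  funext x
  have ht := herg.tendsto u hdm x
  simp_rw [hit] at ht
  have := tendsto_nhds_unique ht tendsto_const_nhds
  rw [hd0] at this
  simp only [hd] at this
  linarith

/-- The value function is the sum of the iterates of a cost with stationary mean zero, which decay
geometrically by ergodicity. -/
theorem exists_poissonPair (u : D.Policy) : ∃ (ρ : ℝ) (h : D.E → ℝ), D.IsPoissonPair g ν u ρ h := by
  have hg1 := hgrowth.one_le_g
  have hpos := integral_L_one_pos hcont hgrowth hrate herg u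
  set ρ : ℝ := (∫ x, D.objR 0 (fun _ => 0) x (u.feedback x) ∂(ν u)) /
    ∫ x, (D.L (fun _ _ => 1) x (u.feedback x)).toReal ∂(ν u) with hρ
  set w : D.E → ℝ := fun x => D.objR ρ (fun _ => 0) x (u.feedback x) with hw
  have h0 := memBg_zero hgrowth.one_le_g
  have hwm : D.MemBg g w := memBg_objR hcont hgrowth hrate u ρ h0
  have hw0 : ∫ x, w x ∂(ν u) = 0 := by
    rw [hw, integral_objR hcont hgrowth hrate herg u ρ h0, hρ]
    simp only [integral_zero, add_zero]
    rw [neg_mul, div_mul_cancel₀ _ hpos.ne']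
    ring
  set v : ℕ → D.E → ℝ := fun k => D.Giter u k w with hv
  set C : ℝ := a * D.normBg g w with hC
  have hC0 : 0 ≤ C := mul_nonneg herg.a_pos.le (normBg_nonneg hg1 w)
  have hvb : ∀ k x, |v k x| ≤ C * κ ^ k * g x := fun k x => by
    have := herg.conv u w hwm k x
    rwa [hw0, sub_zero] at this
  have hvm : ∀ k, D.MemBg g (v k) := memBg_Giter hcont hgrowth hrate u hwm
  have hgeo := summable_geometric_of_lt_one herg.κ_pos.le herg.κ_lt_one
  have hsum : ∀ x, Summable fun k => C * κ ^ k * g x := fun x =>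
    (hgeo.mul_left C).mul_right (g x)
  have hvs : ∀ x, Summable fun k => v k x := fun x =>
    Summable.of_norm_bounded (hsum x) fun k => hvb k x
  set h : D.E → ℝ := fun x => ∑' k, v k x with hh
  have hmeas : Measurable h := by
    refine measurable_of_tendsto_metrizable (f := fun N x => ∑ k ∈ Finset.range N, v k x)
      (fun N => Finset.measurable_sum _ fun k _ => (hvm k).1) ?_
    exact tendsto_pi_nhds.2 fun x => (hvs x).hasSum.tendsto_sum_nat
  have hhb : D.MemBg g h := by
    refine (memBg_iff hg1).2 ⟨hmeas, C * (1 - κ)⁻¹, mul_nonneg hC0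
      (inv_nonneg.2 (sub_nonneg.2 herg.κ_lt_one.le)), fun x => ?_⟩
    have hs : HasSum (fun k => C * κ ^ k * g x) (C * (1 - κ)⁻¹ * g x) :=
      ((hasSum_geometric_of_lt_one herg.κ_pos.le herg.κ_lt_one).mul_left C).mul_right (g x)
    exact tsum_of_norm_bounded (f := fun k => v k x) hs fun k => hvb k x
  have hint : ∀ (μ : Measure D.E), Integrable (fun z : D.E => g z) μ →
      HasSum (fun k => ∫ z, v k z ∂μ) (∫ z, h z ∂μ) := by
    intro μ hμ
    have hb : ∀ k, ∀ᵐ z ∂μ, ‖v k z‖ ≤ C * κ ^ k * g z := fun k => ae_of_all _ (hvb k)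
    have hiv : ∀ k, Integrable (v k) μ := fun k =>
      (hμ.const_mul (C * κ ^ k)).mono' (hvm k).1.aestronglyMeasurable (hb k)
    refine hasSum_integral_of_summable_integral_norm hiv ?_
    refine Summable.of_nonneg_of_le (fun k => integral_nonneg fun _ => norm_nonneg _)
      (fun k => ?_) ((hgeo.mul_left C).mul_right (∫ z : D.E, g z ∂μ))
    rw [← integral_const_mul]
    exact integral_mono_ae (hiv k).norm (hμ.const_mul _) (hb k)
  refine ⟨ρ, h, (isPoissonPair_iff hcont hgrowth hrate u ρ h).2 ⟨hhb, fun x => ?_, ?_⟩⟩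
  · rw [objR_eq_add_step]
    have h1 := hint _ (integrable_g_Gmeas hcont hgrowth hrate (u.feedback_mem x)).1
    have h2 : (fun k => ∫ z, v k z ∂(D.Gmeas x (u.feedback x))) = fun k => v (k + 1) x := by
      funext k
      simp only [hv]
      rw [Giter_succ' hcont hgrowth hrate u hwm]
      rfl
    rw [h2] at h1
    change (∑' k, v k x) = _
    rw [(hvs x).tsum_eq_zero_add, h1.tsum_eq]
    rfl
  · have hgi : Integrable (fun z : D.E => g z) (ν u) :=
      herg.integrable hgrowth.g_mac.measurable hg1 u ((memBg_iff hg1).2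
        ⟨hgrowth.g_mac.measurable.comp measurable_subtype_coe, 1, zero_le_one, fun x => by
          rw [abs_of_nonneg (zero_le_one.trans (hg1 x x.2)), one_mul]⟩)
    have h1 := hint _ hgi
    have h2 : (fun k => ∫ z, v k z ∂(ν u)) = fun _ => 0 := by
      funext k
      induction k with
      | zero => exact hw0
      | succ k ih =>
        simp only [hv] at ih ⊢
        rw [Giter_succ' hcont hgrowth hrate u hwm, integral_step hcont hgrowth hrate herg u (hvm k)]
        exact ih
    rw [h2] at h1
    exact h1.unique hasSum_zero

/-- The relative value function of a policy is bounded below by arbitrarily small multiples of the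
weight: before `N` jumps the costs are bounded below, and afterwards geometric ergodicity makes
the remaining value small compared with `g`. -/
theorem IsPoissonPair.exists_lower_bound {u : D.Policy} {ρ : ℝ} {h : D.E → ℝ}
    (hp : D.IsPoissonPair g ν u ρ h) {ε : ℝ} (hε : 0 < ε) :
    ∃ C, 0 ≤ C ∧ ∀ x : D.E, -(ε * g x) - C ≤ h x := by
  obtain ⟨h1, h2, h3⟩ := (isPoissonPair_iff hcont hgrowth hrate u ρ h).1 hp
  set C₁ : ℝ := |ρ| * Klam with hC₁
  have hC₁0 : 0 ≤ C₁ := mul_nonneg (abs_nonneg _) Klam.2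
  have hstep : ∀ x, -C₁ + D.step u h x ≤ h x := by
    intro x
    have e1 := objR_eq_add_step u ρ h x
    rw [← h2 x] at e1
    have e2 : -C₁ ≤ D.objR ρ (fun _ => 0) x (u.feedback x) := by
      have hL : (D.L (fun _ _ => 1) x (u.feedback x)).toReal ≤ Klam :=
        ENNReal.toReal_le_coe_of_le_coe (L_one_le hgrowth.c_pos.le hrate (u.feedback_mem x))
      have hL0 : 0 ≤ (D.L (fun _ _ => 1) x (u.feedback x)).toReal := ENNReal.toReal_nonneg
      have h4 : ρ * (D.L (fun _ _ => 1) x (u.feedback x)).toReal ≤ C₁ :=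
        mul_le_mul (le_abs_self ρ) hL hL0 (abs_nonneg ρ)
      have h5 : 0 ≤ (D.L (fun y a => (D.f y a : ℝ≥0∞)) x (u.feedback x)).toReal :=
        ENNReal.toReal_nonneg
      have h6 : 0 ≤ (D.H (fun y a => (D.r y a : ℝ≥0∞)) x (u.feedback x)).toReal :=
        ENNReal.toReal_nonneg
      simp only [objR, integral_zero]
      linarith
    linarith
  have hN : ∀ (N : ℕ) (x : D.E), -(N * C₁) + D.Giter u N h x ≤ h x := by
    intro N
    induction N with
    | zero => intro x; simp [Giter]
    | succ N ih =>
      intro x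
      have hmem := memBg_Giter hcont hgrowth hrate u h1 N
      have hmass : (D.Gmeas x (u.feedback x)).real Set.univ ≤ 1 :=
        ENNReal.toReal_le_of_le_ofReal zero_le_one
          (by simpa using Gmeas_univ_le_one hcont (u.feedback_mem x))
      have : IsFiniteMeasure (D.Gmeas x (u.feedback x)) :=
        ⟨(Gmeas_univ_le_one hcont (u.feedback_mem x)).trans_lt ENNReal.one_lt_top⟩
      have hmono : ∫ z, (-(N * C₁) + D.Giter u N h z) ∂(D.Gmeas x (u.feedback x)) ≤
          D.step u h x :=
        integral_mono ((integrable_const _).add (integrable_feedback hcont hgrowth hrate u hmem x))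
          (integrable_feedback hcont hgrowth hrate u h1 x) ih
      rw [integral_add (integrable_const _) (integrable_feedback hcont hgrowth hrate u hmem x),
        integral_const, smul_eq_mul] at hmono
      have hNC : 0 ≤ (N : ℝ) * C₁ := by positivity
      have h7 := mul_le_mul_of_nonneg_right hmass hNC
      rw [Giter_succ' hcont hgrowth hrate u h1]
      have h8 := hstep x
      change _ + D.step u (D.Giter u N h) x ≤ _ at hmono
      push_cast
      linarith
  set A : ℝ := a * D.normBg g h with hA
  have hlim : Tendsto (fun N : ℕ => A * κ ^ N) atTop (𝓝 0) := by
    simpa using (tendsto_pow_atTop_nhds_zero_of_lt_one herg.κ_pos.le herg.κ_lt_one).const_mul A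
  obtain ⟨N, hNε⟩ := (hlim.eventually (gt_mem_nhds hε)).exists
  refine ⟨N * C₁, by positivity, fun x => ?_⟩
  have h9 := herg.conv u h h1 N x
  rw [h3, sub_zero] at h9
  have h10 := (abs_le.1 h9).1
  have hgx : 0 ≤ g x := zero_le_one.trans (hgrowth.one_le_g x x.2)
  have h11 : A * κ ^ N * g x ≤ ε * g x := mul_le_mul_of_nonneg_right hNε.le hgx
  have := hN N x
  linarith

end PDMP

/-! ### Minimizing policies -/

namespace PDMP

variable {n : ℕ} {𝕌 : Type*} [MetricSpace 𝕌] [MeasurableSpace 𝕌] {D : PDMP n 𝕌}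
  {b c δ M : ℝ} {g Xg : EuclideanSpace ℝ (Fin n) → ℝ}
  {rbar : EuclideanSpace ℝ (Fin n) → ℝ≥0} {lamLow : EuclideanSpace ℝ (Fin n) → ℝ≥0} {Klam : ℝ≥0}

theorem integrable_g_Q (hgm : Measurable g) (hg : ∀ x ∈ D.E, 1 ≤ g x)
    {p : EuclideanSpace ℝ (Fin n) × 𝕌} (hp : D.Qg g p ≠ ⊤) :
    Integrable (fun z : D.E => g z) (D.Q p) :=
  (lintegral_ofReal_ne_top_iff_integrable (hgm.comp measurable_subtype_coe).aestronglyMeasurable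
    (ae_of_all _ fun z : D.E => zero_le_one.trans (hg z z.2))).1 hp

theorem ofReal_integral_g (hgm : Measurable g) (hg : ∀ x ∈ D.E, 1 ≤ g x)
    {p : EuclideanSpace ℝ (Fin n) × 𝕌} (hp : D.Qg g p ≠ ⊤) :
    ENNReal.ofReal (∫ z : D.E, g z ∂(D.Q p)) = D.Qg g p :=
  ofReal_integral_eq_lintegral_ofReal (integrable_g_Q hgm hg hp)
    (ae_of_all _ fun z : D.E => zero_le_one.trans (hg z z.2))

/-- Lower semicontinuity in the action of the expectation of an unbounded function whose negative
part is negligible compared with the weight `g`. Only expectations of bounded functions are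
continuous in the action, so that this asymmetry is essential. -/
theorem lowerSemicontinuousOn_mul_integral (hgm : Measurable g) (hg : ∀ x ∈ D.E, 1 ≤ g x)
    {S : Set 𝕌} {l : 𝕌 → ℝ≥0} (hl : ContinuousOn l S) {y : EuclideanSpace ℝ (Fin n)}
    (hQ : ∀ h : D.E → ℝ, Measurable h → (∃ C, ∀ z, |h z| ≤ C) →
      ContinuousOn (fun a => ∫ z, h z ∂(D.Q (y, a))) S)
    {B : ℝ≥0} (hB : ∀ a ∈ S, (l a : ℝ≥0∞) * D.Qg g (y, a) ≤ B)
    {h : D.E → ℝ} (hh : D.MemBg g h)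
    (hlow : ∀ ε > 0, ∃ C, 0 ≤ C ∧ ∀ x : D.E, -(ε * g x) - C ≤ h x) :
    LowerSemicontinuousOn (fun a => (l a : ℝ) * ∫ z, h z ∂(D.Q (y, a))) S := by
  obtain ⟨hm, C, hC0, hC⟩ := (memBg_iff hg).1 hh
  have hgE : Measurable fun z : D.E => g z := hgm.comp measurable_subtype_coe
  intro a₀ ha₀ m hma
  set η : ℝ := (l a₀ * ∫ z, h z ∂(D.Q (y, a₀)) - m) / 3 with hη
  have hη0 : 0 < η := by
    have : m < l a₀ * ∫ z, h z ∂(D.Q (y, a₀)) := hma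
    rw [hη]; linarith
  have hε : 0 < η / (B + 1) := by positivity
  obtain ⟨Cε, hCε0, hCε⟩ := hlow _ hε
  set ε : ℝ := η / (B + 1) with hεdef
  set ψ : ℕ → D.E → ℝ := fun N z => min (h z + ε * g z) N with hψ
  have hψm : ∀ N, Measurable (ψ N) := fun N => (hm.add (hgE.const_mul ε)).min measurable_const
  have hψl : ∀ N z, -Cε ≤ ψ N z := fun N z =>
    le_min (by linarith [hCε z]) (by have : (0 : ℝ) ≤ N := N.cast_nonneg; linarith)
  have hψb : ∀ N, ∃ K, ∀ z, |ψ N z| ≤ K := fun N => ⟨max Cε N, fun z =>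
    abs_le.2 ⟨by linarith [hψl N z, le_max_left Cε (N : ℝ)], (min_le_right _ _).trans (le_max_right _ _)⟩⟩
  have hψi : ∀ N a, Integrable (ψ N) (D.Q (y, a)) := fun N a => by
    obtain ⟨K, hK⟩ := hψb N
    exact Integrable.of_bound (hψm N).aestronglyMeasurable K (ae_of_all _ hK)
  have hcontψ : ∀ N, ContinuousOn (fun a => (l a : ℝ) * ∫ z, ψ N z ∂(D.Q (y, a))) S := fun N =>
    (NNReal.continuous_coe.comp_continuousOn hl).mul (hQ _ (hψm N) (hψb N))
  have hfin : ∀ a ∈ S, l a ≠ 0 → D.Qg g (y, a) ≠ ⊤ := by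
    intro a ha hla htop
    have := hB a ha
    rw [htop, ENNReal.mul_top (by simpa using hla)] at this
    exact absurd this (not_le.2 ENNReal.coe_lt_top)
  have hhi : ∀ a ∈ S, l a ≠ 0 → Integrable h (D.Q (y, a)) := fun a ha hla =>
    ((integrable_g_Q hgm hg (hfin a ha hla)).const_mul C).mono' hm.aestronglyMeasurable
      (ae_of_all _ hC)
  have hlg : ∀ a ∈ S, (l a : ℝ) * ∫ z : D.E, g z ∂(D.Q (y, a)) ≤ B := by
    intro a ha
    by_cases hla : l a = 0
    · simp [hla]
    · have h1 := hB a ha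
      rw [← ofReal_integral_g hgm hg (hfin a ha hla), ← ENNReal.ofReal_coe_nnreal,
        ← ENNReal.ofReal_mul (NNReal.coe_nonneg (l a)), ← ENNReal.ofReal_coe_nnreal (p := B)] at h1
      exact (ENNReal.ofReal_le_ofReal_iff (NNReal.coe_nonneg B)).1 h1
  -- comparison of `l ∫ h` with its continuous minorants
  have hcomp : ∀ N, ∀ a ∈ S, (l a : ℝ) * ∫ z, ψ N z ∂(D.Q (y, a)) - ε * B ≤
      l a * ∫ z, h z ∂(D.Q (y, a)) := by
    intro N a ha
    by_cases hla : l a = 0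
    · simp only [hla, NNReal.coe_zero, zero_mul, zero_sub, Left.neg_nonpos_iff]
      positivity
    · have hgi := integrable_g_Q hgm hg (hfin a ha hla)
      have h1 : ∫ z, ψ N z ∂(D.Q (y, a)) ≤ ∫ z, (h z + ε * g z) ∂(D.Q (y, a)) :=
        integral_mono (hψi N a) ((hhi a ha hla).add (hgi.const_mul ε)) fun z => min_le_left _ _
      rw [integral_add (hhi a ha hla) (hgi.const_mul ε), integral_const_mul] at h1
      have h2 := mul_le_mul_of_nonneg_left h1 (l a).2
      have h3 := mul_le_mul_of_nonneg_left (hlg a ha) hε.le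
      change (l a : ℝ) * _ ≤ (l a : ℝ) * _ at h2
      linarith
  have hlim : ∃ N, (l a₀ : ℝ) * ∫ z, h z ∂(D.Q (y, a₀)) - η <
      l a₀ * ∫ z, ψ N z ∂(D.Q (y, a₀)) := by
    by_cases hla : l a₀ = 0
    · exact ⟨0, by simpa [hla] using hη0⟩
    have hgi := integrable_g_Q hgm hg (hfin a₀ ha₀ hla)
    have hsum := (hhi a₀ ha₀ hla).add (hgi.const_mul ε)
    have htend : Tendsto (fun N => ∫ z, ψ N z ∂(D.Q (y, a₀))) atTop
        (𝓝 (∫ z, (h z + ε * g z) ∂(D.Q (y, a₀)))) := by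
      refine tendsto_integral_of_dominated_convergence
        (fun z => |h z + ε * g z| + Cε) (fun N => (hψm N).aestronglyMeasurable)
        (hsum.abs.add (integrable_const _)) (fun N => ae_of_all _ fun z => ?_)
        (ae_of_all _ fun z => ?_)
      · rw [Real.norm_eq_abs, abs_le]
        constructor
        · linarith [hψl N z, abs_nonneg (h z + ε * g z)]
        · linarith [min_le_left (h z + ε * g z) (N : ℝ), le_abs_self (h z + ε * g z)]
      · obtain ⟨N₀, hN₀⟩ := exists_nat_ge (h z + ε * g z)
        refine tendsto_const_nhds.congr' ?_
        filter_upwards [eventually_ge_atTop N₀] with N hN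
        exact (min_eq_left (hN₀.trans (Nat.cast_le.2 hN))).symm
    have hlt : (l a₀ : ℝ) * ∫ z, h z ∂(D.Q (y, a₀)) - η <
        l a₀ * ∫ z, (h z + ε * g z) ∂(D.Q (y, a₀)) := by
      rw [integral_add (hhi a₀ ha₀ hla) (hgi.const_mul ε), integral_const_mul]
      have h1 : 0 ≤ ∫ z : D.E, g z ∂(D.Q (y, a₀)) :=
        integral_nonneg fun z => zero_le_one.trans (hg z z.2)
      have h2 : 0 ≤ (l a₀ : ℝ) * (ε * ∫ z : D.E, g z ∂(D.Q (y, a₀))) := by positivity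
      linarith
    exact ((htend.const_mul (l a₀ : ℝ)).eventually (lt_mem_nhds hlt)).exists
  obtain ⟨N, hN⟩ := hlim
  have hev := (hcontψ N a₀ ha₀).eventually (lt_mem_nhds (show
    (l a₀ : ℝ) * ∫ z, h z ∂(D.Q (y, a₀)) - 2 * η < l a₀ * ∫ z, ψ N z ∂(D.Q (y, a₀)) by linarith))
  have hεB : ε * B < η := by
    rw [hεdef, div_mul_eq_mul_div, div_lt_iff₀ (by positivity)]
    nlinarith
  filter_upwards [hev, self_mem_nhdsWithin] with a ha haS
  have h1 := hcomp N a haS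
  change m < _
  rw [hη] at *
  linarith

/-- The graph of the feasible actions over a Borel set of states. -/
theorem measurableSet_graph_inter {S : Set (EuclideanSpace ℝ (Fin n))} (hS : MeasurableSet S)
    (hSc : S ⊆ closure D.E) :
    MeasurableSet {p : EuclideanSpace ℝ (Fin n) × 𝕌 | p.1 ∈ S ∧ p.2 ∈ D.A p.1} := by
  have : {p : EuclideanSpace ℝ (Fin n) × 𝕌 | p.1 ∈ S ∧ p.2 ∈ D.A p.1} =
      Prod.fst ⁻¹' S ∩ {p | p.1 ∈ closure D.E ∧ p.2 ∈ D.A p.1} := by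
    ext p
    exact ⟨fun h => ⟨h.1, hSc h.1, h.2⟩, fun h => ⟨h.1, h.2.2⟩⟩
  rw [this]
  exact (measurable_fst hS).inter D.measurableSet_graph

/-- The boundary states at which `Qg` is bounded over the feasible actions. -/
def tameBoundary (D : PDMP n 𝕌) (g : EuclideanSpace ℝ (Fin n) → ℝ) :
    Set (EuclideanSpace ℝ (Fin n)) :=
  {z | z ∈ frontier D.E ∧ ∃ m : ℕ, ∀ a ∈ D.A z, D.Qg g (z, a) ≤ m}

theorem tameBoundary_subset : D.tameBoundary g ⊆ closure D.E :=
  fun _ hz => frontier_subset_closure hz.1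

theorem exit_mem_tameBoundary (hgrowth : D.GrowthCondition b c δ M g rbar) (x : D.E)
    (hT : D.tstar x ≠ ⊤) : D.exit x ∈ D.tameBoundary g := by
  obtain ⟨ℓ, hℓ⟩ := hgrowth.g_mac.limit x hT
  obtain ⟨m, hm⟩ := exists_nat_ge ℓ
  refine ⟨D.exit_mem_frontier x, m, fun a ha => ?_⟩
  refine (le_trans le_add_self (hgrowth.boundary x hT ℓ hℓ a ha)).trans ?_
  rw [← ENNReal.ofReal_natCast]
  exact ENNReal.ofReal_le_ofReal hm

section Borel

variable [BorelSpace 𝕌] [CompactSpace 𝕌]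

/-- A policy that minimizes a function over a Borel set of states; elsewhere it follows `u`. -/
theorem exists_policy_argmin (u : D.Policy) {S : Set (EuclideanSpace ℝ (Fin n))}
    (hS : MeasurableSet S) (hSc : S ⊆ closure D.E) {F : EuclideanSpace ℝ (Fin n) × 𝕌 → ℝ}
    (hF : Measurable F) (hl : ∀ y ∈ S, LowerSemicontinuousOn (fun a => F (y, a)) (D.A y)) :
    ∃ u' : D.Policy, ∀ y ∈ S, ∀ a ∈ D.A y, F (y, u'.toFun y) ≤ F (y, a) := by
  classical
  set K : Set (EuclideanSpace ℝ (Fin n) × 𝕌) := {p | p.1 ∈ S ∧ p.2 ∈ D.A p.1} with hK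
  have hsec : ∀ y ∈ S, {a | (y, a) ∈ K} = D.A y := fun y hy => by
    ext a
    exact ⟨fun h => h.2, fun h => ⟨hy, h⟩⟩
  have hsec' : ∀ y ∉ S, {a | (y, a) ∈ K} = ∅ := fun y hy => by
    ext a
    exact ⟨fun h => (hy h.1).elim, fun h => h.elim⟩
  obtain ⟨v, hv, hvK⟩ := exists_measurable_argmin (measurableSet_graph_inter (D := D) hS hSc)
    (fun y => by
      change IsClosed {a | (y, a) ∈ K}
      by_cases hy : y ∈ S
      · rw [hsec y hy]
        exact (D.isCompact_A y (hSc hy)).isClosed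
      · rw [hsec' y hy]
        exact isClosed_empty) hF
    (fun y => by
      change LowerSemicontinuousOn (fun a => F (y, a)) {a | (y, a) ∈ K}
      by_cases hy : y ∈ S
      · rw [hsec y hy]
        exact hl y hy
      · rw [hsec' y hy]
        intro a ha
        exact ha.elim) u.measurable_toFun
  have hvS : ∀ y ∈ S, v y ∈ D.A y ∧ ∀ a ∈ D.A y, F (y, v y) ≤ F (y, a) := fun y hy => by
    obtain ⟨h1, h2⟩ := hvK y ⟨u.toFun y, hy, u.mem_A y (hSc hy)⟩
    exact ⟨h1.2, fun a ha => h2 a ⟨hy, ha⟩⟩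
  refine ⟨⟨fun y => if y ∈ S then v y else u.toFun y, Measurable.ite hS hv u.measurable_toFun,
    fun y hy => ?_⟩, fun y hy a ha => ?_⟩
  · split_ifs with h
    · exact (hvS y h).1
    · exact u.mem_A y hy
  · simp only [hy, if_true]
    exact (hvS y hy).2 a ha

/-- The set is a countable union of complements of projections of Borel sets with compact sections. -/
theorem measurableSet_tameBoundary (hcont : D.ContinuityAssumptions) (hgm : Measurable g)
    (hg : ∀ x ∈ D.E, 1 ≤ g x) : MeasurableSet (D.tameBoundary g) := by
  have hgE : Measurable fun z : D.E => g z := hgm.comp measurable_subtype_coe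
  set q : ℕ → EuclideanSpace ℝ (Fin n) × 𝕌 → ℝ := fun k p =>
    ∫ z : D.E, min (g z) k ∂(D.Q p) with hq
  have htm : ∀ k : ℕ, Measurable fun z : D.E => min (g z) (k : ℝ) := fun k =>
    hgE.min measurable_const
  have htn : ∀ (k : ℕ) (z : D.E), 0 ≤ min (g z) (k : ℝ) := fun k z =>
    le_min (zero_le_one.trans (hg z z.2)) k.cast_nonneg
  have htb : ∀ (k : ℕ) (z : D.E), |min (g z) (k : ℝ)| ≤ k := fun k z => by
    rw [abs_of_nonneg (htn k z)]
    exact min_le_right _ _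
  have hqm : ∀ k, Measurable (q k) := fun k => D.measurable_Q_integral (htm k)
  have hqQ : ∀ p (m : ℕ), (m : ℝ≥0∞) < D.Qg g p ↔ ∃ k j : ℕ, (m : ℝ) + 1 / (j + 1) ≤ q k p := by
    intro p m
    have hsup : D.Qg g p = ⨆ k : ℕ, ENNReal.ofReal (q k p) := by
      have h1 : ∀ k, ENNReal.ofReal (q k p) =
          ∫⁻ z : D.E, ENNReal.ofReal (min (g z) k) ∂(D.Q p) := fun k =>
        ofReal_integral_eq_lintegral_ofReal
          (Integrable.of_bound (htm k).aestronglyMeasurable k (ae_of_all _ (htb k)))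
          (ae_of_all _ (htn k))
      simp_rw [h1]
      rw [← lintegral_iSup (fun k => (htm k).ennreal_ofReal) (fun k k' hkk' z =>
        ENNReal.ofReal_le_ofReal (min_le_min_left _ (Nat.cast_le.2 hkk')))]
      refine lintegral_congr fun z => le_antisymm ?_ (iSup_le fun k =>
        ENNReal.ofReal_le_ofReal (min_le_left _ _))
      obtain ⟨N, hN⟩ := exists_nat_ge (g z)
      refine le_iSup_of_le N ?_
      rw [min_eq_left hN]
    rw [hsup, lt_iSup_iff]
    refine exists_congr fun k => ?_
    rw [← ENNReal.ofReal_natCast, ENNReal.ofReal_lt_ofReal_iff_of_nonneg m.cast_nonneg]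
    constructor
    · intro h
      obtain ⟨j, hj⟩ := exists_nat_one_div_lt (sub_pos.2 h)
      exact ⟨j, by linarith⟩
    · rintro ⟨j, hj⟩
      have : (0 : ℝ) < 1 / (j + 1) := by positivity
      linarith
  have hproj : ∀ (m k j : ℕ), MeasurableSet {z | ∃ a, (z, a) ∈
      {p : EuclideanSpace ℝ (Fin n) × 𝕌 | p.1 ∈ closure D.E ∧ p.2 ∈ D.A p.1} ∩
        {p | (m : ℝ) + 1 / (j + 1) ≤ q k p}} := by
    intro m k j
    refine measurableSet_proj_of_isClosed_sections
      (D.measurableSet_graph.inter (hqm k measurableSet_Ici)) fun z => ?_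
    by_cases hz : z ∈ closure D.E
    · have : {a | (z, a) ∈ {p : EuclideanSpace ℝ (Fin n) × 𝕌 | p.1 ∈ closure D.E ∧ p.2 ∈ D.A p.1} ∩
          {p | (m : ℝ) + 1 / (j + 1) ≤ q k p}} =
          D.A z ∩ (fun a => q k (z, a)) ⁻¹' Set.Ici ((m : ℝ) + 1 / (j + 1)) := by
        ext a
        exact ⟨fun h => ⟨h.1.2, h.2⟩, fun h => ⟨⟨hz, h.1⟩, h.2⟩⟩
      rw [this]
      exact (hcont.Q_cont z hz _ (htm k) ⟨k, htb k⟩).preimage_isClosed_of_isClosed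
        (D.isCompact_A z hz).isClosed isClosed_Ici
    · have : {a | (z, a) ∈ {p : EuclideanSpace ℝ (Fin n) × 𝕌 | p.1 ∈ closure D.E ∧ p.2 ∈ D.A p.1} ∩
          {p | (m : ℝ) + 1 / (j + 1) ≤ q k p}} = ∅ := by
        ext a
        exact ⟨fun h => (hz h.1.1).elim, fun h => h.elim⟩
      rw [this]
      exact isClosed_empty
  have heq : D.tameBoundary g = frontier D.E ∩ ⋃ m : ℕ, (⋃ k : ℕ, ⋃ j : ℕ, {z | ∃ a, (z, a) ∈
      {p : EuclideanSpace ℝ (Fin n) × 𝕌 | p.1 ∈ closure D.E ∧ p.2 ∈ D.A p.1} ∩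
        {p | (m : ℝ) + 1 / (j + 1) ≤ q k p}})ᶜ := by
    ext z
    refine and_congr_right fun hz => ?_
    rw [Set.mem_iUnion]
    refine exists_congr fun m => ?_
    constructor
    · intro h hz'
      simp only [Set.mem_iUnion] at hz'
      obtain ⟨k, j, a, ha⟩ := hz'
      exact absurd (h a ha.1.2) (not_le.2 ((hqQ (z, a) m).2 ⟨k, j, ha.2⟩))
    · intro h a ha
      by_contra! hlt
      obtain ⟨k, j, hkj⟩ := (hqQ (z, a) m).1 hlt
      refine h ?_
      simp only [Set.mem_iUnion]
      exact ⟨k, j, a, ⟨frontier_subset_closure hz, ha⟩, hkj⟩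
  rw [heq]
  exact measurableSet_frontier.inter (MeasurableSet.iUnion fun m =>
    (MeasurableSet.iUnion fun k => MeasurableSet.iUnion fun j => hproj m k j).compl)

/-- The jump rate is maximized by a policy. -/
theorem exists_policy_max_rate (hcont : D.ContinuityAssumptions) (u : D.Policy) :
    ∃ u' : D.Policy, ∀ y ∈ D.E, ∀ a ∈ D.A y, D.lam y a ≤ D.lam y (u'.toFun y) := by
  obtain ⟨u', hu'⟩ := exists_policy_argmin u D.isOpen_E.measurableSet subset_closure
    (F := fun p => -(D.lam p.1 p.2 : ℝ)) (measurable_coe_nnreal_real.comp D.measurable_lam_prod).neg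
    (fun y hy => (NNReal.continuous_coe.comp_continuousOn
      (hcont.lam_cont y hy)).neg.lowerSemicontinuousOn)
  refine ⟨u', fun y hy a ha => ?_⟩
  have := hu' y hy a ha
  exact NNReal.coe_le_coe.1 (neg_le_neg_iff.1 this)

/-- The running Hamiltonian `f + λ Qh - λ v`, up to the constant `-ρ`. -/
def ham (D : PDMP n 𝕌) (h : D.E → ℝ) (v : ℝ) (y : EuclideanSpace ℝ (Fin n)) (a : 𝕌) : ℝ :=
  D.f y a + D.lamQ h (y, a) - D.lam y a * v

/-- The boundary Hamiltonian `r + Qh`. -/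
def bham (D : PDMP n 𝕌) (h : D.E → ℝ) (z : EuclideanSpace ℝ (Fin n)) (a : 𝕌) : ℝ :=
  D.r z a + ∫ x, h x ∂(D.Q (z, a))

/-- One policy minimizes the running Hamiltonian at every interior state and the boundary Hamiltonian
at every exit state. Exit states are tame, which makes the boundary Hamiltonian lower
semicontinuous there; at other boundary states it need not have a minimizer. -/
theorem exists_policy_ham (hcont : D.ContinuityAssumptions)
    (hgrowth : D.GrowthCondition b c δ M g rbar) {h : D.E → ℝ} (hh : D.MemBg g h)
    (hlow : ∀ ε > 0, ∃ C, 0 ≤ C ∧ ∀ x : D.E, -(ε * g x) - C ≤ h x)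
    (u : D.Policy) {W : EuclideanSpace ℝ (Fin n) → ℝ} (hW : Measurable W) :
    ∃ u' : D.Policy,
      (∀ y ∈ D.E, ∀ a ∈ D.A y, D.ham h (W y) y (u'.toFun y) ≤ D.ham h (W y) y a) ∧
      ∀ x : D.E, D.tstar x ≠ ⊤ → ∀ a ∈ D.A (D.exit x),
        D.bham h (D.exit x) (u'.toFun (D.exit x)) ≤ D.bham h (D.exit x) a := by
  classical
  have hgm := hgrowth.g_mac.measurable
  obtain ⟨Xg, hX, hd⟩ := hgrowth.exists_driftInequality
  have hEm : MeasurableSet D.E := D.isOpen_E.measurableSet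
  set F : EuclideanSpace ℝ (Fin n) × 𝕌 → ℝ := fun p =>
    if p.1 ∈ D.E then D.ham h (W p.1) p.1 p.2 else D.bham h p.1 p.2 with hF
  have hFm : Measurable F := by
    refine Measurable.ite (measurable_fst hEm) ?_ ?_
    · exact ((measurable_coe_nnreal_real.comp D.measurable_f_prod).add
        (D.measurable_lamQ hh.1)).sub
        ((measurable_coe_nnreal_real.comp D.measurable_lam_prod).mul (hW.comp measurable_fst))
    · exact (measurable_coe_nnreal_real.comp D.measurable_r_prod).add
        (D.measurable_Q_integral hh.1)
  have hnot : ∀ z ∈ frontier D.E, z ∉ D.E := fun z hz hzE => D.notMem_frontier ⟨z, hzE⟩ hz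
  obtain ⟨u', hu'⟩ := exists_policy_argmin u
    (hEm.union (measurableSet_tameBoundary hcont hgm hgrowth.one_le_g))
    (Set.union_subset subset_closure tameBoundary_subset) hFm (by
      rintro y (hy | hy)
      · simp only [hF, hy, if_true]
        have hyc := subset_closure hy
        have hlc := hcont.lam_cont y hy
        obtain ⟨B, hB⟩ := (D.isCompact_A y hyc).bddAbove_image hlc
        have hg0 : 0 ≤ g y := zero_le_one.trans (hgrowth.one_le_g y hy)
        have hl1 : LowerSemicontinuousOn (fun a => D.lamQ h (y, a)) (D.A y) := by
          refine lowerSemicontinuousOn_mul_integral hgm hgrowth.one_le_g hlc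
            (fun k => hcont.Q_cont y hyc k)
            (B := (b - Xg y - c * g y + B * g y).toNNReal) (fun a ha => ?_) hh hlow
          refine (hd y hy a ha).2.trans ?_
          have hle : (D.lam y a : ℝ) ≤ B := NNReal.coe_le_coe.2 (hB ⟨a, ha, rfl⟩)
          change ENNReal.ofReal _ ≤ ENNReal.ofReal _
          refine ENNReal.ofReal_le_ofReal ?_
          gcongr
        have hl2 : LowerSemicontinuousOn (fun a => (D.f y a : ℝ) - D.lam y a * W y) (D.A y) :=
          ((NNReal.continuous_coe.comp_continuousOn (hcont.f_cont y hyc)).sub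
            ((NNReal.continuous_coe.comp_continuousOn hlc).mul
              continuousOn_const)).lowerSemicontinuousOn
        have hl3 := hl2.add hl1
        have heq : (fun a => D.ham h (W y) y a) =
            fun a => (D.f y a : ℝ) - D.lam y a * W y + D.lamQ h (y, a) := by
          funext a
          simp only [ham]
          ring
        rw [heq]
        exact hl3
      · have hyE := hnot y hy.1
        simp only [hF, hyE, if_false]
        obtain ⟨m, hm⟩ := hy.2
        have hyc := frontier_subset_closure hy.1
        have hl1 : LowerSemicontinuousOn (fun a => ((1 : ℝ≥0) : ℝ) * ∫ x, h x ∂(D.Q (y, a)))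
            (D.A y) := by
          refine lowerSemicontinuousOn_mul_integral hgm hgrowth.one_le_g continuousOn_const
            (fun k => hcont.Q_cont y hyc k) (B := m) (fun a ha => ?_) hh hlow
          simpa using hm a ha
        have hl3 := (NNReal.continuous_coe.comp_continuousOn
          (hcont.r_cont y hy.1)).lowerSemicontinuousOn.add hl1
        have heq : (fun a => D.bham h y a) =
            fun a => (D.r y a : ℝ) + ((1 : ℝ≥0) : ℝ) * ∫ x, h x ∂(D.Q (y, a)) := by
          funext a
          simp [bham]
        rw [heq]
        exact hl3)
  refine ⟨u', fun y hy a ha => ?_, fun x hT a ha => ?_⟩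
  · have := hu' y (Or.inl hy) a ha
    simpa only [hF, hy, if_true] using this
  · have hz := exit_mem_tameBoundary hgrowth x hT
    have := hu' _ (Or.inr hz) a ha
    simpa only [hF, hnot _ hz.1, if_false] using this

end Borel

end PDMP

/-! ### The one-stage cost as an integral along the flow -/

namespace PDMP

variable {n : ℕ} {𝕌 : Type*} [MetricSpace 𝕌] [MeasurableSpace 𝕌] {D : PDMP n 𝕌}

variable {b c δ M : ℝ} {g Xg : EuclideanSpace ℝ (Fin n) → ℝ}
  {rbar : EuclideanSpace ℝ (Fin n) → ℝ≥0} {lamLow : EuclideanSpace ℝ (Fin n) → ℝ≥0} {Klam : ℝ≥0}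
  {ρ : ℝ} {h : D.E → ℝ}

/-- The running cost rate `-ρ + f + λ Qh`. -/
def cost (D : PDMP n 𝕌) (ρ : ℝ) (h : D.E → ℝ) (p : EuclideanSpace ℝ (Fin n) × 𝕌) : ℝ :=
  -ρ + D.f p.1 p.2 + D.lamQ h p

/-- The running cost rate along the flow line of `x` under a relaxed control. -/
def runCost (D : PDMP n 𝕌) (ρ : ℝ) (h : D.E → ℝ) (x : EuclideanSpace ℝ (Fin n))
    (Θ : RelaxedControl 𝕌) (s : ℝ) : ℝ := ∫ a, D.cost ρ h (D.path x s, a) ∂(Θ.μ s)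

theorem measurable_cost (hh : Measurable h) : Measurable (D.cost ρ h) :=
  (measurable_const.add (measurable_coe_nnreal_real.comp D.measurable_f_prod)).add
    (D.measurable_lamQ hh)

theorem measurable_bham (hh : Measurable h) :
    Measurable fun p : EuclideanSpace ℝ (Fin n) × 𝕌 => D.bham h p.1 p.2 :=
  (measurable_coe_nnreal_real.comp D.measurable_r_prod).add (D.measurable_Q_integral hh)

theorem rate_feedback (u : D.Policy) (x : D.E) (s : ℝ) :
    D.rate x (u.feedback x) s = D.lam (D.path x s) (u.toFun (D.path x s)) := by
  rw [rate, avg_feedback D.measurable_lam_ennreal]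
  rfl

theorem runCost_feedback (hh : Measurable h) (u : D.Policy) (x : D.E) (s : ℝ) :
    D.runCost ρ h x (u.feedback x) s = D.cost ρ h (D.path x s, u.toFun (D.path x s)) :=
  Kernel.integral_deterministic' (f := fun a => D.cost ρ h (D.path x s, a))
    (g := fun s => u.toFun (D.path x s)) (a := s)
    (u.measurable_toFun.comp (D.measurable_path x))
    ((measurable_cost hh).comp measurable_prodMk_left).stronglyMeasurable

theorem integral_bham_feedback (hh : Measurable h) (u : D.Policy) (x : D.E) :
    ∫ a, D.bham h (D.exit x) a ∂(u.feedback x).bdry = D.bham h (D.exit x) (u.toFun (D.exit x)) :=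
  integral_dirac' _ _ ((measurable_bham hh).comp measurable_prodMk_left).stronglyMeasurable

/-- The rate of jumps into `h` is of order `g`, uniformly over the feasible actions. -/
theorem abs_lamQ_le (hgm : Measurable g) (hd : D.DriftInequality b c g Xg)
    {C : ℝ} (hC0 : 0 ≤ C) (hC : ∀ x : D.E, |h x| ≤ C * g x)
    {y : EuclideanSpace ℝ (Fin n)} (hy : y ∈ D.E) {a : 𝕌} (ha : a ∈ D.A y) :
    |D.lamQ h (y, a)| ≤ C * (b - Xg y - c * g y + D.lam y a * g y) := by
  obtain ⟨h0, h1⟩ := hd y hy a ha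
  by_cases hla : D.lam y a = 0
  · simp only [lamQ, hla, NNReal.coe_zero, zero_mul, abs_zero] at h0 ⊢
    exact mul_nonneg hC0 h0
  have hl0 : (0 : ℝ) ≤ D.lam y a := NNReal.coe_nonneg _
  have hlow : |∫ z, h z ∂(D.Q (y, a))| ≤ C * (D.Qg g (y, a)).toReal := by
    have hm : AEStronglyMeasurable (fun z : D.E => g z) (D.Q (y, a)) :=
      (hgm.comp measurable_subtype_coe).aestronglyMeasurable
    have hfin : D.Qg g (y, a) ≠ ⊤ := by
      intro htop
      rw [htop, ENNReal.mul_top (by simpa using hla)] at h1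
      exact absurd h1 (not_le.2 ENNReal.ofReal_lt_top)
    calc |∫ z, h z ∂(D.Q (y, a))| ≤ (∫⁻ z, ENNReal.ofReal ‖h z‖ ∂(D.Q (y, a))).toReal :=
          norm_integral_le_lintegral_norm h
      _ ≤ (ENNReal.ofReal C * D.Qg g (y, a)).toReal := by
          refine ENNReal.toReal_mono (ENNReal.mul_ne_top ENNReal.ofReal_ne_top hfin) ?_
          rw [Qg, ← lintegral_const_mul _ (measurable_g_E hgm)]
          refine lintegral_mono fun z => ?_
          rw [← ENNReal.ofReal_mul hC0]
          exact ENNReal.ofReal_le_ofReal (hC z)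
      _ = C * (D.Qg g (y, a)).toReal := by rw [ENNReal.toReal_mul, ENNReal.toReal_ofReal hC0]
  have h2 : (D.lam y a : ℝ) * (D.Qg g (y, a)).toReal ≤ b - Xg y - c * g y + D.lam y a * g y := by
    have := ENNReal.toReal_mono ENNReal.ofReal_ne_top h1
    rwa [ENNReal.toReal_mul, ENNReal.toReal_ofReal h0] at this
  rw [lamQ, abs_mul, abs_of_nonneg hl0]
  calc (D.lam y a : ℝ) * |∫ z, h z ∂(D.Q (y, a))|
      ≤ D.lam y a * (C * (D.Qg g (y, a)).toReal) := mul_le_mul_of_nonneg_left hlow hl0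
    _ = C * (D.lam y a * (D.Qg g (y, a)).toReal) := by ring
    _ ≤ _ := mul_le_mul_of_nonneg_left h2 hC0

variable [BorelSpace 𝕌]

theorem surv_tstar_ne_zero (hcont : D.ContinuityAssumptions) {x : D.E} {Θ : RelaxedControl 𝕌}
    (hΘ : Θ ∈ D.relaxedControls x) (hT : D.tstar x ≠ ⊤) : D.surv x Θ (D.tstar x) ≠ 0 := by
  have hL := Lam_tstar_lt_top hcont hΘ hT
  rw [← ENNReal.ofReal_toReal hT] at hL ⊢
  rw [(rate_spec D ENNReal.toReal_nonneg hL).2]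
  exact (ENNReal.ofReal_pos.2 (Real.exp_pos _)).ne'

variable (hcont : D.ContinuityAssumptions)
  (hgrowth : D.GrowthCondition b c δ M g rbar)
  (hrate : D.JumpRateBounds c g lamLow Klam)

include hcont hgrowth hrate

/-- The one-stage cost as a discounted integral of the running cost and a boundary term. -/
theorem objR_eq_integral (hh : D.MemBg g h) (ρ : ℝ) {x : D.E} {Θ : RelaxedControl 𝕌}
    (hΘ : Θ ∈ D.relaxedControls x) :
    IntegrableOn (fun s => (D.surv x Θ (ENNReal.ofReal s)).toReal * D.runCost ρ h x Θ s)
      (timesBefore (D.tstar x)) ∧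
    (D.tstar x ≠ ⊤ → Integrable (fun a => D.bham h (D.exit x) a) Θ.bdry) ∧
    D.objR ρ h x Θ = (∫ s in timesBefore (D.tstar x),
        (D.surv x Θ (ENNReal.ofReal s)).toReal * D.runCost ρ h x Θ s) +
      (D.surv x Θ (D.tstar x)).toReal * ∫ a, D.bham h (D.exit x) a ∂Θ.bdry := by
  obtain ⟨hm, C, -, hC⟩ := (memBg_iff hgrowth.one_le_g).1 hh
  obtain ⟨h1, h2, h3, -⟩ := objectiveFinite hcont hgrowth hrate hh hΘ
  obtain ⟨i1, i2, e⟩ := D.integrable_of_integrable_Gmeas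
    (integrable_Gmeas hcont hgrowth hrate hm hC hΘ)
  have hfm := measurable_coe_nnreal_ennreal.comp D.measurable_f_prod
  have hrm := measurable_coe_nnreal_ennreal.comp D.measurable_r_prod
  have hone : D.occ x Θ Set.univ = D.L (fun _ _ => 1) x Θ :=
    lintegral_one.symm.trans (D.lintegral_occ (v := fun _ => 1) measurable_const x Θ)
  have hfin : IsFiniteMeasure (D.occ x Θ) := ⟨hone.trans_lt h1⟩
  have hu : (D.occ x Θ).real Set.univ = (D.L (fun _ _ => 1) x Θ).toReal :=
    congrArg _ hone
  have hfe := D.lintegral_occ hfm x Θ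
  have hre := D.lintegral_bocc hrm x Θ
  have hfi : Integrable (fun p : EuclideanSpace ℝ (Fin n) × 𝕌 => (D.f p.1 p.2 : ℝ)) (D.occ x Θ) :=
    integrable_toReal_of_lintegral_ne_top (f := fun p : EuclideanSpace ℝ (Fin n) × 𝕌 => (D.f p.1 p.2 : ℝ≥0∞)) hfm.aemeasurable
      (hfe.trans_lt h2).ne
  have hri : Integrable (fun p : EuclideanSpace ℝ (Fin n) × 𝕌 => (D.r p.1 p.2 : ℝ)) (D.bocc x Θ) :=
    integrable_toReal_of_lintegral_ne_top (f := fun p : EuclideanSpace ℝ (Fin n) × 𝕌 => (D.r p.1 p.2 : ℝ≥0∞)) hrm.aemeasurable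
      (hre.trans_lt h3).ne
  have hfe' : ∫ p, (D.f p.1 p.2 : ℝ) ∂(D.occ x Θ) =
      (D.L (fun y a => (D.f y a : ℝ≥0∞)) x Θ).toReal :=
    (integral_toReal (f := fun p : EuclideanSpace ℝ (Fin n) × 𝕌 => (D.f p.1 p.2 : ℝ≥0∞)) hfm.aemeasurable
      (ae_of_all _ fun _ => ENNReal.coe_lt_top)).trans (congrArg _ hfe)
  have hre' : ∫ p, (D.r p.1 p.2 : ℝ) ∂(D.bocc x Θ) =
      (D.H (fun y a => (D.r y a : ℝ≥0∞)) x Θ).toReal :=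
    (integral_toReal (f := fun p : EuclideanSpace ℝ (Fin n) × 𝕌 => (D.r p.1 p.2 : ℝ≥0∞)) hrm.aemeasurable
      (ae_of_all _ fun _ => ENNReal.coe_lt_top)).trans (congrArg _ hre)
  have hρf : Integrable (fun p : EuclideanSpace ℝ (Fin n) × 𝕌 => -ρ + (D.f p.1 p.2 : ℝ))
      (D.occ x Θ) := (integrable_const _).add hfi
  have hci : Integrable (D.cost ρ h) (D.occ x Θ) := hρf.add i1
  have hbi : Integrable (fun p => D.bham h p.1 p.2) (D.bocc x Θ) := hri.add i2
  obtain ⟨j1, j2⟩ := D.integral_occ (measurable_cost (ρ := ρ) hm) hci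
  refine ⟨j1, fun hT => ?_, ?_⟩
  · rw [bocc, integrable_smul_measure (surv_tstar_ne_zero hcont hΘ hT) (D.surv_ne_top x Θ _),
      integrable_map_measure (measurable_bham hm).aestronglyMeasurable
        measurable_prodMk_left.aemeasurable] at hbi
    exact hbi
  · have k1 : ∫ p, D.cost ρ h p ∂(D.occ x Θ) = -ρ * (D.L (fun _ _ => 1) x Θ).toReal +
        (D.L (fun y a => (D.f y a : ℝ≥0∞)) x Θ).toReal + ∫ p, D.lamQ h p ∂(D.occ x Θ) := by
      simp only [cost]
      rw [integral_add hρf i1, integral_add (integrable_const _) hfi,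
        integral_const, hu, hfe', smul_eq_mul, mul_comm]
    have k2 : ∫ p, D.bham h p.1 p.2 ∂(D.bocc x Θ) =
        (D.H (fun y a => (D.r y a : ℝ≥0∞)) x Θ).toReal +
          ∫ p, ∫ z, h z ∂(D.Q p) ∂(D.bocc x Θ) := by
      simp only [bham]
      rw [integral_add hri i2, hre']
    rw [objR, e]
    have k3 := D.integral_bocc x Θ (measurable_bham (D := D) hm)
    change _ = (∫ s in timesBefore (D.tstar x), (D.surv x Θ (ENNReal.ofReal s)).toReal *
      ∫ a, D.cost ρ h (D.path x s, a) ∂(Θ.μ s)) + _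
    rw [← k3, ← j2, k1, k2]
    ring

omit hrate in
/-- Averages of the running Hamiltonian over a feasible relaxed control. -/
theorem ae_integral_ham (hh : D.MemBg g h) (ρ : ℝ) {x : D.E} {Θ : RelaxedControl 𝕌}
    (hΘ : Θ ∈ D.relaxedControls x) {t : ℝ} (ht : t ∈ timesBefore (D.tstar x)) (v : ℝ → ℝ) :
    ∀ᵐ s ∂(volume.restrict (Set.Ico 0 t)),
      Integrable (D.ham h (v s) (D.path x s)) (Θ.μ s) ∧
      ∫ a, D.ham h (v s) (D.path x s) a ∂(Θ.μ s) =
        D.runCost ρ h x Θ s + ρ - D.rate x Θ s * v s := by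
  obtain ⟨hm, C, hC0, hC⟩ := (memBg_iff hgrowth.one_le_g).1 hh
  obtain ⟨Xg, hX, hd⟩ := hgrowth.exists_driftInequality
  filter_upwards [ae_restrict_of_ae_restrict_of_subset (Ico_subset_timesBefore ht) (ae_mem_A hΘ),
    ae_avg_lam_lt_top hcont hΘ ht, ae_restrict_mem measurableSet_Ico] with s hs hfin hst
  have hy := D.path_mem x (Ico_subset_timesBefore ht hst)
  have hpm : Measurable fun a : 𝕌 => (D.path x s, a) := measurable_prodMk_left
  have hlm : Measurable fun a => (D.lam (D.path x s) a : ℝ≥0∞) :=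
    (measurable_coe_nnreal_ennreal.comp D.measurable_lam_prod).comp hpm
  have hli : Integrable (fun a => (D.lam (D.path x s) a : ℝ)) (Θ.μ s) :=
    integrable_toReal_of_lintegral_ne_top (f := fun a => (D.lam (D.path x s) a : ℝ≥0∞))
      hlm.aemeasurable hfin.ne
  have hle : ∫ a, (D.lam (D.path x s) a : ℝ) ∂(Θ.μ s) = D.rate x Θ s :=
    integral_toReal (f := fun a => (D.lam (D.path x s) a : ℝ≥0∞)) hlm.aemeasurable
      (ae_of_all _ fun _ => ENNReal.coe_lt_top)
  have hfi : Integrable (fun a => (D.f (D.path x s) a : ℝ)) (Θ.μ s) := by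
    refine Integrable.mono' (integrable_const (M * g (D.path x s)))
      ((measurable_coe_nnreal_real.comp D.measurable_f_prod).comp hpm).aestronglyMeasurable
      (hs.mono fun a ha => ?_)
    rw [Real.norm_of_nonneg (NNReal.coe_nonneg _)]
    exact hgrowth.f_le _ hy a ha
  have hQi : Integrable (fun a => D.lamQ h (D.path x s, a)) (Θ.μ s) := by
    refine Integrable.mono' (((integrable_const (b - Xg (D.path x s) - c * g (D.path x s))).add
      (hli.mul_const (g (D.path x s)))).const_mul C)
      ((D.measurable_lamQ hm).comp hpm).aestronglyMeasurable (hs.mono fun a ha => ?_)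
    exact abs_lamQ_le hgrowth.g_mac.measurable hd hC0 hC hy ha
  have hsum : Integrable (fun a => (D.f (D.path x s) a : ℝ) + D.lamQ h (D.path x s, a)) (Θ.μ s) :=
    hfi.add hQi
  refine ⟨hsum.sub (hli.mul_const _), ?_⟩
  have e1 : D.runCost ρ h x Θ s = -ρ + ∫ a, ((D.f (D.path x s) a : ℝ) +
      D.lamQ h (D.path x s, a)) ∂(Θ.μ s) := by
    simp only [runCost, cost, add_assoc]
    rw [integral_add (integrable_const _) hsum]
    simp
  simp only [ham]
  rw [integral_sub hsum (hli.mul_const _), integral_mul_const, hle, e1]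
  ring

end PDMP

/-! ### Solutions of the dynamic programming equation along the flow -/

namespace PDMP

variable {n : ℕ} {𝕌 : Type*} [MetricSpace 𝕌] [MeasurableSpace 𝕌] {D : PDMP n 𝕌}

variable {b c δ M : ℝ} {g Xg : EuclideanSpace ℝ (Fin n) → ℝ}
  {rbar : EuclideanSpace ℝ (Fin n) → ℝ≥0} {lamLow : EuclideanSpace ℝ (Fin n) → ℝ≥0} {Klam : ℝ≥0}
  {ρ : ℝ} {h : D.E → ℝ} {u : D.Policy} {W : EuclideanSpace ℝ (Fin n) → ℝ}

/-- The integrand of the equation that the value `W` of the policy `u` solves along flow lines. -/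
def flowHam (D : PDMP n 𝕌) (ρ : ℝ) (h : D.E → ℝ) (u : D.Policy)
    (W : EuclideanSpace ℝ (Fin n) → ℝ) (y : EuclideanSpace ℝ (Fin n)) : ℝ :=
  D.ham h (W y) y (u.toFun y) - ρ

/-- `W` solves, along every flow line, the integrated equation `W' = -(f + λ Qh - λ W - ρ)` under
the policy `u`, with boundary value `r + Qh`, and is of order `g`. -/
structure IsFlowSolution (D : PDMP n 𝕌) (g : EuclideanSpace ℝ (Fin n) → ℝ) (ρ : ℝ) (h : D.E → ℝ)
    (u : D.Policy) (W : EuclideanSpace ℝ (Fin n) → ℝ) : Prop where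
  bound : ∃ C, ∀ y ∈ D.E, |W y| ≤ C * g y
  integrable : ∀ x : D.E, ∀ t ∈ timesBefore (D.tstar x),
    IntervalIntegrable (fun s => D.flowHam ρ h u W (D.path x s)) volume 0 t
  eq : ∀ x : D.E, ∀ t ∈ timesBefore (D.tstar x),
    W (D.path x t) = W x - ∫ s in (0 : ℝ)..t, D.flowHam ρ h u W (D.path x s)
  terminal : ∀ x : D.E, D.tstar x ≠ ⊤ → Tendsto (fun t => W (D.path x t))
    (𝓝[<] (D.tstar x).toReal) (𝓝 (D.bham h (D.exit x) (u.toFun (D.exit x))))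

variable [BorelSpace 𝕌] (hcont : D.ContinuityAssumptions)
  (hgrowth : D.GrowthCondition b c δ M g rbar)
  (hrate : D.JumpRateBounds c g lamLow Klam)

include hcont

theorem surv_toReal {x : D.E} {Θ : RelaxedControl 𝕌} (hΘ : Θ ∈ D.relaxedControls x) {t : ℝ}
    (ht : t ∈ timesBefore (D.tstar x)) : (D.surv x Θ (ENNReal.ofReal t)).toReal =
      Real.exp (-∫ s in (0 : ℝ)..t, D.rate x Θ s) := by
  rw [(rate_spec D ht.1 (Lam_lt_top hcont hΘ ht)).2, ENNReal.toReal_ofReal (Real.exp_pos _).le]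

include hgrowth hrate

omit hcont in
/-- The discounted value along a flow line, in the limit at the exit time. -/
theorem IsFlowSolution.tendsto_surv_mul (hW : D.IsFlowSolution g ρ h u W) {x : D.E}
    {Θ : RelaxedControl 𝕌} (hΘ : Θ ∈ D.relaxedControls x) :
    Tendsto (fun t => (D.surv x Θ (ENNReal.ofReal t)).toReal * W (D.path x t))
      (exitFilter (D.tstar x))
      (𝓝 ((D.surv x Θ (D.tstar x)).toReal * D.bham h (D.exit x) (u.toFun (D.exit x)))) := by
  by_cases hT : D.tstar x = ⊤
  · rw [surv_tstar_eq_zero hgrowth.c_pos.le hrate hΘ hT, ENNReal.toReal_zero, zero_mul]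
    obtain ⟨C, hC⟩ := hW.bound
    have h1 := (ENNReal.tendsto_toReal ENNReal.zero_ne_top).comp (tendsto_surv_mul_g hrate hΘ hT)
    have h2 := h1.const_mul C
    rw [ENNReal.toReal_zero, mul_zero] at h2
    refine squeeze_zero_norm' ?_ h2
    filter_upwards [eventually_mem_exitFilter (D.tstar_pos x)] with t ht
    have hy := D.path_mem x ht
    rw [Function.comp_apply, ENNReal.toReal_mul,
      ENNReal.toReal_ofReal (zero_le_one.trans (hgrowth.one_le_g _ hy)), norm_mul,
      Real.norm_of_nonneg ENNReal.toReal_nonneg]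
    calc _ ≤ (D.surv x Θ (ENNReal.ofReal t)).toReal * (C * g (D.path x t)) :=
          mul_le_mul_of_nonneg_left (hC _ hy) ENNReal.toReal_nonneg
      _ = _ := by ring
  · refine ((ENNReal.tendsto_toReal (D.surv_ne_top x Θ _)).comp (D.tendsto_surv x Θ)).mul ?_
    rw [exitFilter_of_ne_top hT]
    exact hW.terminal x hT

/-- The one-stage cost of a control exceeds a flow solution by the accumulated excess of its
Hamiltonian. -/
theorem IsFlowSolution.tendsto_gap (hh : D.MemBg g h) (hW : D.IsFlowSolution g ρ h u W) {x : D.E}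
    {Θ : RelaxedControl 𝕌} (hΘ : Θ ∈ D.relaxedControls x) :
    Tendsto (fun t => ∫ s in (0 : ℝ)..t, Real.exp (-∫ r in (0 : ℝ)..s, D.rate x Θ r) *
        (D.runCost ρ h x Θ s - D.rate x Θ s * W (D.path x s) - D.flowHam ρ h u W (D.path x s)))
      (exitFilter (D.tstar x))
      (𝓝 (D.objR ρ h x Θ - W x - (D.surv x Θ (D.tstar x)).toReal *
        (∫ a, D.bham h (D.exit x) a ∂Θ.bdry - D.bham h (D.exit x) (u.toFun (D.exit x))))) := by
  obtain ⟨h1, -, h3⟩ := objR_eq_integral hcont hgrowth hrate hh ρ hΘ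
  have hlim := ((tendsto_integral_exitFilter (D.tstar_pos x) h1).add
    (hW.tendsto_surv_mul hgrowth hrate hΘ)).sub_const (W x)
  have heq : (∫ s in timesBefore (D.tstar x),
        (D.surv x Θ (ENNReal.ofReal s)).toReal * D.runCost ρ h x Θ s) +
      (D.surv x Θ (D.tstar x)).toReal * D.bham h (D.exit x) (u.toFun (D.exit x)) - W x =
      D.objR ρ h x Θ - W x - (D.surv x Θ (D.tstar x)).toReal *
        (∫ a, D.bham h (D.exit x) a ∂Θ.bdry - D.bham h (D.exit x) (u.toFun (D.exit x))) := by
    rw [h3]; ring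
  rw [heq] at hlim
  refine hlim.congr' ?_
  filter_upwards [eventually_mem_exitFilter (D.tstar_pos x)] with t ht
  have hrt := (rate_spec D ht.1 (Lam_lt_top hcont hΘ ht)).1
  obtain ⟨hint, he⟩ := exp_neg_integral_mul_eq (V := fun s => W (D.path x s)) (v₀ := W x) ht.1 hrt
    (hW.integrable x t ht).neg (fun s hs => by
      rw [hW.eq x s (Icc_subset_timesBefore ht hs)]
      simp only [Pi.neg_apply, intervalIntegral.integral_neg]
      ring)
  have hS : ∀ s ∈ Set.uIcc 0 t, (D.surv x Θ (ENNReal.ofReal s)).toReal * D.runCost ρ h x Θ s =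
      Real.exp (-∫ r in (0 : ℝ)..s, D.rate x Θ r) * D.runCost ρ h x Θ s := fun s hs => by
    rw [Set.uIcc_of_le ht.1] at hs
    rw [surv_toReal hcont hΘ (Icc_subset_timesBefore ht hs)]
  have hci : IntervalIntegrable (fun s => Real.exp (-∫ r in (0 : ℝ)..s, D.rate x Θ r) *
      D.runCost ρ h x Θ s) volume 0 t := by
    refine (intervalIntegrable_iff_integrableOn_Ico_of_le ht.1).2
      ((h1.mono_set (Ico_subset_timesBefore ht)).congr_fun (fun s hs => hS s ?_) measurableSet_Ico)
    rw [Set.uIcc_of_le ht.1]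
    exact Set.Ico_subset_Icc_self hs
  rw [surv_toReal hcont hΘ ht, intervalIntegral.integral_congr hS]
  change _ + Real.exp (-∫ r in (0 : ℝ)..t, D.rate x Θ r) * (fun s => W (D.path x s)) t - W x = _
  have hadd := intervalIntegral.integral_add hci hint
  rw [he, add_sub_assoc, add_sub_cancel_left, ← hadd]
  refine intervalIntegral.integral_congr fun s _ => ?_
  simp only [Pi.neg_apply]
  ring

/-- A flow solution whose policy minimizes the Hamiltonians is a lower bound of the one-stage cost
over all relaxed controls. -/
theorem IsFlowSolution.le_objR (hh : D.MemBg g h) (hW : D.IsFlowSolution g ρ h u W)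
    (hmin : ∀ y ∈ D.E, ∀ a ∈ D.A y, D.ham h (W y) y (u.toFun y) ≤ D.ham h (W y) y a)
    (hbdry : ∀ x : D.E, D.tstar x ≠ ⊤ → ∀ a ∈ D.A (D.exit x),
      D.bham h (D.exit x) (u.toFun (D.exit x)) ≤ D.bham h (D.exit x) a)
    {x : D.E} {Θ : RelaxedControl 𝕌} (hΘ : Θ ∈ D.relaxedControls x) : W x ≤ D.objR ρ h x Θ := by
  have hB : 0 ≤ (D.surv x Θ (D.tstar x)).toReal *
      (∫ a, D.bham h (D.exit x) a ∂Θ.bdry - D.bham h (D.exit x) (u.toFun (D.exit x))) := by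
    by_cases hT : D.tstar x = ⊤
    · simp [surv_tstar_eq_zero hgrowth.c_pos.le hrate hΘ hT]
    · refine mul_nonneg ENNReal.toReal_nonneg (sub_nonneg.2 ?_)
      have hi := (objR_eq_integral hcont hgrowth hrate hh ρ hΘ).2.1 hT
      calc D.bham h (D.exit x) (u.toFun (D.exit x))
          = ∫ _, D.bham h (D.exit x) (u.toFun (D.exit x)) ∂Θ.bdry := by simp
        _ ≤ _ := integral_mono_ae (integrable_const _) hi
            ((ae_bdry_mem_A hΘ).mono fun a ha => hbdry x hT a ha)
  have h0 := ge_of_tendsto (hW.tendsto_gap hcont hgrowth hrate hh hΘ) (b := 0) (by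
    filter_upwards [eventually_mem_exitFilter (D.tstar_pos x)] with t ht
    rw [intervalIntegral.integral_of_le ht.1, integral_Ioc_eq_integral_Ioo,
      ← integral_Ico_eq_integral_Ioo]
    refine integral_nonneg_of_ae ?_
    filter_upwards [ae_integral_ham hcont hgrowth hh ρ hΘ ht (fun s => W (D.path x s)),
      ae_restrict_of_ae_restrict_of_subset (Ico_subset_timesBefore ht) (ae_mem_A hΘ),
      ae_restrict_mem measurableSet_Ico] with s hs hsA hst
    have hy := D.path_mem x (Ico_subset_timesBefore ht hst)
    have hle : D.ham h (W (D.path x s)) (D.path x s) (u.toFun (D.path x s)) ≤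
        ∫ a, D.ham h (W (D.path x s)) (D.path x s) a ∂(Θ.μ s) := by
      calc _ = ∫ _, D.ham h (W (D.path x s)) (D.path x s) (u.toFun (D.path x s)) ∂(Θ.μ s) := by simp
        _ ≤ _ := integral_mono_ae (integrable_const _) hs.1 (hsA.mono fun a ha => hmin _ hy a ha)
    rw [hs.2] at hle
    refine mul_nonneg (Real.exp_pos _).le ?_
    rw [flowHam]
    linarith)
  linarith

/-- A policy with smaller Hamiltonians than those of a flow solution has a smaller one-stage cost:
the policy improvement step. -/
theorem IsFlowSolution.objR_feedback_le (hh : D.MemBg g h) (hW : D.IsFlowSolution g ρ h u W)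
    {u' : D.Policy}
    (hle : ∀ y ∈ D.E, D.ham h (W y) y (u'.toFun y) ≤ D.ham h (W y) y (u.toFun y))
    (hbdry : ∀ x : D.E, D.tstar x ≠ ⊤ →
      D.bham h (D.exit x) (u'.toFun (D.exit x)) ≤ D.bham h (D.exit x) (u.toFun (D.exit x)))
    (x : D.E) : D.objR ρ h x (u'.feedback x) ≤ W x := by
  have hΘ := u'.feedback_mem x
  have hB : (D.surv x (u'.feedback x) (D.tstar x)).toReal *
      (∫ a, D.bham h (D.exit x) a ∂(u'.feedback x).bdry -
        D.bham h (D.exit x) (u.toFun (D.exit x))) ≤ 0 := by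
    by_cases hT : D.tstar x = ⊤
    · simp [surv_tstar_eq_zero hgrowth.c_pos.le hrate hΘ hT]
    · rw [integral_bham_feedback hh.1]
      exact mul_nonpos_of_nonneg_of_nonpos ENNReal.toReal_nonneg (sub_nonpos.2 (hbdry x hT))
  have h0 := le_of_tendsto (hW.tendsto_gap hcont hgrowth hrate hh hΘ) (b := 0) (by
    filter_upwards [eventually_mem_exitFilter (D.tstar_pos x)] with t ht
    rw [intervalIntegral.integral_of_le ht.1]
    refine setIntegral_nonpos measurableSet_Ioc fun s hs => ?_
    have hy := D.path_mem x (Icc_subset_timesBefore ht (Set.Ioc_subset_Icc_self hs))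
    refine mul_nonpos_of_nonneg_of_nonpos (Real.exp_pos _).le ?_
    rw [runCost_feedback hh.1, rate_feedback, flowHam]
    have := hle _ hy
    simp only [ham, cost] at this ⊢
    linarith)
  linarith

/-! ### The value of a policy along the flow -/

omit hcont hgrowth hrate

/-- The one-stage cost of a policy as a function on the ambient space, extended by zero. -/
def value (D : PDMP n 𝕌) (ρ : ℝ) (h : D.E → ℝ) (u : D.Policy) : EuclideanSpace ℝ (Fin n) → ℝ :=
  Function.extend Subtype.val (fun x : D.E => D.objR ρ h x (u.feedback x)) 0

omit [BorelSpace 𝕌] in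
theorem value_coe (x : D.E) : D.value ρ h u x = D.objR ρ h x (u.feedback x) :=
  Subtype.val_injective.extend_apply _ _ x

omit [BorelSpace 𝕌] in
theorem measurable_value (hh : Measurable h) : Measurable (D.value ρ h u) :=
  (MeasurableEmbedding.subtype_coe D.isOpen_E.measurableSet).measurable_extend
    (measurable_objR u ρ hh) measurable_zero

omit [BorelSpace 𝕌] in
theorem rate_pathE (x : D.E) {t : ℝ} (ht : t ∈ timesBefore (D.tstar x)) {s : ℝ} (hs : 0 ≤ s) :
    D.rate (D.pathE x ht) (u.feedback (D.pathE x ht)) s = D.rate x (u.feedback x) (t + s) := by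
  rw [rate_feedback, rate_feedback, ← D.path_add _ ht.1 hs]
  rfl

omit [BorelSpace 𝕌] in
/-- The survival factor of a feedback control is multiplicative along the flow. -/
theorem surv_add (x : D.E) {t : ℝ} (ht : t ∈ timesBefore (D.tstar x)) {s : ℝ} (hs : 0 ≤ s)
    (h1 : D.Lam x (u.feedback x) (ENNReal.ofReal t) < ⊤)
    (h2 : D.Lam x (u.feedback x) (ENNReal.ofReal (t + s)) < ⊤)
    (h3 : D.Lam (D.pathE x ht) (u.feedback (D.pathE x ht)) (ENNReal.ofReal s) < ⊤) :
    (D.surv x (u.feedback x) (ENNReal.ofReal (t + s))).toReal =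
      (D.surv x (u.feedback x) (ENNReal.ofReal t)).toReal *
        (D.surv (D.pathE x ht) (u.feedback (D.pathE x ht)) (ENNReal.ofReal s)).toReal := by
  obtain ⟨i1, e1⟩ := rate_spec D ht.1 h1
  obtain ⟨i2, e2⟩ := rate_spec D (add_nonneg ht.1 hs) h2
  obtain ⟨i3, e3⟩ := rate_spec D hs h3
  rw [e1, e2, e3]
  simp only [ENNReal.toReal_ofReal (Real.exp_pos _).le]
  rw [← Real.exp_add, ← intervalIntegral.integral_add_adjacent_intervals i1 (i1.symm.trans i2),
    neg_add]
  congr 3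
  have hsub := intervalIntegral.integral_comp_add_left (a := 0) (b := s)
    (fun r => D.rate x (u.feedback x) r) t
  rw [add_zero] at hsub
  rw [← hsub]
  refine intervalIntegral.integral_congr fun r hr => ?_
  rw [Set.uIcc_of_le hs] at hr
  exact (rate_pathE x ht hr.1).symm

include hcont hgrowth hrate

/-- The value of a policy splits at any time before the exit time. -/
theorem value_eq_add (hh : D.MemBg g h) (x : D.E) {t : ℝ} (ht : t ∈ timesBefore (D.tstar x)) :
    D.value ρ h u x = (∫ s in (0 : ℝ)..t, (D.surv x (u.feedback x) (ENNReal.ofReal s)).toReal *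
        D.runCost ρ h x (u.feedback x) s) +
      (D.surv x (u.feedback x) (ENNReal.ofReal t)).toReal * D.value ρ h u (D.path x t) := by
  have hΘ := u.feedback_mem x
  set x' := D.pathE x ht with hx'
  have hΘ' := u.feedback_mem x'
  have hp : D.value ρ h u (D.path x t) = D.objR ρ h x' (u.feedback x') := value_coe x'
  obtain ⟨i1, -, e1⟩ := objR_eq_integral hcont hgrowth hrate hh ρ hΘ
  obtain ⟨i2, -, e2⟩ := objR_eq_integral hcont hgrowth hrate hh ρ hΘ'
  have hbd : (D.surv x (u.feedback x) (D.tstar x)).toReal =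
      (D.surv x (u.feedback x) (ENNReal.ofReal t)).toReal *
        (D.surv x' (u.feedback x') (D.tstar x')).toReal := by
    by_cases hT : D.tstar x = ⊤
    · have hT' := (D.tstar_pathE_eq_top_iff x ht).2 hT
      rw [surv_tstar_eq_zero hgrowth.c_pos.le hrate hΘ hT,
        surv_tstar_eq_zero hgrowth.c_pos.le hrate hΘ' hT']
      simp
    · have hT' := mt (D.tstar_pathE_eq_top_iff x ht).1 hT
      have hts : t + (D.tstar x').toReal = (D.tstar x).toReal := by
        rw [hx', D.tstar_pathE, ENNReal.toReal_sub_of_le ht.2.le hT, ENNReal.toReal_ofReal ht.1]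
        ring
      have hL := Lam_tstar_lt_top hcont hΘ hT
      have hL' := Lam_tstar_lt_top hcont hΘ' hT'
      rw [← ENNReal.ofReal_toReal hT, ← hts] at hL
      rw [← ENNReal.ofReal_toReal hT'] at hL'
      have := surv_add x ht ENNReal.toReal_nonneg (Lam_lt_top hcont hΘ ht) hL hL'
      rwa [hts, ENNReal.ofReal_toReal hT, ENNReal.ofReal_toReal hT'] at this
  have hsplit := setIntegral_sdiff measurableSet_Ico i1 (Ico_subset_timesBefore ht)
  have hshift : ∫ s in timesBefore (D.tstar x) \ Set.Ico 0 t,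
      (D.surv x (u.feedback x) (ENNReal.ofReal s)).toReal * D.runCost ρ h x (u.feedback x) s =
      (D.surv x (u.feedback x) (ENNReal.ofReal t)).toReal * ∫ s in timesBefore (D.tstar x'),
        (D.surv x' (u.feedback x') (ENNReal.ofReal s)).toReal *
          D.runCost ρ h x' (u.feedback x') s := by
    rw [← integral_indicator ((measurableSet_timesBefore _).diff measurableSet_Ico),
      ← integral_add_left_eq_self _ t, ← integral_const_mul,
      ← integral_indicator (measurableSet_timesBefore _)]
    refine integral_congr_ae (ae_of_all _ fun s => ?_)
    by_cases hs : s ∈ timesBefore (D.tstar x')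
    · have hts := (D.mem_timesBefore_tstar_pathE x ht hs.1).1 hs
      have hmem : t + s ∈ timesBefore (D.tstar x) \ Set.Ico 0 t :=
        ⟨hts, fun h => absurd h.2 (by linarith [hs.1])⟩
      simp only [Set.indicator_of_mem hs, Set.indicator_of_mem hmem]
      rw [surv_add x ht hs.1 (Lam_lt_top hcont hΘ ht) (Lam_lt_top hcont hΘ hts)
        (Lam_lt_top hcont hΘ' hs), runCost_feedback hh.1, runCost_feedback hh.1,
        ← D.path_add _ ht.1 hs.1, mul_assoc]
      rfl
    · have hmem : t + s ∉ timesBefore (D.tstar x) \ Set.Ico 0 t := by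
        rintro ⟨h1, h2⟩
        have hs0 : 0 ≤ s := by
          by_contra! hlt
          exact h2 ⟨h1.1, by linarith⟩
        exact hs ((D.mem_timesBefore_tstar_pathE x ht hs0).2 h1)
      simp only [Set.indicator_of_notMem hs, Set.indicator_of_notMem hmem]
  have hI : ∫ s in Set.Ico 0 t, (D.surv x (u.feedback x) (ENNReal.ofReal s)).toReal *
      D.runCost ρ h x (u.feedback x) s = ∫ s in (0 : ℝ)..t,
        (D.surv x (u.feedback x) (ENNReal.ofReal s)).toReal *
          D.runCost ρ h x (u.feedback x) s := by
    rw [intervalIntegral.integral_of_le ht.1, integral_Ioc_eq_integral_Ioo,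
      integral_Ico_eq_integral_Ioo]
  rw [value_coe, hp, e1, e2, hbd, integral_bham_feedback hh.1, integral_bham_feedback hh.1,
    hx', D.exit_pathE, ← hx', ← hI]
  rw [hshift] at hsplit
  linear_combination -hsplit

/-- Undoing the discounting in `value_eq_add` gives the equation along the flow. -/
theorem isFlowSolution_value (hh : D.MemBg g h) :
    D.IsFlowSolution g ρ h u (D.value ρ h u) := by
  have key : ∀ x : D.E, ∀ t ∈ timesBefore (D.tstar x),
      IntervalIntegrable (fun s => D.flowHam ρ h u (D.value ρ h u) (D.path x s)) volume 0 t ∧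
      D.value ρ h u (D.path x t) = D.value ρ h u x -
        ∫ s in (0 : ℝ)..t, D.flowHam ρ h u (D.value ρ h u) (D.path x s) := by
    intro x t ht
    have hΘ := u.feedback_mem x
    have hrt := (rate_spec D ht.1 (Lam_lt_top hcont hΘ ht)).1
    have hci := (objR_eq_integral hcont hgrowth hrate hh ρ hΘ).1
    have hci' := (intervalIntegrable_iff_integrableOn_Ico_of_le ht.1).2
      (hci.mono_set (Ico_subset_timesBefore ht))
    obtain ⟨i, e⟩ := exp_neg_integral_mul_eq (v₀ := D.value ρ h u x) ht.1 hrt.neg hci'.neg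
      (V := fun s => (D.surv x (u.feedback x) (ENNReal.ofReal s)).toReal *
        D.value ρ h u (D.path x s)) (fun s hs => by
        rw [value_eq_add hcont hgrowth hrate hh x (Icc_subset_timesBefore ht hs)]
        simp only [Pi.neg_apply, intervalIntegral.integral_neg]
        ring)
    have hSS : ∀ s ∈ Set.Icc 0 t, Real.exp (-∫ r in (0 : ℝ)..s, (-D.rate x (u.feedback x)) r) *
        (D.surv x (u.feedback x) (ENNReal.ofReal s)).toReal = 1 := fun s hs => by
      rw [surv_toReal hcont hΘ (Icc_subset_timesBefore ht hs)]
      simp only [Pi.neg_apply, intervalIntegral.integral_neg, neg_neg]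
      rw [← Real.exp_add, add_neg_cancel, Real.exp_zero]
    have hfun : ∀ s ∈ Set.uIcc 0 t, Real.exp (-∫ r in (0 : ℝ)..s, (-D.rate x (u.feedback x)) r) *
        ((-fun s => (D.surv x (u.feedback x) (ENNReal.ofReal s)).toReal *
          D.runCost ρ h x (u.feedback x) s) s - (-D.rate x (u.feedback x)) s *
          ((D.surv x (u.feedback x) (ENNReal.ofReal s)).toReal * D.value ρ h u (D.path x s))) =
        -D.flowHam ρ h u (D.value ρ h u) (D.path x s) := fun s hs => by
      rw [Set.uIcc_of_le ht.1] at hs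
      have h1 := hSS s hs
      simp only [Pi.neg_apply]
      rw [runCost_feedback hh.1, rate_feedback, flowHam]
      simp only [cost, ham]
      simp only [Pi.neg_apply] at h1
      linear_combination (ρ - D.f (D.path x s) (u.toFun (D.path x s)) -
        D.lamQ h (D.path x s, u.toFun (D.path x s)) + D.lam (D.path x s) (u.toFun (D.path x s)) *
          D.value ρ h u (D.path x s)) * h1
    have h1 := hSS t ⟨ht.1, le_rfl⟩
    rw [← mul_assoc, h1, one_mul, intervalIntegral.integral_congr hfun,
      intervalIntegral.integral_neg] at e
    refine ⟨?_, e⟩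
    have i' := i.neg
    rw [intervalIntegrable_iff_integrableOn_Ico_of_le ht.1] at i' ⊢
    refine i'.congr_fun (fun s hs => ?_) measurableSet_Ico
    have := hfun s (by rw [Set.uIcc_of_le ht.1]; exact Set.Ico_subset_Icc_self hs)
    rw [Pi.neg_apply, this, neg_neg]
  refine ⟨?_, fun x t ht => (key x t ht).1, fun x t ht => (key x t ht).2, fun x hT => ?_⟩
  · obtain ⟨C, -, hC⟩ := exists_abs_objR_le hcont hgrowth hrate hh ρ
    refine ⟨C, fun y hy => ?_⟩
    rw [show D.value ρ h u y = D.objR ρ h ⟨y, hy⟩ (u.feedback ⟨y, hy⟩) from value_coe ⟨y, hy⟩]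
    exact hC ⟨y, hy⟩ _ (u.feedback_mem _)
  · have hΘ := u.feedback_mem x
    obtain ⟨i, -, e⟩ := objR_eq_integral hcont hgrowth hrate hh ρ hΘ
    have hS0 : (D.surv x (u.feedback x) (D.tstar x)).toReal ≠ 0 :=
      ENNReal.toReal_ne_zero.2 ⟨surv_tstar_ne_zero hcont hΘ hT, D.surv_ne_top x _ _⟩
    have hS := (ENNReal.tendsto_toReal (D.surv_ne_top x (u.feedback x) _)).comp
      (D.tendsto_surv x (u.feedback x))
    have hlim := ((tendsto_integral_exitFilter (D.tstar_pos x) i).const_sub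
      (D.value ρ h u x)).div hS hS0
    rw [value_coe, e, add_sub_cancel_left, mul_div_cancel_left₀ _ hS0,
      integral_bham_feedback hh.1] at hlim
    rw [← exitFilter_of_ne_top hT]
    refine hlim.congr' ?_
    filter_upwards [eventually_mem_exitFilter (D.tstar_pos x)] with t ht
    have h1 := value_eq_add (ρ := ρ) (u := u) hcont hgrowth hrate hh x ht
    rw [value_coe, e, integral_bham_feedback hh.1] at h1
    have h2 : (D.surv x (u.feedback x) (ENNReal.ofReal t)).toReal ≠ 0 := by
      rw [surv_toReal hcont hΘ ht]
      exact (Real.exp_pos _).ne'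
    simp only [Pi.div_apply, Function.comp_apply]
    rw [div_eq_iff h2]
    linear_combination h1

end PDMP

/-! ### Domination of the Hamiltonians along the flow -/

namespace PDMP

variable {n : ℕ} {𝕌 : Type*} [MetricSpace 𝕌] [MeasurableSpace 𝕌] {D : PDMP n 𝕌}

variable {b c δ M : ℝ} {g Xg : EuclideanSpace ℝ (Fin n) → ℝ}
  {rbar : EuclideanSpace ℝ (Fin n) → ℝ≥0} {lamLow : EuclideanSpace ℝ (Fin n) → ℝ≥0} {Klam : ℝ≥0}
  {ρ : ℝ} {h : D.E → ℝ} {u : D.Policy} {W : EuclideanSpace ℝ (Fin n) → ℝ}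

/-- The slack of the drift inequality, with the jump rate of the policy `v`. -/
def driftSlack (D : PDMP n 𝕌) (b c : ℝ) (g Xg : EuclideanSpace ℝ (Fin n) → ℝ) (v : D.Policy)
    (y : EuclideanSpace ℝ (Fin n)) : ℝ :=
  b - Xg y - c * g y + D.lam y (v.toFun y) * g y

/-- A bound of the Hamiltonians that is uniform over the policies, when `v` maximizes the jump
rate. -/
def hamBound (D : PDMP n 𝕌) (b c M : ℝ) (g Xg : EuclideanSpace ℝ (Fin n) → ℝ) (v : D.Policy)
    (ρ C C' : ℝ) (y : EuclideanSpace ℝ (Fin n)) : ℝ :=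
  |ρ| + M * g y + C * D.driftSlack b c g Xg v y + C' * (D.lam y (v.toFun y) * g y)

theorem abs_flowHam_le (hgrowth : D.GrowthCondition b c δ M g rbar)
    (hd : D.DriftInequality b c g Xg) {v : D.Policy}
    (hv : ∀ y ∈ D.E, ∀ a ∈ D.A y, D.lam y a ≤ D.lam y (v.toFun y)) {C C' : ℝ} (hC0 : 0 ≤ C)
    (hC : ∀ x : D.E, |h x| ≤ C * g x) (hW : ∀ y ∈ D.E, |W y| ≤ C' * g y)
    {y : EuclideanSpace ℝ (Fin n)} (hy : y ∈ D.E) :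
    |D.flowHam ρ h u W y| ≤ D.hamBound b c M g Xg v ρ C C' y := by
  have ha := u.mem_A y (subset_closure hy)
  have hl : (D.lam y (u.toFun y) : ℝ) ≤ D.lam y (v.toFun y) := hv y hy _ ha
  have hl0 : (0 : ℝ) ≤ D.lam y (u.toFun y) := NNReal.coe_nonneg _
  have hg0 : 0 ≤ g y := zero_le_one.trans (hgrowth.one_le_g y hy)
  have h1 := abs_lamQ_le (h := h) hgrowth.g_mac.measurable hd hC0 hC hy ha
  have h2 : |(D.f y (u.toFun y) : ℝ)| ≤ M * g y := by
    rw [abs_of_nonneg (NNReal.coe_nonneg _)]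
    exact hgrowth.f_le y hy _ ha
  have h3 : |(D.lam y (u.toFun y) : ℝ) * W y| ≤ C' * (D.lam y (v.toFun y) * g y) := by
    rw [abs_mul, abs_of_nonneg hl0]
    calc _ ≤ (D.lam y (v.toFun y) : ℝ) * (C' * g y) :=
          mul_le_mul hl (hW y hy) (abs_nonneg _) (hl0.trans hl)
      _ = _ := by ring
  have h4 : C * (b - Xg y - c * g y + D.lam y (u.toFun y) * g y) ≤
      C * D.driftSlack b c g Xg v y := by
    refine mul_le_mul_of_nonneg_left ?_ hC0
    rw [driftSlack]
    gcongr
  rw [flowHam, ham, hamBound]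
  refine (abs_sub _ _).trans ?_
  have h5 := abs_sub ((D.f y (u.toFun y) : ℝ) + D.lamQ h (y, u.toFun y))
    (D.lam y (u.toFun y) * W y)
  have h6 := abs_add_le (D.f y (u.toFun y) : ℝ) (D.lamQ h (y, u.toFun y))
  linarith

theorem MemMac.continuousOn_path (hg : D.MemMac g) (x : D.E) {t : ℝ}
    (ht : t ∈ timesBefore (D.tstar x)) :
    ContinuousOn (fun s => g (D.path x s)) (Set.uIcc 0 t) :=
  (hg.absCont x t ht).continuousOn

/-- A function with a limit at the exit time is bounded along flow lines of finite length. -/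
theorem MemMac.exists_le (hg : D.MemMac g) (x : D.E) (hT : D.tstar x ≠ ⊤) :
    ∃ B, ∀ s ∈ timesBefore (D.tstar x), g (D.path x s) ≤ B := by
  obtain ⟨ℓ, hℓ⟩ := hg.limit x hT
  have hT0 : 0 < (D.tstar x).toReal := ENNReal.toReal_pos (D.tstar_pos x).ne' hT
  have hev := hℓ.eventually (gt_mem_nhds (show ℓ < ℓ + 1 by linarith))
  obtain ⟨l, hl, hsub⟩ := (mem_nhdsLT_iff_exists_Ioo_subset' hT0).1 hev
  have hmem : ∀ s, s ∈ timesBefore (D.tstar x) ↔ 0 ≤ s ∧ s < (D.tstar x).toReal := fun s =>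
    and_congr_right fun _ => ENNReal.ofReal_lt_iff_lt_toReal ‹_› hT
  have ht₀ : max l 0 ∈ timesBefore (D.tstar x) :=
    (hmem _).2 ⟨le_max_right _ _, max_lt hl hT0⟩
  obtain ⟨B, hB⟩ := isCompact_uIcc.bddAbove_image (hg.continuousOn_path x ht₀)
  refine ⟨max B (ℓ + 1), fun s hs => ?_⟩
  rcases le_or_gt s (max l 0) with hs' | hs'
  · refine le_max_of_le_left (hB ⟨s, ?_, rfl⟩)
    rw [Set.uIcc_of_le (le_max_right _ _)]
    exact ⟨hs.1, hs'⟩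
  · exact le_max_of_le_right (hsub ⟨(le_max_left _ _).trans_lt hs', ((hmem s).1 hs).2⟩).le

theorem measurable_feedback_path {β : Type*} [MeasurableSpace β]
    {v : EuclideanSpace ℝ (Fin n) × 𝕌 → β} (hv : Measurable v) (u : D.Policy) :
    Measurable fun y => v (y, u.toFun y) :=
  hv.comp (measurable_id.prodMk u.measurable_toFun)

theorem measurable_flowHam (hh : Measurable h) (hW : Measurable W) :
    Measurable (D.flowHam ρ h u W) :=
  (((measurable_coe_nnreal_real.comp (measurable_feedback_path D.measurable_f_prod u)).add
    (measurable_feedback_path (D.measurable_lamQ hh) u)).sub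
    ((measurable_coe_nnreal_real.comp (measurable_feedback_path D.measurable_lam_prod u)).mul
      hW)).sub_const ρ

variable [BorelSpace 𝕌] (hcont : D.ContinuityAssumptions)
  (hgrowth : D.GrowthCondition b c δ M g rbar) (hX : D.IsFlowDeriv g Xg)

include hcont hgrowth hX

omit hX in
theorem intervalIntegrable_lam_mul_g (v : D.Policy) (x : D.E) {t : ℝ}
    (ht : t ∈ timesBefore (D.tstar x)) :
    IntervalIntegrable (fun s => (D.lam (D.path x s) (v.toFun (D.path x s)) : ℝ) * g (D.path x s))
      volume 0 t := by
  have h1 := (rate_spec D ht.1 (Lam_lt_top hcont (v.feedback_mem x) ht)).1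
  rw [show D.rate x (v.feedback x) = _ from funext (rate_feedback v x)] at h1
  exact h1.mul_continuousOn (hgrowth.g_mac.continuousOn_path x ht)

theorem intervalIntegrable_driftSlack (v : D.Policy) (x : D.E) {t : ℝ}
    (ht : t ∈ timesBefore (D.tstar x)) :
    IntervalIntegrable (fun s => D.driftSlack b c g Xg v (D.path x s)) volume 0 t :=
  ((intervalIntegrable_const.sub (hX.integrable x t ht)).sub
    ((hgrowth.g_mac.continuousOn_path x ht).intervalIntegrable.const_mul c)).add
    (intervalIntegrable_lam_mul_g hcont hgrowth v x ht)

theorem intervalIntegrable_hamBound (v : D.Policy) (ρ C C' : ℝ) (x : D.E) {t : ℝ}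
    (ht : t ∈ timesBefore (D.tstar x)) :
    IntervalIntegrable (fun s => D.hamBound b c M g Xg v ρ C C' (D.path x s)) volume 0 t :=
  ((intervalIntegrable_const.add
    ((hgrowth.g_mac.continuousOn_path x ht).intervalIntegrable.const_mul M)).add
    ((intervalIntegrable_driftSlack hcont hgrowth hX v x ht).const_mul C)).add
    ((intervalIntegrable_lam_mul_g hcont hgrowth v x ht).const_mul C')

/-- If the exit time is finite, the Hamiltonians are dominated up to the exit time. The drift slack
is nonnegative, and its integral is bounded because `g ≥ 0` is bounded along the flow line. -/
theorem integrableOn_hamBound (hd : D.DriftInequality b c g Xg) (v : D.Policy) (ρ C C' : ℝ) (x : D.E)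
    (hT : D.tstar x ≠ ⊤) :
    IntegrableOn (fun s => D.hamBound b c M g Xg v ρ C C' (D.path x s))
      (timesBefore (D.tstar x)) := by
  have hm := measurableSet_timesBefore (D.tstar x)
  have hpm := D.measurable_path x
  have hgm := hgrowth.g_mac.measurable
  have hlm : Measurable fun s => (D.lam (D.path x s) (v.toFun (D.path x s)) : ℝ) :=
    (measurable_coe_nnreal_real.comp (measurable_feedback_path D.measurable_lam_prod v)).comp hpm
  obtain ⟨B, hB⟩ := hgrowth.g_mac.exists_le x hT
  have hg0 : ∀ s ∈ timesBefore (D.tstar x), 0 ≤ g (D.path x s) := fun s hs =>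
    zero_le_one.trans (hgrowth.one_le_g _ (D.path_mem x hs))
  have hgb : ∀ᵐ s ∂(volume.restrict (timesBefore (D.tstar x))), ‖g (D.path x s)‖ ≤ B :=
    (ae_restrict_mem hm).mono fun s hs => by
      rw [Real.norm_of_nonneg (hg0 s hs)]
      exact hB s hs
  have hico := timesBefore_of_ne_top hT
  have hfin : IsFiniteMeasure (volume.restrict (timesBefore (D.tstar x))) := by
    rw [hico]
    infer_instance
  have hgi : IntegrableOn (fun s => g (D.path x s)) (timesBefore (D.tstar x)) :=
    Integrable.of_bound (hgm.comp hpm).aestronglyMeasurable B hgb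
  have hli : IntegrableOn (fun s => (D.lam (D.path x s) (v.toFun (D.path x s)) : ℝ))
      (timesBefore (D.tstar x)) := by
    have hL := Lam_tstar_lt_top hcont (v.feedback_mem x) hT
    rw [← ENNReal.ofReal_toReal hT] at hL
    have h1 := (rate_spec D ENNReal.toReal_nonneg hL).1
    rw [show D.rate x (v.feedback x) = _ from funext (rate_feedback v x)] at h1
    rw [hico]
    exact (intervalIntegrable_iff_integrableOn_Ico_of_le ENNReal.toReal_nonneg).1 h1
  have hlg : IntegrableOn (fun s => (D.lam (D.path x s) (v.toFun (D.path x s)) : ℝ) *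
      g (D.path x s)) (timesBefore (D.tstar x)) :=
    hli.mul_bdd (hgm.comp hpm).aestronglyMeasurable hgb
  have hsm : Measurable fun s => D.driftSlack b c g Xg v (D.path x s) :=
    ((measurable_const.sub (hX.measurable.comp hpm)).sub ((hgm.comp hpm).const_mul c)).add
      (hlm.mul (hgm.comp hpm))
  have hs0 : ∀ s ∈ timesBefore (D.tstar x), 0 ≤ D.driftSlack b c g Xg v (D.path x s) :=
    fun s hs => (hd _ (D.path_mem x hs) _ (v.mem_A _ (subset_closure (D.path_mem x hs)))).1
  have hsi : IntegrableOn (fun s => D.driftSlack b c g Xg v (D.path x s))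
      (timesBefore (D.tstar x)) := by
    refine (lintegral_ofReal_ne_top_iff_integrable hsm.aestronglyMeasurable
      ((ae_restrict_mem hm).mono hs0)).1 (ne_top_of_le_ne_top (ENNReal.ofReal_ne_top
        (r := b * (D.tstar x).toReal + g x + ∫ s in timesBefore (D.tstar x),
          (D.lam (D.path x s) (v.toFun (D.path x s)) : ℝ) * g (D.path x s))) ?_)
    refine le_of_tendsto (tendsto_lintegral_exitFilter (D.tstar_pos x) hsm.ennreal_ofReal) ?_
    filter_upwards [eventually_mem_exitFilter (D.tstar_pos x)] with t ht
    have hsub := Ico_subset_timesBefore ht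
    have hsit := intervalIntegrable_driftSlack hcont hgrowth hX v x ht
    rw [← ofReal_integral_eq_lintegral_ofReal
      ((intervalIntegrable_iff_integrableOn_Ico_of_le ht.1).1 hsit)
      ((ae_restrict_mem measurableSet_Ico).mono fun s hs => hs0 s (hsub hs)),
      integral_Ico_eq_integral_Ioo, ← integral_Ioc_eq_integral_Ioo,
      ← intervalIntegral.integral_of_le ht.1]
    refine ENNReal.ofReal_le_ofReal ?_
    have hXi := hX.integrable x t ht
    have hgit := (hgrowth.g_mac.continuousOn_path x ht).intervalIntegrable (μ := volume)
    have hlgt := intervalIntegrable_lam_mul_g hcont hgrowth v x ht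
    simp only [driftSlack]
    rw [intervalIntegral.integral_add ((intervalIntegrable_const.sub hXi).sub (hgit.const_mul c))
      hlgt, intervalIntegral.integral_sub (intervalIntegrable_const.sub hXi) (hgit.const_mul c),
      intervalIntegral.integral_sub intervalIntegrable_const hXi, ← hX.integral_eq x t ht,
      intervalIntegral.integral_const_mul, intervalIntegral.integral_const, smul_eq_mul, sub_zero]
    have k1 : 0 ≤ ∫ s in (0 : ℝ)..t, g (D.path x s) :=
      intervalIntegral.integral_nonneg ht.1 fun s hs => hg0 s (Icc_subset_timesBefore ht hs)
    have k2 : ∫ s in (0 : ℝ)..t, (D.lam (D.path x s) (v.toFun (D.path x s)) : ℝ) *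
        g (D.path x s) ≤ ∫ s in timesBefore (D.tstar x),
          (D.lam (D.path x s) (v.toFun (D.path x s)) : ℝ) * g (D.path x s) := by
      rw [intervalIntegral.integral_of_le ht.1]
      refine setIntegral_mono_set hlg ((ae_restrict_mem hm).mono fun s hs =>
        mul_nonneg (NNReal.coe_nonneg _) (hg0 s hs)) (LE.le.eventuallyLE ?_)
      exact fun s hs => Icc_subset_timesBefore ht (Set.Ioc_subset_Icc_self hs)
    have k3 : t * b ≤ b * (D.tstar x).toReal := by
      rw [mul_comm]
      refine mul_le_mul_of_nonneg_left ?_ hgrowth.b_nonneg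
      exact ((ENNReal.ofReal_lt_iff_lt_toReal ht.1 hT).1 ht.2).le
    have k4 := hg0 t ht
    have k5 := mul_nonneg hgrowth.c_pos.le k1
    linarith
  exact (((integrable_const _).add (hgi.const_mul M)).add (hsi.const_mul C)).add (hlg.const_mul C')

end PDMP

/-! ### Policy iteration -/

namespace PDMP

variable {n : ℕ} {𝕌 : Type*} [MetricSpace 𝕌] [MeasurableSpace 𝕌] {D : PDMP n 𝕌}

variable {b c δ M : ℝ} {g Xg : EuclideanSpace ℝ (Fin n) → ℝ}
  {rbar : EuclideanSpace ℝ (Fin n) → ℝ≥0} {lamLow : EuclideanSpace ℝ (Fin n) → ℝ≥0} {Klam : ℝ≥0}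
  {ρ : ℝ} {h : D.E → ℝ}

/-- The policy `u` minimizes the running and the boundary Hamiltonians at the function `W`. -/
def IsMinimizing (D : PDMP n 𝕌) (h : D.E → ℝ) (W : EuclideanSpace ℝ (Fin n) → ℝ) (u : D.Policy) :
    Prop :=
  (∀ y ∈ D.E, ∀ a ∈ D.A y, D.ham h (W y) y (u.toFun y) ≤ D.ham h (W y) y a) ∧
    ∀ x : D.E, D.tstar x ≠ ⊤ → ∀ a ∈ D.A (D.exit x),
      D.bham h (D.exit x) (u.toFun (D.exit x)) ≤ D.bham h (D.exit x) a

/-- If two policies minimize the Hamiltonians at `V` and at a smaller `w`, and `V'` lies between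
`w` and `V`, then the Hamiltonian of the first policy at `V'` is close to that of the second policy
at `w`. -/
theorem abs_flowHam_sub_le {u u' v : D.Policy} {V V' w : EuclideanSpace ℝ (Fin n) → ℝ}
    (hv : ∀ y ∈ D.E, ∀ a ∈ D.A y, D.lam y a ≤ D.lam y (v.toFun y))
    (hu : D.IsMinimizing h V u) (hu' : D.IsMinimizing h w u') {y : EuclideanSpace ℝ (Fin n)}
    (hy : y ∈ D.E) (h1 : w y ≤ V' y) (h2 : V' y ≤ V y) :
    |D.flowHam ρ h u V' y - D.flowHam ρ h u' w y| ≤ D.lam y (v.toFun y) * (V y - w y) := by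
  have ha := u.mem_A y (subset_closure hy)
  have ha' := u'.mem_A y (subset_closure hy)
  have e1 := hu.1 y hy _ ha'
  have e2 := hu'.1 y hy _ ha
  have hl : (D.lam y (u.toFun y) : ℝ) ≤ D.lam y (v.toFun y) := hv y hy _ ha
  have hl0 : (0 : ℝ) ≤ D.lam y (u.toFun y) := NNReal.coe_nonneg _
  have hl0' : (0 : ℝ) ≤ D.lam y (u'.toFun y) := NNReal.coe_nonneg _
  simp only [flowHam, ham] at *
  rw [abs_le]
  have k1 : (D.lam y (u.toFun y) : ℝ) * (V' y - w y) ≤ D.lam y (v.toFun y) * (V y - w y) :=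
    mul_le_mul hl (by linarith) (by linarith) (hl0.trans hl)
  have k2 : (D.lam y (u.toFun y) : ℝ) * (V y - V' y) ≤ D.lam y (v.toFun y) * (V y - w y) :=
    mul_le_mul hl (by linarith) (by linarith) (hl0.trans hl)
  have k3 : 0 ≤ (D.lam y (u'.toFun y) : ℝ) * (V y - w y) := mul_nonneg hl0' (by linarith)
  constructor <;> linarith

variable [BorelSpace 𝕌] (hcont : D.ContinuityAssumptions)
  (hgrowth : D.GrowthCondition b c δ M g rbar)
  (hrate : D.JumpRateBounds c g lamLow Klam)

include hcont hgrowth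

/-- A monotone limit of flow solutions, produced by policy iteration, is a flow solution for a
policy that minimizes the Hamiltonians at the limit. -/
theorem isFlowSolution_of_tendsto (hh : D.MemBg g h) {v : D.Policy}
    (hv : ∀ y ∈ D.E, ∀ a ∈ D.A y, D.lam y a ≤ D.lam y (v.toFun y))
    {U : ℕ → D.Policy} {V : ℕ → EuclideanSpace ℝ (Fin n) → ℝ} {w : EuclideanSpace ℝ (Fin n) → ℝ}
    {u : D.Policy} (hVm : ∀ k, Measurable (V k)) (hwm : Measurable w) {C' : ℝ}
    (hVC : ∀ k, ∀ y ∈ D.E, |V k y| ≤ C' * g y)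
    (hV : ∀ k, D.IsFlowSolution g ρ h (U k) (V k)) (hU : ∀ k, D.IsMinimizing h (V k) (U (k + 1)))
    (hu : D.IsMinimizing h w u) (hanti : ∀ y, Antitone fun k => V k y)
    (hlim : ∀ y ∈ D.E, Tendsto (fun k => V k y) atTop (𝓝 (w y))) :
    D.IsFlowSolution g ρ h u w := by
  obtain ⟨hm, C, hC0, hC⟩ := (memBg_iff hgrowth.one_le_g).1 hh
  obtain ⟨Xg, hX, hd⟩ := hgrowth.exists_driftInequality
  have hwle : ∀ k, ∀ y ∈ D.E, w y ≤ V k y := fun k y hy => (hanti y).le_of_tendsto (hlim y hy) k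
  have hwC : ∀ y ∈ D.E, |w y| ≤ C' * g y := fun y hy =>
    le_of_tendsto ((continuous_abs.tendsto _).comp (hlim y hy))
      (Eventually.of_forall fun k => hVC k y hy)
  have hlim1 : ∀ y ∈ D.E, Tendsto (fun k => V (k + 1) y) atTop (𝓝 (w y)) := fun y hy =>
    (tendsto_add_atTop_iff_nat 1).2 (hlim y hy)
  have hbd : ∀ k, ∀ y ∈ D.E, ‖D.flowHam ρ h (U k) (V k) y‖ ≤ D.hamBound b c M g Xg v ρ C C' y :=
    fun k y hy => abs_flowHam_le hgrowth hd hv hC0 hC (hVC k) hy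
  have hbd' : ∀ y ∈ D.E, ‖D.flowHam ρ h u w y‖ ≤ D.hamBound b c M g Xg v ρ C C' y :=
    fun y hy => abs_flowHam_le hgrowth hd hv hC0 hC hwC hy
  have hconv : ∀ y ∈ D.E, Tendsto (fun k => D.flowHam ρ h (U (k + 1)) (V (k + 1)) y) atTop
      (𝓝 (D.flowHam ρ h u w y)) := by
    intro y hy
    rw [tendsto_iff_norm_sub_tendsto_zero]
    have h0 := ((hlim y hy).sub_const (w y)).const_mul (D.lam y (v.toFun y) : ℝ)
    rw [sub_self, mul_zero] at h0
    exact squeeze_zero (fun _ => norm_nonneg _) (fun k => abs_flowHam_sub_le hv (hU k) hu hy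
      (hwle _ y hy) (hanti y k.le_succ)) h0
  have hFm : ∀ k x, Measurable fun s => D.flowHam ρ h (U k) (V k) (D.path x s) := fun k x =>
    (measurable_flowHam hm (hVm k)).comp (D.measurable_path x)
  have hFm' : ∀ x, Measurable fun s => D.flowHam ρ h u w (D.path x s) := fun x =>
    (measurable_flowHam hm hwm).comp (D.measurable_path x)
  have hmem : ∀ (x : D.E), ∀ t ∈ timesBefore (D.tstar x), ∀ s ∈ Set.uIoc 0 t,
      D.path x s ∈ D.E := fun x t ht s hs => by
    rw [Set.uIoc_of_le ht.1] at hs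
    exact D.path_mem x (Icc_subset_timesBefore ht (Set.Ioc_subset_Icc_self hs))
  have hint : ∀ (x : D.E), ∀ t ∈ timesBefore (D.tstar x),
      IntervalIntegrable (fun s => D.flowHam ρ h u w (D.path x s)) volume 0 t := fun x t ht =>
    (intervalIntegrable_hamBound hcont hgrowth hX v ρ C C' x ht).mono_fun'
      (hFm' x).aestronglyMeasurable ((ae_restrict_mem measurableSet_uIoc).mono fun s hs =>
        hbd' _ (hmem x t ht s hs))
  have heq : ∀ (x : D.E), ∀ t ∈ timesBefore (D.tstar x),
      w (D.path x t) = w x - ∫ s in (0 : ℝ)..t, D.flowHam ρ h u w (D.path x s) := by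
    intro x t ht
    refine tendsto_nhds_unique (hlim1 _ (D.path_mem x ht)) ?_
    simp_rw [fun k => (hV (k + 1)).eq x t ht]
    refine (hlim1 x x.2).sub (intervalIntegral.tendsto_integral_filter_of_dominated_convergence _
      (Eventually.of_forall fun k => (hFm _ x).aestronglyMeasurable)
      (Eventually.of_forall fun k => ae_of_all _ fun s hs => hbd (k + 1) _ (hmem x t ht s hs))
      (intervalIntegrable_hamBound hcont hgrowth hX v ρ C C' x ht)
      (ae_of_all _ fun s hs => hconv _ (hmem x t ht s hs)))
  refine ⟨⟨C', hwC⟩, hint, heq, fun x hT => ?_⟩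
  have hmT := measurableSet_timesBefore (D.tstar x)
  have hbi := integrableOn_hamBound hcont hgrowth hX hd v ρ C C' x hT
  have hi : ∀ k, IntegrableOn (fun s => D.flowHam ρ h (U k) (V k) (D.path x s))
      (timesBefore (D.tstar x)) := fun k => hbi.mono' (hFm k x).aestronglyMeasurable
    ((ae_restrict_mem hmT).mono fun s hs => hbd k _ (D.path_mem x hs))
  have hi' : IntegrableOn (fun s => D.flowHam ρ h u w (D.path x s)) (timesBefore (D.tstar x)) :=
    hbi.mono' (hFm' x).aestronglyMeasurable
      ((ae_restrict_mem hmT).mono fun s hs => hbd' _ (D.path_mem x hs))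
  -- Up to the exit time, the equations of the approximations involve the same boundary value.
  have hstart : ∀ k, V (k + 1) x - ∫ s in timesBefore (D.tstar x),
      D.flowHam ρ h (U (k + 1)) (V (k + 1)) (D.path x s) =
        D.bham h (D.exit x) (u.toFun (D.exit x)) := by
    intro k
    have hB : D.bham h (D.exit x) ((U (k + 1)).toFun (D.exit x)) =
        D.bham h (D.exit x) (u.toFun (D.exit x)) :=
      le_antisymm ((hU k).2 x hT _ (u.mem_A _ (D.exit_mem_closure x)))
        (hu.2 x hT _ ((U (k + 1)).mem_A _ (D.exit_mem_closure x)))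
    have ht := (hV (k + 1)).terminal x hT
    rw [← exitFilter_of_ne_top hT, hB] at ht
    refine tendsto_nhds_unique ?_ ht
    refine ((tendsto_integral_exitFilter (D.tstar_pos x) (hi (k + 1))).const_sub
      (V (k + 1) x)).congr' ?_
    filter_upwards [eventually_mem_exitFilter (D.tstar_pos x)] with t ht
    exact ((hV (k + 1)).eq x t ht).symm
  have hstart' : w x - ∫ s in timesBefore (D.tstar x), D.flowHam ρ h u w (D.path x s) =
      D.bham h (D.exit x) (u.toFun (D.exit x)) := by
    have h1 := (hlim1 x x.2).sub (tendsto_integral_of_dominated_convergence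
      (μ := volume.restrict (timesBefore (D.tstar x))) _
      (fun k => (hFm (k + 1) x).aestronglyMeasurable) hbi
      (fun k => (ae_restrict_mem hmT).mono fun s hs => hbd (k + 1) _ (D.path_mem x hs))
      ((ae_restrict_mem hmT).mono fun s hs => hconv _ (D.path_mem x hs)))
    simp_rw [hstart] at h1
    exact (tendsto_nhds_unique h1 tendsto_const_nhds)
  rw [← exitFilter_of_ne_top hT, ← hstart']
  refine ((tendsto_integral_exitFilter (D.tstar_pos x) hi').const_sub (w x)).congr' ?_
  filter_upwards [eventually_mem_exitFilter (D.tstar_pos x)] with t ht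
  exact (heq x t ht).symm

include hrate

/-- The dynamic programming equation has a solution, which is the limit of policy iteration. -/
theorem exists_isFlowSolution_isMinimizing [CompactSpace 𝕌] (hh : D.MemBg g h)
    (hlow : ∀ ε > 0, ∃ C, 0 ≤ C ∧ ∀ x : D.E, -(ε * g x) - C ≤ h x) (u₀ : D.Policy) (ρ : ℝ) :
    ∃ (u : D.Policy) (w : EuclideanSpace ℝ (Fin n) → ℝ),
      D.IsFlowSolution g ρ h u w ∧ D.IsMinimizing h w u := by
  obtain ⟨v, hv⟩ := exists_policy_max_rate hcont u₀
  have hnext : ∀ u : D.Policy, ∃ u', D.IsMinimizing h (D.value ρ h u) u' := fun u =>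
    exists_policy_ham hcont hgrowth hh hlow u (measurable_value hh.1)
  choose next hnext using hnext
  set U : ℕ → D.Policy := fun k => next^[k] u₀ with hU
  have hUs : ∀ k, U (k + 1) = next (U k) := fun k => Function.iterate_succ_apply' next k u₀
  set V : ℕ → EuclideanSpace ℝ (Fin n) → ℝ := fun k => D.value ρ h (U k) with hVdef
  have hV : ∀ k, D.IsFlowSolution g ρ h (U k) (V k) := fun k =>
    isFlowSolution_value hcont hgrowth hrate hh
  have hmin : ∀ k, D.IsMinimizing h (V k) (U (k + 1)) := fun k => by
    rw [hUs]
    exact hnext (U k)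
  obtain ⟨C, -, hC⟩ := exists_abs_objR_le hcont hgrowth hrate hh ρ
  have hVE : ∀ k (x : D.E), V k x = D.objR ρ h x ((U k).feedback x) := fun k x => value_coe x
  have hVout : ∀ k, ∀ y ∉ D.E, V k y = 0 := fun k y hy =>
    Function.extend_apply' _ _ _ fun ⟨x, hx⟩ => hy (hx ▸ x.2)
  have hVC : ∀ k, ∀ y ∈ D.E, |V k y| ≤ C * g y := fun k y hy => by
    rw [hVE k ⟨y, hy⟩]
    exact hC ⟨y, hy⟩ _ ((U k).feedback_mem _)
  have hanti : ∀ y, Antitone fun k => V k y := fun y => antitone_nat_of_succ_le fun k => by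
    by_cases hy : y ∈ D.E
    · rw [hVE (k + 1) ⟨y, hy⟩]
      exact (hV k).objR_feedback_le hcont hgrowth hrate hh
        (fun z hz => (hmin k).1 z hz _ ((U k).mem_A z (subset_closure hz)))
        (fun x hT => (hmin k).2 x hT _ ((U k).mem_A _ (D.exit_mem_closure x))) ⟨y, hy⟩
    · rw [hVout _ y hy, hVout _ y hy]
  have hVm : ∀ k, Measurable (V k) := fun k => measurable_value hh.1
  set w : EuclideanSpace ℝ (Fin n) → ℝ := fun y => ⨅ k, V k y with hw
  have hwm : Measurable w := Measurable.iInf hVm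
  have hlim : ∀ y ∈ D.E, Tendsto (fun k => V k y) atTop (𝓝 (w y)) := fun y hy =>
    tendsto_atTop_ciInf (hanti y) ⟨-(C * g y), by
      rintro _ ⟨k, rfl⟩
      exact (abs_le.1 (hVC k y hy)).1⟩
  obtain ⟨u, hu⟩ := exists_policy_ham hcont hgrowth hh hlow u₀ hwm
  exact ⟨u, w, isFlowSolution_of_tendsto hcont hgrowth hh hv hVm hwm hVC hV hmin hu hanti hlim, hu⟩

/-- The minimal one-stage cost over all relaxed controls is attained by one policy. -/
theorem exists_policy_objR_le [CompactSpace 𝕌] (hh : D.MemBg g h)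
    (hlow : ∀ ε > 0, ∃ C, 0 ≤ C ∧ ∀ x : D.E, -(ε * g x) - C ≤ h x) (u₀ : D.Policy) (ρ : ℝ) :
    ∃ u : D.Policy, ∀ x : D.E, ∀ Θ ∈ D.relaxedControls x,
      D.objR ρ h x (u.feedback x) ≤ D.objR ρ h x Θ := by
  obtain ⟨u, w, hw, hmin⟩ :=
    exists_isFlowSolution_isMinimizing hcont hgrowth hrate hh hlow u₀ ρ
  refine ⟨u, fun x Θ hΘ => ?_⟩
  exact (hw.objR_feedback_le hcont hgrowth hrate hh (fun _ _ => le_rfl) (fun _ _ => le_rfl) x).trans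
    (hw.le_objR hcont hgrowth hrate hh hmin.1 hmin.2 hΘ)

/-- Passing from `u` to a policy with smaller one-stage costs does not increase the gain. -/
theorem gain_le {a κ : ℝ} {ν : D.Policy → Measure D.E} (herg : D.GeometricErgodicity g a κ ν)
    {u u' : D.Policy} {ρ' : ℝ} {h' : D.E → ℝ} (hp : D.IsPoissonPair g ν u ρ h)
    (hp' : D.IsPoissonPair g ν u' ρ' h')
    (hle : ∀ x, D.objR ρ h x (u'.feedback x) ≤ D.objR ρ h x (u.feedback x)) : ρ' ≤ ρ := by
  obtain ⟨hh, he, -⟩ := (isPoissonPair_iff hcont hgrowth hrate u ρ h).1 hp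
  have hI : ∀ {h : D.E → ℝ}, D.MemBg g h → Integrable h (ν u') := fun hh =>
    herg.integrable hgrowth.g_mac.measurable hgrowth.one_le_g u' hh
  have h1 : ∫ x, D.objR ρ h x (u'.feedback x) ∂(ν u') ≤ ∫ x, h x ∂(ν u') :=
    integral_mono (hI (memBg_objR hcont hgrowth hrate u' ρ hh)) (hI hh) fun x => by
      rw [he x]
      exact hle x
  rw [integral_objR hcont hgrowth hrate herg u' ρ hh,
    ← gain_eq hcont hgrowth hrate herg u' hp'] at h1
  have hpos := integral_L_one_pos hcont hgrowth hrate herg u'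
  refine le_of_mul_le_mul_right ?_ hpos
  linarith

end PDMP
end

/-- Every policy `u` has exactly one normalized solution `(ρ_u, h_u)` of its pseudo-Poisson
equation; the infimum `ℛ(ρ_u,h_u)(x)`, all of whose terms are finite, is attained for all `x` at the
feedback control of one policy `u'`, and `ρ_{u'} ≤ ρ_u`. -/
theorem proposition4p4 {n : ℕ} {𝕌 : Type*} [MetricSpace 𝕌] [CompactSpace 𝕌]
    [MeasurableSpace 𝕌] [BorelSpace 𝕌] (D : PDMP n 𝕌)
    (b c δ M : ℝ) (g : EuclideanSpace ℝ (Fin n) → ℝ) (rbar : EuclideanSpace ℝ (Fin n) → ℝ≥0)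
    (a κ : ℝ) (ν : D.Policy → Measure D.E) (kg Kg : ℝ)
    (lamLow : EuclideanSpace ℝ (Fin n) → ℝ≥0) (Klam : ℝ≥0)
    (hcont : D.ContinuityAssumptions)
    (hgrowth : D.GrowthCondition b c δ M g rbar)
    (herg : D.GeometricErgodicity g a κ ν)
    (hlyap : D.LyapunovCondition g kg Kg)
    (hrate : D.JumpRateBounds c g lamLow Klam) :
    (∀ u : D.Policy, ∃! p : ℝ × (D.E → ℝ), D.IsPoissonPair g ν u p.1 p.2) ∧
    ∀ (u : D.Policy) (ρ : ℝ) (h : D.E → ℝ), D.IsPoissonPair g ν u ρ h →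
      (∀ x : D.E, ∀ Θ ∈ D.relaxedControls x, D.ObjectiveFinite h x Θ) ∧
      ∃ u' : D.Policy,
        (∀ x : D.E, D.R ρ h x = D.objective ρ h x (u'.feedback x)) ∧
        ∀ (ρ' : ℝ) (h' : D.E → ℝ), D.IsPoissonPair g ν u' ρ' h' → ρ' ≤ ρ := by
  refine ⟨fun u => ?_, fun u ρ h hp => ?_⟩
  · obtain ⟨ρ, h, hp⟩ := PDMP.exists_poissonPair hcont hgrowth hrate herg u
    refine ⟨(ρ, h), hp, fun q hq => ?_⟩
    obtain ⟨h1, h2⟩ := PDMP.poissonPair_unique hcont hgrowth hrate herg u hq hp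
    exact Prod.ext h1 h2
  · have hh := hp.memBg
    obtain ⟨u', hu'⟩ := PDMP.exists_policy_objR_le hcont hgrowth hrate hh
      (fun ε hε => hp.exists_lower_bound hcont hgrowth hrate herg hε) u ρ
    refine ⟨fun x Θ hΘ => PDMP.objectiveFinite hcont hgrowth hrate hh hΘ, u', fun x => ?_,
      fun ρ' h' hp' => PDMP.gain_le hcont hgrowth hrate herg hp hp'
        fun x => hu' x _ (u.feedback_mem x)⟩
    refine le_antisymm (iInf₂_le _ (u'.feedback_mem x)) (le_iInf₂ fun Θ hΘ => ?_)
    rw [PDMP.objective_eq hcont hgrowth hrate hh ρ (u'.feedback_mem x),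
      PDMP.objective_eq hcont hgrowth hrate hh ρ hΘ]
    exact EReal.coe_le_coe (hu' x Θ hΘ)
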